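/- **Setting.** Let $\mathbb H$ be the quaternions with units $e_0=1,e_1,e_2,e_3$, let $\mathbb S$ be the sphere of imaginary units $J$ and $\mathbb C_J=\mathbb R+J\mathbb R$. For $0<\omega\le\pi$ let $S_\omega=\{s\in\mathbb H\setminus\{0\}:|\operatorname{Arg}s|<\omega\}$. A function $f:S_\theta\to\mathbb H$ is left slice hyperholomorphic if $f(x+Jy)=a(x,y)+Jb(x,y)$ for all $J\in\mathbb S$, with $C^1$ functions $a,b$ that are respectively even and odd in $y$ and satisfy the Cauchy–Riemann equations; it is intrinsic if $a,b$ are real valued. $\Psi_L^{a,b}(S_\theta)$ (resp. $\Psi^{a,b}(S_\theta)$) is the set of left slice hyperholomorphic (resp. intrinsic) $f$ for which there are $\delta>0$, $C\ge 0$ with $|f(s)|\le C|s|^{a-1+\delta}$ for $|s|\le1$ and $|f(s)|\le C|s|^{b-1-\delta}$ for $|s|\ge1$. Let $V$ be a two-sided quaternionic Banach space. A right linear operator $T$ in $V$ with two-sided linear domain has unique two-sided linear components $T_i$, with $T=\sum_{i=0}^3e_iT_i$ on $\operatorname{dom}T$; put $\overline T=T_0-\sum_{i=1}^3e_iT_i$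 on $\operatorname{dom}T$, and $|T|^2=\sum_iT_i^2$ on $\operatorname{dom}|T|^2=\bigcap_i\operatorname{dom}T_i^2$. $T$ has commuting components if $T_iT_jv=T_jT_iv$ for all $v\in\operatorname{dom}|T|^2$ and all $i,j$. Let $D\subseteq\operatorname{dom}|T|^2$ be a dense two-sided linear subspace such that $T_iv\in D$ for all $i$ whenever $v\in D$ and $|T|^2v\in\operatorname{dom}T$, and such that $Q_{c,s}(T)=s^2-2sT_0+|T|^2$ with domain $D$ is closed for every $s\in\mathbb H$. Put $\rho_F(T)=\{s: Q_{c,s}(T)\text{ is bijective from }D\text{ onto }V\}$, $\sigma_F(T)=\mathbb H\setminus\rho_F(T)$, and for $s\in\rho_F(T)$ $$S_L^{-1}(s,T)=(s-\overline T)Q_{c,s}^{-1}(T),\quad P_2^L(s,T)=2S_L^{-1}(s,T)\big(S_L^{-1}(s,T)+S_L^{-1}(s,\overline T)\big),\quad F_L(s,T)=-4S_L^{-1}(s,T)Q_{c,s}^{-1}(T).$$ $T$ (with $D$) is of type $(\alpha,\beta,\omega)$ if $T,\overline T$ are closed with commuting components, $\sigma_F(T)\subseteq\overline{S_\omega}$,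 and for every $\varphi\in(\omega,\pi)$ there is $C_\varphi\ge 0$ such that, for all $s\in\mathbb H\setminus S_\varphi$ with $s\neq0$, $\|S_L^{-1}(s,T)\|\le C_\varphi|s|^{-\alpha}$ if $|s|\le1$ and $\|S_L^{-1}(s,T)\|\le C_\varphi|s|^{-\beta}$ if $|s|\ge1$. The $S$-, $Q$-, $P_2$- and $F$-functional calculi of $f$ are the integrals $$\frac1{2\pi}\int_{\partial(S_\varphi\cap\mathbb C_J)}K_L(s,T)\,ds_J\,f(s)=\frac1{2\pi}\int_{\mathbb R}K_L(\gamma(t),T)\frac{\gamma'(t)}{J}f(\gamma(t))\,dt,\qquad \varphi\in(\omega,\theta),\ J\in\mathbb S,$$ with $\gamma(t)=-te^{J\varphi}$ for $t<0$ and $\gamma(t)=te^{-J\varphi}$ for $t>0$, written $f(T)$, $\mathcal Df(T)$, $\overline{\mathcal D}f(T)$, $\Delta f(T)$ for the kernels $K_L=S_L^{-1},\,-2Q_{c,s}^{-1},\,P_2^L,\,F_L$ respectively; the calculi of $\overline T$ use the same $D$. Such a calculus is called *defined* for $f$ if these integrals converge absolutely in operator norm for all $\varphi\in(\omega,\theta)$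 and $J\in\mathbb S$. **Theorem.** Let $\alpha\ge\frac13$, $\beta\in(0,\frac13]$, $\omega\in(0,\pi)$, $\theta\in(\omega,\pi)$, and let $T$ (with $D$) be of type $(\alpha,\beta,\omega)$. (a) For both $T$ and $\overline T$, the $S$-calculus is defined for every $h\in\Psi_L^{3\alpha,\beta}(S_\theta)$, the $Q$- and the $P_2$-calculus for every $h\in\Psi_L^{3\alpha,2\beta}(S_\theta)$, and the $F$-calculus for every $h\in\Psi_L^{3\alpha,3\beta}(S_\theta)$. If $h\in\Psi_L^{3\alpha,3\beta}(S_\theta)$ and one of the four calculi of $T$ or of $\overline T$ is defined for $h$, its value depends neither on $\varphi$ nor on $J$. (b) Let $g\in\Psi^{3\alpha,3\beta}(S_\theta)$ and $f\in\Psi_L^{3\alpha,3\beta}(S_\theta)$. Then $gf\in\Psi_L^{3\alpha,3\beta}(S_\theta)$, and each of the following formulas holds whenever all terms on its right hand side are defined; its left hand side is then defined as well. In particular all of them hold if moreover $g\in\Psi^{3\alpha,\beta}(S_\theta)$ and $f\in\Psi_L^{3\alpha,\beta}(S_\theta)$. $$\begin{aligned} \text{i)}\quad (gf)(T)&=g(T)f(T),\\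 \text{ii)}\quad \mathcal D(gf)(T)&=\mathcal Dg(T)f(T)+g(\overline T)\,\mathcal Df(T)\quad\text{and}\quad \mathcal D(gf)(T)=\mathcal Dg(T)f(\overline T)+g(T)\,\mathcal Df(T),\\ \text{iii)}\quad \overline{\mathcal D}(gf)(T)&=\overline{\mathcal D}g(T)f(T)+g(T)\overline{\mathcal D}f(T)+\mathcal Dg(T)\big(f(T)-f(\overline T)\big),\\ \text{iv)}\quad \Delta(gf)(T)&=\Delta g(T)f(T)+g(T)\Delta f(T)-\mathcal Dg(T)\,\mathcal Df(T). \end{aligned}$$ -/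

import Mathlib

open MeasureTheory Set
open scoped Quaternion

namespace FineStructure

noncomputable section

/-! ### Quaternions, sectors and slice hyperholomorphic functions -/

/-- The imaginary units `e₁, e₂, e₃`. -/
def e₁ : ℍ[ℝ] := ⟨0, 1, 0, 0⟩

def e₂ : ℍ[ℝ] := ⟨0, 0, 1, 0⟩

def e₃ : ℍ[ℝ] := ⟨0, 0, 0, 1⟩

/-- The basis `1, e₁, e₂, e₃` of the quaternions. -/
def e : Fin 4 → ℍ[ℝ] := ![1, e₁, e₂, e₃]

/-- The sphere `𝕊` of purely imaginary unit quaternions. -/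
def imSphere : Set ℍ[ℝ] := {J | J.re = 0 ∧ ‖J‖ = 1}

/-- The open sector `S_ω`. For `s = x + J y ≠ 0` the modulus `|Arg s| ∈ [0, π]` of the argument of
`s` in the plane `ℂ_J` is `arccos (x / |s|)`. -/
def sector (ω : ℝ) : Set ℍ[ℝ] := {s | s ≠ 0 ∧ Real.arccos (s.re / ‖s‖) < ω}

/-- The point `x + J y`. -/
def slicePt (J : ℍ[ℝ]) (p : ℝ × ℝ) : ℍ[ℝ] := (p.1 : ℍ[ℝ]) + J * (p.2 : ℍ[ℝ])

/-- The set of all `(x, y) ∈ ℝ²` with `x + 𝕊 y ⊆ U`. -/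
def reduced (U : Set ℍ[ℝ]) : Set (ℝ × ℝ) := {p | ∀ J ∈ imSphere, slicePt J p ∈ U}

/-- `f (x + J y) = a (x, y) + J b (x, y)` on the axially symmetric open set `U`, with continuously
differentiable `a, b` that satisfy the even-odd conditions and the Cauchy-Riemann equations. -/
structure IsLeftSliceDecomp (U : Set ℍ[ℝ]) (f : ℍ[ℝ] → ℍ[ℝ]) (a b : ℝ × ℝ → ℍ[ℝ]) : Prop where
  contDiffOn_a : ContDiffOn ℝ 1 a (reduced U)
  contDiffOn_b : ContDiffOn ℝ 1 b (reduced U)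
  decomp : ∀ p ∈ reduced U, ∀ J ∈ imSphere, f (slicePt J p) = a p + J * b p
  even_a : ∀ p ∈ reduced U, a (p.1, -p.2) = a p
  odd_b : ∀ p ∈ reduced U, b (p.1, -p.2) = -b p
  cauchyRiemann₁ : ∀ p ∈ reduced U, fderiv ℝ a p (1, 0) = fderiv ℝ b p (0, 1)
  cauchyRiemann₂ : ∀ p ∈ reduced U, fderiv ℝ a p (0, 1) = -fderiv ℝ b p (1, 0)

/-- The class `SH_L(U)` of left slice hyperholomorphic functions. -/
def IsLeftSlice (U : Set ℍ[ℝ]) (f : ℍ[ℝ] → ℍ[ℝ]) : Prop :=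
  ∃ a b, IsLeftSliceDecomp U f a b

/-- The class `N(U)` of intrinsic functions: `a` and `b` are real valued. -/
def IsIntrinsic (U : Set ℍ[ℝ]) (f : ℍ[ℝ] → ℍ[ℝ]) : Prop :=
  ∃ a b, IsLeftSliceDecomp U f a b ∧ ∀ p ∈ reduced U, (a p).im = 0 ∧ (b p).im = 0

/-- The bound `|f(s)| ≤ C |s|^(α-1+δ)` for `|s| ≤ 1` and `|f(s)| ≤ C |s|^(β-1-δ)` for `|s| ≥ 1` on
`S_θ`, for some `δ > 0` and `C ≥ 0`. -/
def Decays (α β θ : ℝ) (f : ℍ[ℝ] → ℍ[ℝ]) : Prop :=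
  ∃ δ > (0 : ℝ), ∃ C ≥ (0 : ℝ), ∀ s ∈ sector θ,
    (‖s‖ ≤ 1 → ‖f s‖ ≤ C * ‖s‖ ^ (α - 1 + δ)) ∧ (1 ≤ ‖s‖ → ‖f s‖ ≤ C * ‖s‖ ^ (β - 1 - δ))

/-- The class `Ψ_L^{α,β}(S_θ)`. -/
def PsiL (α β θ : ℝ) : Set (ℍ[ℝ] → ℍ[ℝ]) := {f | IsLeftSlice (sector θ) f ∧ Decays α β θ f}

/-- The class `Ψ^{α,β}(S_θ)` of intrinsic functions. -/
def Psi (α β θ : ℝ) : Set (ℍ[ℝ] → ℍ[ℝ]) := {f | IsIntrinsic (sector θ) f ∧ Decays α β θ f}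

/-! ### Operators on a two-sided quaternionic Banach space

Left scalars are an action of `ℍ[ℝ]`, right scalars one of `ℍ[ℝ]ᵐᵒᵖ`. -/

section Operators

variable (V : Type*) [NormedAddCommGroup V] [NormedSpace ℝ V]
  [Module ℍ[ℝ] V] [Module ℍ[ℝ]ᵐᵒᵖ V] [SMulCommClass ℍ[ℝ] ℍ[ℝ]ᵐᵒᵖ V]

/-- A right linear operator `T : V → V` whose domain is a two-sided linear subspace. -/
structure RightOp where
  toPMap : V →ₗ.[ℍ[ℝ]ᵐᵒᵖ] V
  smul_mem : ∀ (q : ℍ[ℝ]) (v : V), v ∈ toPMap.domain → q • v ∈ toPMap.domain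

variable {V}

/-- Left multiplication by a quaternion, as a right linear map. -/
def leftMul (q : ℍ[ℝ]) : V →ₗ[ℍ[ℝ]ᵐᵒᵖ] V where
  toFun v := q • v
  map_add' := smul_add q
  map_smul' r v := smul_comm q r v

namespace RightOp

/-- `dom T`. -/
def dom (T : RightOp V) : Submodule ℍ[ℝ]ᵐᵒᵖ V := T.toPMap.domain

/-- The component `T_i = (e_i / 4) (e_i T e_i - ∑_{j ≠ i} e_j T e_j)` on `dom T`. -/
def compMap (T : RightOp V) (i : Fin 4) : T.toPMap.domain →ₗ[ℍ[ℝ]ᵐᵒᵖ] V :=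
  leftMul (((4⁻¹ : ℝ) : ℍ[ℝ]) * e i) ∘ₗ
    ∑ j, leftMul (if j = i then e j else -e j) ∘ₗ T.toPMap.toFun ∘ₗ
      (leftMul (V := V) (e j)).restrict (p := T.toPMap.domain) (q := T.toPMap.domain)
        (fun v hv => T.smul_mem (e j) v hv)

open Classical in
/-- The component `T_i` as a function on `V`, with the value `0` off `dom T` (never used there). -/
def comp (T : RightOp V) (i : Fin 4) (v : V) : V :=
  if h : v ∈ T.toPMap.domain then T.compMap i ⟨v, h⟩ else 0

open Classical in
/-- `T v`, with the value `0` off `dom T` (never used there). -/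
def app (T : RightOp V) (v : V) : V :=
  if h : v ∈ T.toPMap.domain then T.toPMap ⟨v, h⟩ else 0

/-- The conjugate `T_0 - e₁ T_1 - e₂ T_2 - e₃ T_3`, with the domain of `T`. -/
def conj (T : RightOp V) : RightOp V where
  toPMap :=
    { domain := T.toPMap.domain
      toFun := leftMul (e 0) ∘ₗ T.compMap 0 - leftMul (e 1) ∘ₗ T.compMap 1
        - leftMul (e 2) ∘ₗ T.compMap 2 - leftMul (e 3) ∘ₗ T.compMap 3 }
  smul_mem := T.smul_mem

/-- `dom |T|²`, the intersection of the domains of `T_0², …, T_3²`. -/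
def domSq (T : RightOp V) : Set V := {v | v ∈ T.dom ∧ ∀ i, T.comp i v ∈ T.dom}

/-- `|T|² = T_0² + T_1² + T_2² + T_3²`. -/
def absSq (T : RightOp V) (v : V) : V := ∑ i, T.comp i (T.comp i v)

/-- The class `KC(V)` of closed operators with commuting components. -/
def IsKC (T : RightOp V) : Prop :=
  IsClosed (T.toPMap.graph : Set (V × V)) ∧ ∀ v ∈ T.domSq, ∀ i j, T.comp i (T.comp j v) = T.comp j (T.comp i v)

/-- `Q_{c,s}(T) = s² - 2 s T_0 + |T|²`. -/
def Q (T : RightOp V) (s : ℍ[ℝ]) (v : V) : V :=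
  s ^ 2 • v - (2 * s) • T.comp 0 v + T.absSq v

/-- `D` is an admissible common domain of the operators `Q_{c,s}(T)`. -/
structure IsAdmissibleDomain (T : RightOp V) (D : Submodule ℍ[ℝ]ᵐᵒᵖ V) : Prop where
  smul_mem : ∀ (q : ℍ[ℝ]) (v : V), v ∈ D → q • v ∈ D
  dense : Dense (D : Set V)
  subset_domSq : (D : Set V) ⊆ T.domSq
  comp_mem : ∀ v ∈ D, T.absSq v ∈ T.dom → ∀ i, T.comp i v ∈ D
  isClosed_Q : ∀ s, IsClosed {p : V × V | p.1 ∈ D ∧ p.2 = T.Q s p.1}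

/-- The `F`-spectrum: all `s` for which `Q_{c,s}(T) : D → V` is not bijective. -/
def specF (T : RightOp V) (D : Submodule ℍ[ℝ]ᵐᵒᵖ V) : Set ℍ[ℝ] :=
  {s | ¬ BijOn (T.Q s) (D : Set V) univ}

open Classical in
/-- The bounded operator with underlying function `F` (and `0` if `F` is not a bounded operator).
Bounded operators are viewed as continuous real linear maps, with the operator norm; for right
linear maps this is the usual space `B(V)` with its norm. -/
def toBounded (F : V → V) : V →L[ℝ] V :=
  if h : ∃ A : V →L[ℝ] V, ⇑A = F then h.choose else 0

/-- `Q_{c,s}⁻¹(T)`, for `s` in the `F`-resolvent set. -/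
def Qinv (T : RightOp V) (D : Submodule ℍ[ℝ]ᵐᵒᵖ V) (s : ℍ[ℝ]) : V →L[ℝ] V :=
  toBounded (Function.invFunOn (T.Q s) (D : Set V))

/-- The left `S`-resolvent `S_L⁻¹(s, T) = (s - T̄) Q_{c,s}⁻¹(T)`. -/
def SL (T : RightOp V) (D : Submodule ℍ[ℝ]ᵐᵒᵖ V) (s : ℍ[ℝ]) : V →L[ℝ] V :=
  toBounded fun v => s • T.Qinv D s v - T.conj.app (T.Qinv D s v)

/-- The left `P₂`-resolvent `2 S_L⁻¹(s, T) (S_L⁻¹(s, T) + S_L⁻¹(s, T̄))`. -/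
def P2L (T : RightOp V) (D : Submodule ℍ[ℝ]ᵐᵒᵖ V) (s : ℍ[ℝ]) : V →L[ℝ] V :=
  (2 : ℝ) • (T.SL D s * (T.SL D s + T.conj.SL D s))

/-- The left `F`-resolvent `-4 S_L⁻¹(s, T) Q_{c,s}⁻¹(T)`. -/
def FL (T : RightOp V) (D : Submodule ℍ[ℝ]ᵐᵒᵖ V) (s : ℍ[ℝ]) : V →L[ℝ] V :=
  (-4 : ℝ) • (T.SL D s * T.Qinv D s)

/-- `T`, together with `D`, is an operator of type `(α, β, ω)`. -/
structure IsOfType (T : RightOp V) (D : Submodule ℍ[ℝ]ᵐᵒᵖ V) (α β ω : ℝ) : Prop where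
  isKC : T.IsKC
  isKC_conj : T.conj.IsKC
  admissible : T.IsAdmissibleDomain D
  specF_subset : T.specF D ⊆ closure (sector ω)
  bound : ∀ φ ∈ Ioo ω Real.pi, ∃ C ≥ (0 : ℝ), ∀ s ∉ sector φ, s ≠ 0 →
    (‖s‖ ≤ 1 → ‖T.SL D s‖ ≤ C * ‖s‖ ^ (-α)) ∧ (1 ≤ ‖s‖ → ‖T.SL D s‖ ≤ C * ‖s‖ ^ (-β))

end RightOp

/-! ### The functional calculi -/

/-- The four functional calculi `f(T)`, `𝒟f(T)`, `𝒟̄f(T)`, `Δf(T)`. -/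
inductive Calculus
  | S
  | Q
  | P2
  | F

/-- The kernel `K_L(s, T)` of each functional calculus, normalized so that the calculus is
`(1 / 2π) ∫ K_L(s, T) ds_J f(s)`. -/
def Calculus.kernel (k : Calculus) (T : RightOp V) (D : Submodule ℍ[ℝ]ᵐᵒᵖ V) (s : ℍ[ℝ]) :
    V →L[ℝ] V :=
  match k with
  | .S => T.SL D s
  | .Q => (-2 : ℝ) • T.Qinv D s
  | .P2 => T.P2L D s
  | .F => T.FL D s

/-- The number of factors of the size of the `S`-resolvent in the kernel. -/
def Calculus.order : Calculus → ℝ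
  | .S => 1
  | .Q => 2
  | .P2 => 2
  | .F => 3

/-- The parametrization `γ(t) = -t e^{Jφ}` for `t < 0`, `γ(t) = t e^{-Jφ}` for `t > 0`, of the
boundary of `S_φ ∩ ℂ_J`. -/
def path (φ : ℝ) (J : ℍ[ℝ]) (t : ℝ) : ℍ[ℝ] :=
  if t < 0 then ((-t : ℝ) : ℍ[ℝ]) * slicePt J (Real.cos φ, Real.sin φ)
  else (t : ℍ[ℝ]) * slicePt J (Real.cos φ, -Real.sin φ)

variable [IsScalarTower ℝ ℍ[ℝ] V] [NormSMulClass ℍ[ℝ] V]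

/-- The integrand of `∫ K_L(s, T) ds_J f(s)` along the boundary of `S_φ ∩ ℂ_J`, which is
`K_L(γ(t), T) (γ'(t) / J) f(γ(t))`; the quaternion `(γ'(t) / J) f(γ(t))` acts by left
multiplication on `V`. -/
def Calculus.integrand (k : Calculus) (T : RightOp V) (D : Submodule ℍ[ℝ]ᵐᵒᵖ V) (φ : ℝ)
    (J : ℍ[ℝ]) (f : ℍ[ℝ] → ℍ[ℝ]) (t : ℝ) : V →L[ℝ] V :=
  k.kernel T D (path φ J t) *
    ContinuousLinearMap.lsmul ℝ ℍ[ℝ] (deriv (path φ J) t * J⁻¹ * f (path φ J t))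

/-- The functional calculus `(1 / 2π) ∫ K_L(s, T) ds_J f(s)` along the boundary of
`S_φ ∩ ℂ_J`. -/
def Calculus.eval (k : Calculus) (T : RightOp V) (D : Submodule ℍ[ℝ]ᵐᵒᵖ V) (φ : ℝ)
    (J : ℍ[ℝ]) (f : ℍ[ℝ] → ℍ[ℝ]) : V →L[ℝ] V :=
  (2 * Real.pi)⁻¹ • ∫ t : ℝ, k.integrand T D φ J f t

/-- The integrals that define the functional calculus of `f` are all absolutely convergent. -/
def Calculus.Converges (k : Calculus) (T : RightOp V) (D : Submodule ℍ[ℝ]ᵐᵒᵖ V) (ω θ : ℝ)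
    (f : ℍ[ℝ] → ℍ[ℝ]) : Prop :=
  ∀ φ ∈ Ioo ω θ, ∀ J ∈ imSphere, Integrable (k.integrand T D φ J f)

end Operators

end

end FineStructure

open FineStructure

/-! Right multiplication by the plane spanned by 1 and `e₁` makes V a complex Banach space. Right
linear operators and left multiplications by quaternions are complex linear for it, so a complex
scalar z commutes with T, with its components and with every left multiplication. This turns the
noncommutative calculus into an ordinary one: Q_z = z² - 2zT₀ + |T|² factors as (z - T)(z - T̄),
because T + T̄ = 2T₀ and, for commuting components, T T̄ = |T|². Its inverse is therefore ρ(z) =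
R(z) R̄(z), where R and R̄ are the ordinary resolvents of T and T̄ (`IsCoreIn.rho_comp`,
`IsCoreIn.resol_mul_conj_resol`). All four kernels are polynomials in the commuting operators R(z)
and R̄(z), and the product rules reflect identities that follow from the two classical resolvent
equations by commutative algebra (`commuting_resolvent_identities`).

The quaternionic objects are recovered by diagonalizing left multiplication by J. As J² = -1, the
operators P = (1 - iJ)/2 and M = (1 + iJ)/2 are complementary projections, and x + Jy acts as z = x
+ iy on the range of P and as its conjugate on the range of M. Hence the quaternionic kernel at x +
Jy is K(z)P + K(z̄)M, and left multiplication by f(x + Jy) is P F(z) + M F(z̄), where F = a + ib is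
operator valued and holomorphic. When the contributions of the two conjugate rays are added, P + M =
1 eliminates J, and the calculus becomes (2πi)⁻¹ ∫ K(z) F(z) dz (`Calculus.planeIntegrand_conj_sub`,
`Calculus.eval_eq`). This gives independence of J; independence of the angle is Cauchy's theorem.

For the product rules the integral of f is moved to a slightly larger sector. The resolvent identity
(w - z) ∑ p_j(z) q_j(w) = K(z) - K(w) splits the double integral into two parts. By Fubini and
Cauchy's formula the part with K(z) yields 2πi ∫ K G F dz, and the part with K(w) vanishes because w
lies outside the inner sector (`sum_contourIntegral_mul`). That g is intrinsic makes G scalar, so it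
passes through all operators.

The analysis is done in the coordinate η = log z, in which sectors are strips and rays are
horizontal lines. Since 3α ≥ 1 and 3β ≤ 1, the symbols F and G decay exponentially in the strip, so
Cauchy's formula applies to them even where the operator valued integrands are only assumed
absolutely integrable. Moving those integrands between angles needs a regularizing factor
(`integral_line_eq_of_growth`). -/

namespace FineStructure
noncomputable section

set_option linter.unusedSectionVars false

/-! ### Contour shifts in a horizontal strip. -/

section StripAnalysis

open Filter Topology

variable {E : Type*} [NormedAddCommGroup E]

/-- Exponential decay at both ends of the strip `c ≤ Im η ≤ d`. -/
def ExpDecay (H : ℂ → E) (c d : ℝ) : Prop :=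
  ∃ C, ∃ δ > (0 : ℝ), ∃ R, ∀ η : ℂ, c ≤ η.im → η.im ≤ d → R ≤ |η.re| →
    ‖H η‖ ≤ C * Real.exp (-δ * |η.re|)

theorem ExpDecay.add {H G : ℂ → E} {c d : ℝ} (h : ExpDecay H c d) (g : ExpDecay G c d) :
    ExpDecay (fun η => H η + G η) c d := by
  obtain ⟨C, δ, hδ, R, h⟩ := h
  obtain ⟨C', δ', hδ', R', g⟩ := g
  refine ⟨|C| + |C'|, min δ δ', lt_min hδ hδ', max R R', fun η h1 h2 h3 => ?_⟩
  have k1 := h η h1 h2 ((le_max_left _ _).trans h3)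
  have k2 := g η h1 h2 ((le_max_right _ _).trans h3)
  have a0 := abs_nonneg η.re
  have e1 : Real.exp (-δ * |η.re|) ≤ Real.exp (-(min δ δ') * |η.re|) :=
    Real.exp_le_exp.2 (by nlinarith [min_le_left δ δ'])
  have e2 : Real.exp (-δ' * |η.re|) ≤ Real.exp (-(min δ δ') * |η.re|) :=
    Real.exp_le_exp.2 (by nlinarith [min_le_right δ δ'])
  calc ‖H η + G η‖ ≤ ‖H η‖ + ‖G η‖ := norm_add_le _ _
    _ ≤ |C| * Real.exp (-(min δ δ') * |η.re|) + |C'| * Real.exp (-(min δ δ') * |η.re|) := by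
        refine add_le_add (k1.trans ?_) (k2.trans ?_)
        · exact mul_le_mul (le_abs_self _) e1 (Real.exp_pos _).le (abs_nonneg _)
        · exact mul_le_mul (le_abs_self _) e2 (Real.exp_pos _).le (abs_nonneg _)
    _ = _ := by ring

/-- The point `u + i c`. -/
def linePt (c u : ℝ) : ℂ := (u : ℂ) + (c : ℂ) * Complex.I

@[simp] theorem linePt_re (c u : ℝ) : (linePt c u).re = u := by simp [linePt]
@[simp] theorem linePt_im (c u : ℝ) : (linePt c u).im = c := by simp [linePt]

@[fun_prop]
theorem continuous_linePt (c : ℝ) : Continuous (linePt c) := by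
  unfold linePt; fun_prop

theorem continuous_comp_linePt {X : Type*} [TopologicalSpace X] {H : ℂ → X} {c : ℝ}
    (h : ∀ η : ℂ, η.im = c → ContinuousAt H η) : Continuous fun u => H (linePt c u) :=
  continuous_iff_continuousAt.2 fun u =>
    ContinuousAt.comp (h _ (linePt_im c u)) (continuous_linePt c).continuousAt

theorem integrable_exp_neg_abs {δ : ℝ} (hδ : 0 < δ) :
    Integrable fun u : ℝ => Real.exp (-δ * |u|) := by
  refine (Continuous.locallyIntegrable (by fun_prop)).integrable_of_isBigO_atBot_atTop
    (g := fun u => Real.exp (δ * u)) (g' := fun u => Real.exp (-δ * u)) ?_ ?_ ?_ ?_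
  · refine (Asymptotics.isBigO_refl _ _).congr' ?_ EventuallyEq.rfl
    filter_upwards [eventually_le_atBot 0] with u hu
    rw [abs_of_nonpos hu]; ring_nf
  · exact ⟨Iic 0, Iic_mem_atBot 0, integrableOn_exp_mul_Iic hδ 0⟩
  · refine (Asymptotics.isBigO_refl _ _).congr' ?_ EventuallyEq.rfl
    filter_upwards [eventually_ge_atTop 0] with u hu
    rw [abs_of_nonneg hu]
  · exact ⟨Ioi 0, Ioi_mem_atTop 0, exp_neg_integrableOn_Ioi 0 hδ⟩

theorem integrable_of_exp_decay {f : ℝ → E} (hf : Continuous f) {C δ R : ℝ} (hδ : 0 < δ)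
    (h : ∀ u, R ≤ |u| → ‖f u‖ ≤ C * Real.exp (-δ * |u|)) : Integrable f := by
  have hi := (integrable_exp_neg_abs hδ).const_mul C
  refine hf.locallyIntegrable.integrable_of_isBigO_atBot_atTop
    (g := fun u => C * Real.exp (-δ * |u|)) (g' := fun u => C * Real.exp (-δ * |u|)) ?_
    (hi.integrableAtFilter _) ?_ (hi.integrableAtFilter _)
  · refine Asymptotics.IsBigO.of_bound 1 ?_
    filter_upwards [tendsto_abs_atBot_atTop.eventually_ge_atTop R] with u hu
    rw [one_mul]; exact (h u hu).trans (le_abs_self _)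
  · refine Asymptotics.IsBigO.of_bound 1 ?_
    filter_upwards [tendsto_abs_atTop_atTop.eventually_ge_atTop R] with u hu
    rw [one_mul]; exact (h u hu).trans (le_abs_self _)

theorem ExpDecay.integrable {H : ℂ → E} {c d : ℝ} (h : ExpDecay H c d) {y : ℝ} (hy : c ≤ y)
    (hy' : y ≤ d) (hc : ∀ η : ℂ, η.im = y → ContinuousAt H η) :
    Integrable fun u => H (linePt y u) := by
  obtain ⟨C, δ, hδ, R, h⟩ := h
  refine integrable_of_exp_decay (continuous_comp_linePt hc) hδ (C := C) (R := R) fun u hu => ?_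
  simpa using h (linePt y u) (by simpa) (by simpa) (by simpa)

variable [NormedSpace ℂ E]

/-- Shifting a line of integration inside a strip of holomorphy. -/
theorem integral_line_eq {H : ℂ → E} {c d : ℝ} (hcd : c ≤ d)
    (hH : ∀ η : ℂ, c ≤ η.im → η.im ≤ d → DifferentiableAt ℂ H η) (hd : ExpDecay H c d) :
    ∫ u, H (linePt c u) = ∫ u, H (linePt d u) := by
  have hic := hd.integrable le_rfl hcd
    fun η hη => (hH η (by linarith) (by linarith)).continuousAt
  have hid := hd.integrable hcd le_rfl
    fun η hη => (hH η (by linarith) (by linarith)).continuousAt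
  obtain ⟨C, δ, hδ, R, hd⟩ := hd
  have t1 := intervalIntegral_tendsto_integral hic tendsto_neg_atTop_atBot
    (tendsto_id (α := ℝ) (x := atTop))
  have t2 := intervalIntegral_tendsto_integral hid tendsto_neg_atTop_atBot
    (tendsto_id (α := ℝ) (x := atTop))
  -- The vertical sides of the rectangle with corners at real parts ±r contribute at most C
  -- exp(-δr)|d - c|.
  have side : ∀ σ : ℝ, |σ| = 1 → Tendsto (fun r : ℝ => ∫ y in c..d, H (linePt y (σ * r))) atTop
      (𝓝 0) := by
    intro σ hσ
    have hb : Tendsto (fun r : ℝ => C * Real.exp (-δ * r) * |d - c|) atTop (𝓝 0) := by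
      have : Tendsto (fun r : ℝ => Real.exp (-δ * r)) atTop (𝓝 0) := by
        refine Real.tendsto_exp_atBot.comp ?_
        exact tendsto_id.const_mul_atTop_of_neg (by linarith)
      simpa using (this.const_mul C).mul_const |d - c|
    refine squeeze_zero_norm' ?_ hb
    filter_upwards [eventually_ge_atTop (max R 0)] with r hr
    have hr0 : 0 ≤ r := (le_max_right _ _).trans hr
    refine intervalIntegral.norm_integral_le_of_norm_le_const fun y hy => ?_
    rw [uIoc_of_le hcd] at hy
    have := hd (linePt y (σ * r)) (by simpa using hy.1.le) (by simpa using hy.2)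
      (by simpa [abs_mul, hσ, abs_of_nonneg hr0] using (le_max_left _ _).trans hr)
    simpa [abs_mul, hσ, abs_of_nonneg hr0] using this
  have s1 := side 1 (by simp)
  have s2 := side (-1) (by simp)
  have key : ∀ r : ℝ, (∫ u in (-r)..r, H (linePt c u)) - (∫ u in (-r)..r, H (linePt d u))
      + Complex.I • (∫ y in c..d, H (linePt y (1 * r)))
      - Complex.I • (∫ y in c..d, H (linePt y (-1 * r))) = 0 := by
    intro r
    have := Complex.integral_boundary_rect_eq_zero_of_differentiableOn H (linePt c (-r))
      (linePt d r) (by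
        intro η hη
        refine (hH η ?_ ?_).differentiableWithinAt
        · have := hη.2; simp [uIcc_of_le hcd] at this; exact this.1
        · have := hη.2; simp [uIcc_of_le hcd] at this; exact this.2)
    simpa [linePt] using this
  have lim := ((t1.sub t2).add (s1.const_smul Complex.I)).sub (s2.const_smul Complex.I)
  simp only [id, smul_zero, add_zero, sub_zero] at lim
  have := tendsto_nhds_unique (lim.congr fun r => key r) tendsto_const_nhds
  exact sub_eq_zero.1 this

end StripAnalysis

/-! ### Line shifts under weak growth, and a normalizing kernel with a simple pole. -/

section Cauchy

open Filter Topology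

variable {E : Type*} [NormedAddCommGroup E] [NormedSpace ℂ E]

theorem normSq_exp_sub_exp (η ζ : ℂ) :
    ‖Complex.exp η - Complex.exp ζ‖ ^ 2 = Real.exp η.re ^ 2 + Real.exp ζ.re ^ 2
      - 2 * (Real.exp η.re * Real.exp ζ.re) * Real.cos (η.im - ζ.im) := by
  rw [← Complex.normSq_eq_norm_sq, Complex.normSq_apply, Complex.sub_re, Complex.sub_im,
    Complex.exp_re, Complex.exp_re, Complex.exp_im, Complex.exp_im, Real.cos_sub]
  linear_combination Real.exp η.re ^ 2 * Real.sin_sq_add_cos_sq η.im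
    + Real.exp ζ.re ^ 2 * Real.sin_sq_add_cos_sq ζ.im

/-- Points on rays whose angle has cosine at most `κ < 1` are uniformly separated. -/
theorem le_norm_exp_sub_exp {κ : ℝ} (hκ : κ < 1) (hκ' : -1 ≤ κ) {η ζ : ℂ}
    (h : Real.cos (η.im - ζ.im) ≤ κ) :
    √((1 - κ) / 2) * (Real.exp η.re + Real.exp ζ.re) ≤ ‖Complex.exp η - Complex.exp ζ‖ := by
  have h1 := Real.exp_pos η.re
  have h2 := Real.exp_pos ζ.re
  refine le_of_sq_le_sq ?_ (norm_nonneg _)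
  rw [normSq_exp_sub_exp, mul_pow, Real.sq_sqrt (by linarith)]
  -- With x, y the two moduli, x² + y² - 2κxy = (1 - κ)/2 · (x + y)² + (1 + κ)/2 · (x - y)².
  nlinarith [mul_le_mul_of_nonneg_left h (mul_pos h1 h2).le,
    mul_nonneg (by linarith : 0 ≤ (1 + κ) / 2) (sq_nonneg (Real.exp η.re - Real.exp ζ.re))]

theorem exp_sub_exp_ne_zero {η ζ : ℂ} (h : Real.cos (η.im - ζ.im) < 1) :
    Complex.exp η - Complex.exp ζ ≠ 0 := by
  have := le_norm_exp_sub_exp h (Real.neg_one_le_cos _) le_rfl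
  have h1 : 0 < √((1 - Real.cos (η.im - ζ.im)) / 2) := Real.sqrt_pos.2 (by linarith)
  refine norm_pos_iff.1 (lt_of_lt_of_le (mul_pos h1 ?_) this)
  positivity

theorem cos_lt_one_of_abs {x : ℝ} (h0 : x ≠ 0) (h : |x| < 2 * Real.pi) : Real.cos x < 1 := by
  refine lt_of_le_of_ne (Real.cos_le_one x) fun hx => h0 ?_
  have := abs_lt.1 h
  exact (Real.cos_eq_one_iff_of_lt_of_lt this.1 this.2).1 hx

/-- Two lines of integration in a strip on which a holomorphic function is integrable give the same
integral, if the function decays on the left and grows slower than `exp η` on the right. -/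
theorem integral_line_eq_of_growth {H : ℂ → E} {c d θ : ℝ} (hcd : c ≤ d) (hθ : θ < Real.pi)
    (hc : -θ ≤ c) (hdθ : d ≤ θ)
    (hH : ∀ η : ℂ, c ≤ η.im → η.im ≤ d → DifferentiableAt ℂ H η) {C δ : ℝ} (hδ : 0 < δ)
    (hC : 0 ≤ C) (hl : ∀ η : ℂ, c ≤ η.im → η.im ≤ d → η.re ≤ 0 → ‖H η‖ ≤ C * Real.exp (δ * η.re))
    (hr : ∀ η : ℂ, c ≤ η.im → η.im ≤ d → 0 ≤ η.re → ‖H η‖ ≤ C * Real.exp ((1 - δ) * η.re))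
    (hic : Integrable fun u => H (linePt c u)) (hid : Integrable fun u => H (linePt d u)) :
    ∫ u, H (linePt c u) = ∫ u, H (linePt d u) := by
  have hθ0 : 0 ≤ θ := by linarith
  -- The regularizing factor is (1 + exp η/(n + 1))⁻¹. Its denominator is the difference of exp(η -
  -- log(n + 1)) and exp(iπ), and the cosine of the angle between these points is -cos(Im η) ≤ -cos
  -- θ < 1. So the factor is bounded uniformly in n, while for fixed n it gains exp(-Re η) on the
  -- right.
  set κ := -Real.cos θ with hκ
  have hκ1 : κ < 1 := by
    have := Real.cos_lt_cos_of_nonneg_of_le_pi hθ0 le_rfl hθ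
    rw [Real.cos_pi] at this; linarith
  set m := √((1 - κ) / 2) with hm
  have hm0 : 0 < m := Real.sqrt_pos.2 (by linarith)
  have low : ∀ (n : ℕ) (η : ℂ), c ≤ η.im → η.im ≤ d →
      m * (Real.exp η.re / (n + 1) + 1) ≤ ‖1 + (1 / ((n : ℂ) + 1)) * Complex.exp η‖ := by
    intro n η h1 h2
    have hn : (0 : ℝ) < n + 1 := by positivity
    have hcos : Real.cos ((η - Real.log (n + 1)).im - (Real.pi * Complex.I : ℂ).im) ≤ κ := by
      have : (η - Real.log (n + 1)).im - (Real.pi * Complex.I : ℂ).im = η.im - Real.pi := by simp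
      rw [this, Real.cos_sub_pi, hκ, neg_le_neg_iff, ← Real.cos_abs η.im]
      exact Real.cos_le_cos_of_nonneg_of_le_pi (abs_nonneg _) hθ.le (abs_le.2 ⟨by linarith, by linarith⟩)
    have := le_norm_exp_sub_exp hκ1 (by rw [hκ]; linarith [Real.cos_le_one θ]) hcos
    rw [Complex.exp_pi_mul_I, Complex.exp_sub, ← Complex.ofReal_exp, Real.exp_log hn] at this
    simp only [Complex.sub_re, Complex.ofReal_re, Complex.mul_re, Complex.I_re, mul_zero,
      Complex.ofReal_im, Complex.I_im, mul_one, sub_self, Real.exp_zero, Real.exp_sub,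
      Real.exp_log hn] at this
    convert this using 2
    push_cast; ring
  have low0 : ∀ (n : ℕ) (η : ℂ), c ≤ η.im → η.im ≤ d →
      ‖(1 + (1 / ((n : ℂ) + 1)) * Complex.exp η)⁻¹‖ ≤ m⁻¹ := by
    intro n η h1 h2
    rw [norm_inv]
    refine inv_anti₀ hm0 (le_trans ?_ (low n η h1 h2))
    have : 0 ≤ Real.exp η.re / ((n : ℝ) + 1) := by positivity
    nlinarith
  have nez : ∀ (n : ℕ) (η : ℂ), c ≤ η.im → η.im ≤ d →
      1 + (1 / ((n : ℂ) + 1)) * Complex.exp η ≠ 0 := by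
    intro n η h1 h2
    refine norm_pos_iff.1 (lt_of_lt_of_le ?_ (low n η h1 h2))
    positivity
  have eqn : ∀ n : ℕ,
      ∫ u, (1 + (1 / ((n : ℂ) + 1)) * Complex.exp (linePt c u))⁻¹ • H (linePt c u) =
      ∫ u, (1 + (1 / ((n : ℂ) + 1)) * Complex.exp (linePt d u))⁻¹ • H (linePt d u) := by
    intro n
    refine integral_line_eq (H := fun η => (1 + (1 / ((n : ℂ) + 1)) * Complex.exp η)⁻¹ • H η) hcd
      (fun η h1 h2 => ?_) ?_
    · refine DifferentiableAt.smul (DifferentiableAt.inv ?_ (nez n η h1 h2)) (hH η h1 h2)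
      fun_prop
    · have hn : (0 : ℝ) < n + 1 := by positivity
      refine ⟨m⁻¹ * (n + 1) * C, δ, hδ, 0, fun η h1 h2 _ => ?_⟩
      rw [norm_smul]
      rcases le_total η.re 0 with h | h
      · rw [abs_of_nonpos h, show -δ * -η.re = δ * η.re by ring]
        calc _ ≤ m⁻¹ * (C * Real.exp (δ * η.re)) :=
              mul_le_mul (low0 n η h1 h2) (hl η h1 h2 h) (norm_nonneg _) (by positivity)
          _ ≤ (n + 1 : ℝ) * (m⁻¹ * (C * Real.exp (δ * η.re))) :=
              le_mul_of_one_le_left (by positivity) (by simp)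
          _ = _ := by ring
      · rw [abs_of_nonneg h]
        have : ‖(1 + (1 / ((n : ℂ) + 1)) * Complex.exp η)⁻¹‖ ≤
            m⁻¹ * (n + 1) * Real.exp (-η.re) := by
          rw [norm_inv]
          have h3 : m * (Real.exp η.re / (n + 1)) ≤ ‖1 + (1 / ((n : ℂ) + 1)) * Complex.exp η‖ :=
            le_trans (by nlinarith) (low n η h1 h2)
          refine (inv_anti₀ (by positivity) h3).trans (le_of_eq ?_)
          rw [Real.exp_neg]; field_simp
        calc _ ≤ m⁻¹ * (n + 1) * Real.exp (-η.re) * (C * Real.exp ((1 - δ) * η.re)) :=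
              mul_le_mul this (hr η h1 h2 h) (norm_nonneg _) (by positivity)
          _ = m⁻¹ * (n + 1) * C * (Real.exp (-η.re) * Real.exp ((1 - δ) * η.re)) := by ring
          _ = _ := by rw [← Real.exp_add]; ring_nf
  -- The assumed integrability on the two boundary lines is the dominating function for removing the
  -- regularization.
  have lim : ∀ y, c ≤ y → y ≤ d → (Integrable fun u => H (linePt y u)) →
      Tendsto (fun n : ℕ => ∫ u, (1 + (1 / ((n : ℂ) + 1)) * Complex.exp (linePt y u))⁻¹ •
        H (linePt y u)) atTop (𝓝 (∫ u, H (linePt y u))) := by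
    intro y h1 h2 hi
    refine tendsto_integral_of_dominated_convergence (fun u => m⁻¹ * ‖H (linePt y u)‖)
      (fun n => ?_) (hi.norm.const_mul _) (fun n => ?_) ?_
    · refine Continuous.aestronglyMeasurable (Continuous.smul (Continuous.inv₀ ?_ ?_) ?_)
      · fun_prop
      · exact fun u => nez n _ (by simpa) (by simpa)
      · exact continuous_comp_linePt fun η hη => (hH η (by linarith) (by linarith)).continuousAt
    · refine .of_forall fun u => ?_
      rw [norm_smul]
      exact mul_le_mul_of_nonneg_right (low0 n _ (by simpa) (by simpa)) (norm_nonneg _)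
    · refine .of_forall fun u => ?_
      have t : Tendsto (fun n : ℕ => (1 : ℂ) / ((n : ℂ) + 1)) atTop (𝓝 0) :=
        tendsto_one_div_add_atTop_nhds_zero_nat
      have t2 := ((t.mul_const (Complex.exp (linePt y u))).const_add 1).inv₀ (by simp)
      simpa using t2.smul_const (H (linePt y u))
  exact tendsto_nhds_unique (lim c le_rfl hcd hic) (((lim d hcd le_rfl hid)).congr fun n => (eqn n).symm)

/-- The kernel with a simple pole at `0` of residue `1` used to normalize Cauchy's formula. -/
def poleKernel (η : ℂ) : ℂ := 2⁻¹ * Complex.exp (η / 4) / (Complex.exp (η / 2) - 1)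

/-- Where it is finite the kernel equals 1 / (4 sinh(η/4)), which explains the decay rate 1/4, the
oddness and the location of the poles at integer multiples of 4πi. -/
theorem norm_poleKernel_le {η : ℂ} (h : 2 ≤ |η.re|) :
    ‖poleKernel η‖ ≤ Real.exp (-(1 / 4) * |η.re|) := by
  have e1 : 2 ≤ Real.exp 1 := by linarith [Real.add_one_le_exp 1]
  have key : Real.exp (η.re / 4) * Real.exp (1 / 4 * |η.re|) ≤
      2 * |Real.exp (η.re / 2) - 1| := by
    rw [← Real.exp_add]
    rcases le_total η.re 0 with h0 | h0
    · rw [abs_of_nonpos h0] at h ⊢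
      have : Real.exp (η.re / 2) ≤ 1 / 2 := by
        calc _ ≤ Real.exp (-1) := Real.exp_le_exp.2 (by linarith)
          _ ≤ _ := by rw [Real.exp_neg, one_div]; exact inv_anti₀ (by norm_num) e1
      rw [show η.re / 4 + 1 / 4 * -η.re = 0 by ring, Real.exp_zero,
        abs_of_nonpos (by linarith)]
      linarith
    · rw [abs_of_nonneg h0] at h ⊢
      have : 2 ≤ Real.exp (η.re / 2) := e1.trans (Real.exp_le_exp.2 (by linarith))
      rw [show η.re / 4 + 1 / 4 * η.re = η.re / 2 by ring, abs_of_nonneg (by linarith)]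
      linarith
  have h3 : |Real.exp (η.re / 2) - 1| ≤ ‖Complex.exp (η / 2) - 1‖ := by
    have := abs_norm_sub_norm_le (Complex.exp (η / 2)) 1
    rw [Complex.norm_exp, norm_one] at this
    simpa using this
  have h4 : 0 < ‖Complex.exp (η / 2) - 1‖ := by
    have : 0 < Real.exp (η.re / 4) * Real.exp (1 / 4 * |η.re|) := by positivity
    linarith
  rw [poleKernel, norm_div, norm_mul, Complex.norm_exp, div_le_iff₀ h4]
  have h5 : Real.exp (-(1 / 4) * |η.re|) * Real.exp (1 / 4 * |η.re|) = 1 := by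
    rw [← Real.exp_add]; ring_nf; exact Real.exp_zero
  have h6 := Real.exp_pos (-(1 / 4) * |η.re|)
  have h7 : Real.exp (η.re / 4) ≤ Real.exp (-(1 / 4) * |η.re|) * (2 * ‖Complex.exp (η / 2) - 1‖) := by
    calc Real.exp (η.re / 4) = Real.exp (-(1 / 4) * |η.re|) *
          (Real.exp (η.re / 4) * Real.exp (1 / 4 * |η.re|)) := by
          rw [mul_left_comm, h5, mul_one]
      _ ≤ _ := mul_le_mul_of_nonneg_left (by linarith) h6.le
  have h8 : (η / 4).re = η.re / 4 := by simp
  rw [h8, show ‖(2⁻¹ : ℂ)‖ = 2⁻¹ by norm_num]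
  linarith

theorem exp_half_sub_one_ne_zero {η : ℂ} (h0 : η.im ≠ 0) (h : |η.im| < 4 * Real.pi) :
    Complex.exp (η / 2) - 1 ≠ 0 := by
  have := exp_sub_exp_ne_zero (η := η / 2) (ζ := 0) (by
    have h1 : (η / 2).im - (0 : ℂ).im = η.im / 2 := by simp
    rw [h1]
    refine cos_lt_one_of_abs (by simpa using h0) ?_
    rw [abs_div, abs_two]; linarith)
  simpa using this

theorem differentiableAt_poleKernel {η : ℂ} (h : Complex.exp (η / 2) - 1 ≠ 0) :
    DifferentiableAt ℂ poleKernel η := by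
  unfold poleKernel
  exact DifferentiableAt.div (by fun_prop) (by fun_prop) h

/-- On the line Im η = 2π, halfway between two poles, sinh(η/4) becomes i cosh(u/4), and the
integrand is -i times the derivative of 2 arctan(exp(u/4)). -/
theorem integral_poleKernel_two_pi :
    ∫ u, poleKernel (linePt (2 * Real.pi) u) = -(Real.pi * Complex.I) := by
  have h1 : ∀ u : ℝ, poleKernel (linePt (2 * Real.pi) u) =
      -Complex.I * ((2⁻¹ * Real.exp (u / 4) / (1 + Real.exp (u / 4) ^ 2) : ℝ) : ℂ) := by
    intro u
    have e1 : Complex.exp (linePt (2 * Real.pi) u / 4) = (Real.exp (u / 4) : ℂ) * Complex.I := by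
      rw [show linePt (2 * Real.pi) u / 4 = ((u / 4 : ℝ) : ℂ) + Real.pi / 2 * Complex.I by
        simp [linePt]; ring, Complex.exp_add, Complex.exp_pi_div_two_mul_I, Complex.ofReal_exp]
    have e2 : Complex.exp (linePt (2 * Real.pi) u / 2) = -(Real.exp (u / 4) : ℂ) ^ 2 := by
      rw [show linePt (2 * Real.pi) u / 2 = 2 * (linePt (2 * Real.pi) u / 4) by ring, two_mul,
        Complex.exp_add, e1]
      linear_combination (Real.exp (u / 4) : ℂ) ^ 2 * Complex.I_sq
    have hp : (1 : ℂ) + (Real.exp (u / 4) : ℂ) ^ 2 ≠ 0 := by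
      norm_cast; positivity
    have hp2 : -(Real.exp (u / 4) : ℂ) ^ 2 - 1 ≠ 0 := by
      intro h; apply hp; linear_combination -h
    rw [poleKernel, e1, e2]
    push_cast
    push_cast at hp hp2
    field_simp
    ring
  simp_rw [h1]
  rw [integral_const_mul, integral_complex_ofReal]
  have hd : ∀ u : ℝ, HasDerivAt (fun u : ℝ => 2 * Real.arctan (Real.exp (u / 4)))
      (2⁻¹ * Real.exp (u / 4) / (1 + Real.exp (u / 4) ^ 2)) u := by
    intro u
    have := (((hasDerivAt_id u).div_const 4).exp.arctan).const_mul 2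
    refine this.congr_deriv ?_
    simp only [id]; ring
  have hi : Integrable fun u : ℝ => 2⁻¹ * Real.exp (u / 4) / (1 + Real.exp (u / 4) ^ 2) := by
    refine integrable_of_exp_decay (C := 1) (δ := 1 / 4) (R := 2) ?_ (by norm_num) fun u hu => ?_
    · refine Continuous.div (by fun_prop) (by fun_prop) fun u => by positivity
    · have := norm_poleKernel_le (η := linePt (2 * Real.pi) u) (by simpa using hu)
      rw [h1, norm_mul, norm_neg, Complex.norm_I, one_mul, Complex.norm_real] at this
      simpa using this
  rw [integral_of_hasDerivAt_of_tendsto hd hi (m := 0) (n := Real.pi)]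
  · push_cast; ring
  · have : Tendsto (fun u : ℝ => Real.exp (u / 4)) atBot (𝓝 0) :=
      Real.tendsto_exp_atBot.comp (tendsto_id.atBot_div_const (by norm_num))
    have := ((Real.continuous_arctan.tendsto 0).comp this).const_mul 2
    simpa using this
  · have : Tendsto (fun u : ℝ => Real.exp (u / 4)) atTop atTop :=
      Real.tendsto_exp_atTop.comp (tendsto_id.atTop_div_const (by norm_num))
    have := ((tendsto_nhds_of_tendsto_nhdsWithin Real.tendsto_arctan_atTop).comp this).const_mul 2
    rw [show Real.pi = 2 * (Real.pi / 2) by ring]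
    exact this

theorem expDecay_poleKernel (c d : ℝ) : ExpDecay poleKernel c d :=
  ⟨1, 1 / 4, by norm_num, 2, fun η _ _ h => by simpa using norm_poleKernel_le h⟩

/-- The open strip 0 < Im η < 4π contains no pole, so the line can be moved to Im η = 2π. -/
theorem integral_poleKernel {c : ℝ} (h0 : 0 < c) (h1 : c < 4 * Real.pi) :
    ∫ u, poleKernel (linePt c u) = -(Real.pi * Complex.I) := by
  rw [← integral_poleKernel_two_pi]
  have hd : ∀ {a b : ℝ}, 0 < a → b < 4 * Real.pi → ∀ η : ℂ, a ≤ η.im → η.im ≤ b →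
      DifferentiableAt ℂ poleKernel η := fun ha hb η h2 h3 =>
    differentiableAt_poleKernel (exp_half_sub_one_ne_zero (by linarith)
      (by rw [abs_of_nonneg (by linarith)]; linarith))
  have := Real.pi_pos
  rcases le_total c (2 * Real.pi) with h | h
  · exact integral_line_eq h (hd h0 (by linarith)) (expDecay_poleKernel _ _)
  · exact (integral_line_eq h (hd (by linarith) h1) (expDecay_poleKernel _ _)).symm

theorem poleKernel_neg (η : ℂ) : poleKernel (-η) = -poleKernel η := by
  have h1 : Complex.exp (-η / 4) = (Complex.exp (η / 4))⁻¹ := by rw [neg_div, Complex.exp_neg]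
  have h2 : Complex.exp (-η / 2) = ((Complex.exp (η / 4)) ^ 2)⁻¹ := by
    rw [neg_div, Complex.exp_neg, ← Complex.exp_nat_mul]; congr 2; push_cast; ring
  have h3 : Complex.exp (η / 2) = (Complex.exp (η / 4)) ^ 2 := by
    rw [← Complex.exp_nat_mul]; congr 1; push_cast; ring
  rw [poleKernel, poleKernel, h1, h2, h3]
  have h4 := Complex.exp_ne_zero (η / 4)
  set x := Complex.exp (η / 4)
  by_cases hx : x ^ 2 = 1
  · rw [hx]; simp
  · have : x ^ 2 - 1 ≠ 0 := sub_ne_zero.2 hx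
    have h5 : (x ^ 2)⁻¹ - 1 ≠ 0 := by
      intro h; apply hx; exact inv_eq_one.1 (sub_eq_zero.1 h)
    have h6 : (x ^ 2)⁻¹ - 1 = -(x ^ 2 - 1) / x ^ 2 := by field_simp; ring
    rw [h6]; field_simp

theorem integral_poleKernel_neg {c : ℝ} (h0 : c < 0) (h1 : -(4 * Real.pi) < c) :
    ∫ u, poleKernel (linePt c u) = Real.pi * Complex.I := by
  rw [← integral_neg_eq_self]
  have : ∀ u, poleKernel (linePt c (-u)) = -poleKernel (linePt (-c) u) := by
    intro u
    rw [← poleKernel_neg]; congr 1; simp [linePt]; ring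
  simp_rw [this]
  rw [integral_neg, integral_poleKernel (by linarith) (by linarith), neg_neg]

end Cauchy

/-! ### Cauchy's formula for the boundary of a sector. -/

section Cauchy

open Filter Topology

variable {E : Type*} [NormedAddCommGroup E] [NormedSpace ℂ E]

/-- The Cauchy kernel `dw / (w - z)` in the coordinates `w = exp η`, `z = exp ζ`. -/
def cauchyKernel (ζ η : ℂ) : ℂ := Complex.exp η / (Complex.exp η - Complex.exp ζ)

theorem norm_cauchyKernel_le_of_cos {κ : ℝ} (hκ : κ < 1) (hκ' : -1 ≤ κ) {η ζ : ℂ}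
    (h : Real.cos (η.im - ζ.im) ≤ κ) : ‖cauchyKernel ζ η‖ ≤ (√((1 - κ) / 2))⁻¹ := by
  have h1 := le_norm_exp_sub_exp hκ hκ' h
  have hm : 0 < √((1 - κ) / 2) := Real.sqrt_pos.2 (by linarith)
  have h2 := Real.exp_pos η.re
  have h3 := Real.exp_pos ζ.re
  have h4 : √((1 - κ) / 2) * Real.exp η.re ≤ ‖Complex.exp η - Complex.exp ζ‖ :=
    le_trans (mul_le_mul_of_nonneg_left (by linarith) hm.le) h1
  rw [cauchyKernel, norm_div, Complex.norm_exp, div_le_iff₀ (lt_of_lt_of_le (by positivity) h4)]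
  calc Real.exp η.re = (√((1 - κ) / 2))⁻¹ * (√((1 - κ) / 2) * Real.exp η.re) := by field_simp
    _ ≤ _ := mul_le_mul_of_nonneg_left h4 (by positivity)

/-- A unit distance of the real parts separates the two moduli by a factor of at least e ≥ 2. The
bound needs no separation of the angles, which may coincide inside the strip. -/
theorem norm_cauchyKernel_le {ζ η : ℂ} (h : 1 ≤ |η.re - ζ.re|) : ‖cauchyKernel ζ η‖ ≤ 2 := by
  have e1 : 2 ≤ Real.exp 1 := by linarith [Real.add_one_le_exp 1]
  have hp := Real.exp_pos η.re
  have h1 : |Real.exp η.re - Real.exp ζ.re| ≤ ‖Complex.exp η - Complex.exp ζ‖ := by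
    simpa [Complex.norm_exp] using abs_norm_sub_norm_le (Complex.exp η) (Complex.exp ζ)
  have h2 : Real.exp η.re ≤ 2 * |Real.exp η.re - Real.exp ζ.re| := by
    rcases le_total η.re ζ.re with h0 | h0
    · rw [abs_of_nonpos (by linarith)] at h
      have : 2 * Real.exp η.re ≤ Real.exp ζ.re := by
        calc _ ≤ Real.exp 1 * Real.exp η.re := mul_le_mul_of_nonneg_right e1 hp.le
          _ = Real.exp (1 + η.re) := (Real.exp_add _ _).symm
          _ ≤ _ := Real.exp_le_exp.2 (by linarith)
      rw [abs_of_nonpos (by linarith)]; linarith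
    · rw [abs_of_nonneg (by linarith)] at h
      have : 2 * Real.exp ζ.re ≤ Real.exp η.re := by
        calc _ ≤ Real.exp 1 * Real.exp ζ.re :=
              mul_le_mul_of_nonneg_right e1 (Real.exp_pos _).le
          _ = Real.exp (1 + ζ.re) := (Real.exp_add _ _).symm
          _ ≤ _ := Real.exp_le_exp.2 (by linarith)
      rw [abs_of_nonneg (by linarith [Real.exp_pos ζ.re])]; linarith
  rw [cauchyKernel, norm_div, Complex.norm_exp, div_le_iff₀ (by linarith)]
  linarith

theorem differentiableAt_cauchyKernel {ζ η : ℂ} (h : Complex.exp η - Complex.exp ζ ≠ 0) :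
    DifferentiableAt ℂ (cauchyKernel ζ) η := by
  unfold cauchyKernel
  exact DifferentiableAt.div (by fun_prop) (by fun_prop) h

theorem expDecay_cauchyKernel_smul {F : ℂ → E} {ζ : ℂ} {c d C δ : ℝ} (hδ : 0 < δ)
    (hF : ∀ η : ℂ, c ≤ η.im → η.im ≤ d → ‖F η‖ ≤ C * Real.exp (-δ * |η.re|)) :
    ExpDecay (fun η => cauchyKernel ζ η • F η) c d := by
  refine ⟨2 * C, δ, hδ, |ζ.re| + 1, fun η h1 h2 h3 => ?_⟩
  rw [norm_smul, mul_assoc]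
  refine mul_le_mul (norm_cauchyKernel_le ?_) (hF η h1 h2) (norm_nonneg _) (by norm_num)
  have := abs_sub_abs_le_abs_sub η.re ζ.re
  linarith

theorem exp_eq_exp_of_im {ζ η : ℂ} (h : |η.im - ζ.im| < 2 * Real.pi)
    (he : Complex.exp η - Complex.exp ζ = 0) : η = ζ := by
  obtain ⟨n, hn⟩ := Complex.exp_eq_exp_iff_exists_int.1 (sub_eq_zero.1 he)
  have him : η.im - ζ.im = n * (2 * Real.pi) := by
    have := congrArg Complex.im hn
    simp at this; linarith
  rw [him, abs_mul, abs_of_pos Real.two_pi_pos] at h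
  have hn1 : |(n : ℝ)| < 1 := by
    by_contra hh
    push Not at hh
    nlinarith [Real.two_pi_pos]
  have : n = 0 := by
    have : |n| < 1 := by exact_mod_cast hn1
    exact Int.abs_lt_one_iff.1 this
  rw [hn, this]; simp

theorem tendsto_mul_cauchyKernel (ζ : ℂ) :
    Tendsto (fun η => (η - ζ) * cauchyKernel ζ η) (𝓝[≠] ζ) (𝓝 1) := by
  have h1 : Tendsto (fun η => (Complex.exp η - Complex.exp ζ) / (η - ζ)) (𝓝[≠] ζ)
      (𝓝 (Complex.exp ζ)) := by
    have := (hasDerivAt_iff_tendsto_slope.1 (Complex.hasDerivAt_exp ζ))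
    refine this.congr fun η => ?_
    rw [slope_def_field]
  have h2 : Tendsto Complex.exp (𝓝[≠] ζ) (𝓝 (Complex.exp ζ)) :=
    (Complex.continuous_exp.tendsto ζ).mono_left nhdsWithin_le_nhds
  have h3 := h2.div h1 (Complex.exp_ne_zero ζ)
  rw [div_self (Complex.exp_ne_zero ζ)] at h3
  refine h3.congr fun η => ?_
  simp only [Pi.div_apply, cauchyKernel, div_div_eq_mul_div]
  ring

theorem tendsto_mul_poleKernel (ζ : ℂ) :
    Tendsto (fun η => (η - ζ) * poleKernel (η - ζ)) (𝓝[≠] ζ) (𝓝 1) := by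
  have h1 : Tendsto (fun η => (Complex.exp ((η - ζ) / 2) - 1) / (η - ζ)) (𝓝[≠] ζ)
      (𝓝 2⁻¹) := by
    have hd : HasDerivAt (fun η => Complex.exp ((η - ζ) / 2)) 2⁻¹ ζ := by
      have := (((hasDerivAt_id ζ).sub_const ζ).div_const 2).cexp
      refine this.congr_deriv ?_
      simp
    have := hasDerivAt_iff_tendsto_slope.1 hd
    refine this.congr fun η => ?_
    rw [slope_def_field]; simp
  have h2 : Tendsto (fun η => 2⁻¹ * Complex.exp ((η - ζ) / 4)) (𝓝[≠] ζ) (𝓝 2⁻¹) := by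
    have : Continuous (fun η => 2⁻¹ * Complex.exp ((η - ζ) / 4)) := by fun_prop
    have := this.tendsto ζ
    simp only [sub_self, zero_div, Complex.exp_zero, mul_one] at this
    exact this.mono_left nhdsWithin_le_nhds
  have h3 := h2.div h1 (by norm_num)
  rw [div_self (by norm_num)] at h3
  refine h3.congr fun η => ?_
  simp only [Pi.div_apply, poleKernel, div_div_eq_mul_div]
  ring

theorem integral_poleKernel_sub (ζ : ℂ) (c : ℝ) :
    ∫ u, poleKernel (linePt c u - ζ) = ∫ u, poleKernel (linePt (c - ζ.im) u) := by
  rw [← integral_sub_right_eq_self (fun u => poleKernel (linePt (c - ζ.im) u)) ζ.re]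
  congr 1; ext u; congr 1
  apply Complex.ext <;> simp

/-- The Cauchy integral over the boundary of a sector vanishes outside that sector. -/
theorem cauchy_integral_eq_zero {G : ℂ → E} {ζ : ℂ} {φ θ C δ : ℝ} (hθ : θ < Real.pi)
    (hφ0 : 0 ≤ φ) (hφ : φ < |ζ.im|) (hζ : |ζ.im| < θ)
    (hG : ∀ η : ℂ, |η.im| < θ → DifferentiableAt ℂ G η) (hδ : 0 < δ)
    (hGb : ∀ η : ℂ, |η.im| < θ → ‖G η‖ ≤ C * Real.exp (-δ * |η.re|)) :
    (∫ u, cauchyKernel ζ (linePt (-φ) u) • G (linePt (-φ) u)) -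
      (∫ u, cauchyKernel ζ (linePt φ u) • G (linePt φ u)) = 0 := by
  rw [sub_eq_zero]
  refine integral_line_eq (H := fun η => cauchyKernel ζ η • G η) (by linarith)
    (fun η h1 h2 => ?_) ?_
  · have h3 : |η.im| ≤ φ := abs_le.2 ⟨h1, h2⟩
    refine (differentiableAt_cauchyKernel fun h0 => ?_).smul (hG η (by linarith))
    have h4 := exp_eq_exp_of_im (by
      have := abs_sub η.im ζ.im
      linarith) h0
    rw [h4] at h3; linarith
  · exact expDecay_cauchyKernel_smul hδ fun η h1 h2 =>
      hGb η (lt_of_le_of_lt (abs_le.2 ⟨h1, h2⟩) (by linarith))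

variable [CompleteSpace E]

/-- Cauchy's formula in a sector, in logarithmic coordinates. -/
theorem cauchy_formula {F : ℂ → E} {ζ : ℂ} {φ θ C δ : ℝ} (hθ : θ < Real.pi) (hφ : φ < θ)
    (hζ : |ζ.im| < φ) (hF : ∀ η : ℂ, |η.im| < θ → DifferentiableAt ℂ F η) (hδ : 0 < δ)
    (hFb : ∀ η : ℂ, |η.im| < θ → ‖F η‖ ≤ C * Real.exp (-δ * |η.re|)) :
    (∫ u, cauchyKernel ζ (linePt (-φ) u) • F (linePt (-φ) u)) -
      (∫ u, cauchyKernel ζ (linePt φ u) • F (linePt φ u)) =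
      (2 * Real.pi * Complex.I) • F ζ := by
  have hφ0 : 0 < φ := lt_of_le_of_lt (abs_nonneg _) hζ
  have hζ' := abs_lt.1 hζ
  set U : Set ℂ := {η | |η.im| < θ} with hU
  have hUo : IsOpen U := isOpen_lt (by fun_prop) continuous_const
  have hζU : ζ ∈ U := hζ.trans hφ
  have hk : ∀ η ∈ U, η ≠ ζ → Complex.exp η - Complex.exp ζ ≠ 0 := by
    intro η hη hne h0
    refine hne (exp_eq_exp_of_im ?_ h0)
    have := abs_lt.1 (show |η.im| < θ from hη)
    rw [abs_lt]; constructor <;> linarith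
  have hp : ∀ η ∈ U, η ≠ ζ → Complex.exp ((η - ζ) / 2) - 1 ≠ 0 := by
    intro η hη hne h0
    have : (η - ζ) / 2 = 0 := by
      refine exp_eq_exp_of_im ?_ (by rw [Complex.exp_zero]; exact h0)
      have := abs_lt.1 (show |η.im| < θ from hη)
      simp only [Complex.div_ofNat_im, Complex.sub_im, Complex.zero_im, sub_zero]
      rw [abs_lt]; constructor <;> linarith
    exact hne (by simpa [sub_eq_zero] using this)
  -- Both kernels have residue 1 at ζ, so the singularity of the difference is removable and its
  -- line integral can be shifted across ζ. The value 2πi F(ζ) then comes from the explicit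
  -- integrals -πi and πi of the pole kernel above and below its pole.
  set G : ℂ → E := fun η => cauchyKernel ζ η • F η - poleKernel (η - ζ) • F ζ with hG
  have hGd : ∀ η ∈ U, η ≠ ζ → DifferentiableAt ℂ G η := by
    intro η hη hne
    refine ((differentiableAt_cauchyKernel (hk η hη hne)).smul (hF η hη)).sub
      (DifferentiableAt.smul_const ?_ _)
    exact (differentiableAt_poleKernel (hp η hη hne)).comp η
      (f := fun η => η - ζ) (by fun_prop)
  set G' : ℂ → E := Function.update G ζ (limUnder (𝓝[≠] ζ) G) with hG'
  have hlim : Tendsto (fun η => (η - ζ) • G η) (𝓝[≠] ζ) (𝓝 0) := by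
    have h1 : Tendsto F (𝓝[≠] ζ) (𝓝 (F ζ)) :=
      (hF ζ hζU).continuousAt.tendsto.mono_left nhdsWithin_le_nhds
    have := ((tendsto_mul_cauchyKernel ζ).smul h1).sub
      ((tendsto_mul_poleKernel ζ).smul_const (F ζ))
    rw [one_smul, sub_self] at this
    refine this.congr fun η => ?_
    simp only [hG, smul_sub, smul_smul]
  have hG'd : DifferentiableOn ℂ G' U := by
    refine Complex.differentiableOn_update_limUnder_of_isLittleO (hUo.mem_nhds hζU)
      (fun η hη => (hGd η hη.1 hη.2).differentiableWithinAt) ?_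
    have hz : Tendsto (fun η : ℂ => (η - ζ)) (𝓝[≠] ζ) (𝓝 0) := by
      have : Tendsto (fun η : ℂ => (η - ζ)) (𝓝 ζ) (𝓝 (ζ - ζ)) :=
        (continuous_id.sub continuous_const).tendsto ζ
      rw [sub_self] at this
      exact this.mono_left nhdsWithin_le_nhds
    -- The removable singularity criterion concerns G - G(ζ); the arbitrary value G(ζ) is harmless,
    -- as (η - ζ)G(ζ) also tends to 0.
    have h2 := hlim.sub (hz.smul_const (G ζ))
    rw [zero_smul, sub_zero] at h2
    refine Asymptotics.isLittleO_iff.2 fun ε hε => ?_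
    filter_upwards [(tendsto_zero_iff_norm_tendsto_zero.1 h2).eventually (gt_mem_nhds hε),
      self_mem_nhdsWithin] with η hη hne
    have hpos : 0 < ‖η - ζ‖ := norm_pos_iff.2 (sub_ne_zero.2 hne)
    rw [← smul_sub, norm_smul] at hη
    rw [norm_inv, ← div_eq_mul_inv, le_div_iff₀ hpos, mul_comm]
    exact hη.le
  have hGG' : ∀ η, η ≠ ζ → G' η = G η := fun η h => Function.update_of_ne h _ _
  have hdec : ExpDecay G (-φ) φ := by
    have h1 : ExpDecay (fun η => cauchyKernel ζ η • F η) (-φ) φ :=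
      expDecay_cauchyKernel_smul hδ fun η h1 h2 =>
        hFb η (abs_lt.2 ⟨by linarith, by linarith⟩)
    have h2 : ExpDecay (fun η => -(poleKernel (η - ζ) • F ζ)) (-φ) φ := by
      refine ⟨Real.exp (1 / 4 * |ζ.re|) * ‖F ζ‖, 1 / 4, by norm_num, |ζ.re| + 2, fun η _ _ h => ?_⟩
      have h3 := abs_sub_abs_le_abs_sub η.re ζ.re
      have h4 := norm_poleKernel_le (η := η - ζ) (by rw [Complex.sub_re]; linarith)
      rw [norm_neg, norm_smul, mul_right_comm]
      refine mul_le_mul_of_nonneg_right (h4.trans ?_) (norm_nonneg _)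
      rw [← Real.exp_add, Complex.sub_re]
      exact Real.exp_le_exp.2 (by linarith)
    simpa only [hG, sub_eq_add_neg] using h1.add h2
  have hdec' : ExpDecay G' (-φ) φ := by
    obtain ⟨C, δ, hδ, R, h⟩ := hdec
    refine ⟨C, δ, hδ, max R (|ζ.re| + 1), fun η h1 h2 h3 => ?_⟩
    rw [hGG']
    · exact h η h1 h2 ((le_max_left _ _).trans h3)
    · rintro rfl
      have := (le_max_right _ _).trans h3
      linarith
  have hshift := integral_line_eq (by linarith) (fun η h1 h2 =>
    hG'd.differentiableAt (hUo.mem_nhds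
      (show |η.im| < θ from abs_lt.2 ⟨by linarith, by linarith⟩))) hdec'
  have nl : ∀ σ, |σ| = φ → ∀ u, linePt σ u ≠ ζ := by
    intro σ hσ u h
    have : σ = ζ.im := by rw [← h]; simp
    rw [← this, hσ] at hζ
    exact lt_irrefl _ hζ
  have split : ∀ σ, |σ| = φ → ∫ u, G' (linePt σ u) =
      (∫ u, cauchyKernel ζ (linePt σ u) • F (linePt σ u)) -
        (∫ u, poleKernel (linePt (σ - ζ.im) u)) • F ζ := by
    intro σ hσ
    have hσ' : -φ ≤ σ ∧ σ ≤ φ := abs_le.1 hσ.le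
    simp_rw [hGG' _ (nl σ hσ _)]
    have hmem : ∀ η : ℂ, η.im = σ → η ∈ U ∧ η ≠ ζ := by
      intro η h
      refine ⟨show |η.im| < θ by rw [h, hσ]; exact hφ, fun h' => ?_⟩
      rw [← h', h, hσ] at hζ
      exact lt_irrefl _ hζ
    have i1 : Integrable fun u => cauchyKernel ζ (linePt σ u) • F (linePt σ u) :=
      ExpDecay.integrable (H := fun η => cauchyKernel ζ η • F η)
        (expDecay_cauchyKernel_smul (c := -φ) (d := φ) hδ fun η h1 h2 =>
          hFb η (abs_lt.2 ⟨by linarith, by linarith⟩)) hσ'.1 hσ'.2 fun η h =>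
        ((differentiableAt_cauchyKernel (hk η (hmem η h).1 (hmem η h).2)).smul
          (hF η (hmem η h).1)).continuousAt
    have iG : Integrable fun u => G (linePt σ u) := hdec.integrable hσ'.1 hσ'.2 fun η h =>
      (hGd η (hmem η h).1 (hmem η h).2).continuousAt
    have i2 : Integrable fun u => poleKernel (linePt σ u - ζ) • F ζ := by
      refine (i1.sub iG).congr (.of_forall fun u => ?_)
      simp [hG]
    simp only [hG]
    rw [integral_sub i1 i2, integral_smul_const, integral_poleKernel_sub]
  rw [split _ (by rw [abs_neg, abs_of_pos hφ0]), split _ (abs_of_pos hφ0),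
    integral_poleKernel (c := φ - ζ.im) (by linarith) (by linarith),
    integral_poleKernel_neg (c := -φ - ζ.im) (by linarith) (by linarith)] at hshift
  rw [sub_eq_sub_iff_add_eq_add] at hshift
  rw [sub_eq_iff_eq_add]
  have : (2 * Real.pi * Complex.I) • F ζ = (Real.pi * Complex.I : ℂ) • F ζ +
      (Real.pi * Complex.I : ℂ) • F ζ := by rw [← add_smul]; ring_nf
  rw [this]
  rw [neg_smul] at hshift
  have h4 := congrArg (fun x => x + (Real.pi * Complex.I : ℂ) • F ζ) hshift
  beta_reduce at h4
  rw [add_assoc, neg_add_cancel, add_zero] at h4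
  rw [h4]; abel

end Cauchy

/-! ### Integrals over both sides of a sector. -/

section Contour

open Filter Topology

variable {E : Type*} [NormedAddCommGroup E]

/-- Integrability on both sides of the sector of half-angle `φ`. -/
def ContourIntegrable (φ : ℝ) (H : ℂ → E) : Prop :=
  (Integrable fun u => H (linePt (-φ) u)) ∧ Integrable fun u => H (linePt φ u)

theorem contourIntegrable_of_exp_decay {H : ℂ → E} {φ C δ : ℝ} (hφ : 0 ≤ φ)
    (hc : ∀ η : ℂ, |η.im| = φ → ContinuousAt H η) (hδ : 0 < δ)
    (hb : ∀ η : ℂ, |η.im| = φ → ‖H η‖ ≤ C * Real.exp (-δ * |η.re|)) :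
    ContourIntegrable φ H := by
  constructor
  · refine integrable_of_exp_decay (C := C) (δ := δ) (R := 0) (continuous_comp_linePt fun η h =>
      hc η (by rw [h, abs_neg, abs_of_nonneg hφ])) hδ fun u _ => ?_
    simpa using hb (linePt (-φ) u) (by simp [abs_of_nonneg hφ])
  · refine integrable_of_exp_decay (C := C) (δ := δ) (R := 0) (continuous_comp_linePt fun η h =>
      hc η (by rw [h, abs_of_nonneg hφ])) hδ fun u _ => ?_
    simpa using hb (linePt φ u) (by simp [abs_of_nonneg hφ])

variable [NormedSpace ℂ E]

/-- The integral `∫ H(w) dw / w` over the boundary of the sector of half-angle `φ`, in the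
coordinate `η = log w`. -/
def contourIntegral (φ : ℝ) (H : ℂ → E) : E :=
  (∫ u, H (linePt (-φ) u)) - ∫ u, H (linePt φ u)

/-- The two sides of a sector, as one measure space. -/
def contourMeasure : Measure (Bool × ℝ) :=
  volume.map (Prod.mk false) + volume.map (Prod.mk true)

instance : SFinite contourMeasure := by unfold contourMeasure; infer_instance

def contourPt (φ : ℝ) (x : Bool × ℝ) : ℂ := linePt (if x.1 then φ else -φ) x.2

def contourSign (x : Bool × ℝ) : ℂ := if x.1 then -1 else 1

theorem abs_contourPt_im {φ : ℝ} (hφ : 0 ≤ φ) (x : Bool × ℝ) : |(contourPt φ x).im| = φ := by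
  rcases x with ⟨_ | _, u⟩ <;> simp [contourPt, abs_of_nonneg hφ]

@[simp] theorem norm_contourSign (x : Bool × ℝ) : ‖contourSign x‖ = 1 := by
  rcases x with ⟨_ | _, u⟩ <;> simp [contourSign]

theorem continuous_contourPt (φ : ℝ) : Continuous (contourPt φ) := by
  unfold contourPt linePt
  have : Continuous fun x : Bool × ℝ => (if x.1 then φ else -φ) :=
    (continuous_of_discreteTopology (f := fun b : Bool => if b then φ else -φ)).comp continuous_fst
  fun_prop

theorem continuous_contourSign : Continuous contourSign :=
  (continuous_of_discreteTopology (f := fun b : Bool => if b then (-1 : ℂ) else 1)).comp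
    continuous_fst

theorem integrable_contourMeasure_iff {h : Bool × ℝ → E} :
    Integrable h contourMeasure ↔
      Integrable (fun u => h (false, u)) ∧ Integrable (fun u => h (true, u)) := by
  rw [contourMeasure, integrable_add_measure,
    (measurableEmbedding_prodMk_left false).integrable_map_iff,
    (measurableEmbedding_prodMk_left true).integrable_map_iff]
  rfl

theorem integral_contourMeasure {h : Bool × ℝ → E} (hi : Integrable h contourMeasure) :
    ∫ x, h x ∂contourMeasure = (∫ u, h (false, u)) + ∫ u, h (true, u) := by
  unfold contourMeasure at hi ⊢
  rw [integrable_add_measure] at hi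
  rw [integral_add_measure hi.1 hi.2, (measurableEmbedding_prodMk_left false).integral_map,
    (measurableEmbedding_prodMk_left true).integral_map]

theorem ContourIntegrable.integrable {φ : ℝ} {H : ℂ → E} (h : ContourIntegrable φ H) :
    Integrable (fun x => contourSign x • H (contourPt φ x)) contourMeasure := by
  rw [integrable_contourMeasure_iff]
  exact ⟨by simpa [contourSign, contourPt] using h.1,
    by simpa [contourSign, contourPt] using h.2.neg⟩

theorem contourIntegral_eq {φ : ℝ} {H : ℂ → E} (h : ContourIntegrable φ H) :
    contourIntegral φ H = ∫ x, contourSign x • H (contourPt φ x) ∂contourMeasure := by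
  rw [integral_contourMeasure h.integrable]
  simp [contourSign, contourPt, contourIntegral, integral_neg, sub_eq_add_neg]

end Contour

/-! ### Products of contour integrals by Fubini and Cauchy. -/

section ContourProduct

variable {E : Type*} [NormedRing E] [NormedAlgebra ℂ E] [CompleteSpace E]

theorem measurable_cauchyKernel : Measurable fun p : ℂ × ℂ => cauchyKernel p.1 p.2 := by
  unfold cauchyKernel
  exact ((Complex.measurable_exp.comp measurable_snd)).div
    ((Complex.measurable_exp.comp measurable_snd).sub (Complex.measurable_exp.comp measurable_fst))

/-- Two points on the boundaries of the two sectors enclose, up to sign, the angle φ' - φ or φ' + φ.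
Both lie strictly between 0 and 2π, so their cosines stay below some κ < 1. -/
theorem exists_cauchyKernel_bound {φ φ' : ℝ} (hφ0 : 0 < φ) (hφφ' : φ < φ') (hφ' : φ' < Real.pi) :
    ∃ M : ℝ, ∀ ζ η : ℂ, |ζ.im| = φ → |η.im| = φ' →
      ‖cauchyKernel ζ η‖ ≤ M ∧ ‖cauchyKernel η ζ‖ ≤ M := by
  set κ := max (Real.cos (φ' - φ)) (Real.cos (φ' + φ)) with hκ
  have h1 : κ < 1 := max_lt
    (cos_lt_one_of_abs (by linarith) (by rw [abs_of_nonneg (by linarith)]; linarith))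
    (cos_lt_one_of_abs (by linarith) (by rw [abs_of_nonneg (by linarith)]; linarith))
  have h2 : -1 ≤ κ := (Real.neg_one_le_cos _).trans (le_max_left _ _)
  have key : ∀ ζ η : ℂ, |ζ.im| = φ → |η.im| = φ' → Real.cos (η.im - ζ.im) ≤ κ := by
    intro ζ η hζ hη
    rcases (abs_eq hφ0.le).1 hζ with a | a <;> rcases (abs_eq (by linarith)).1 hη with b | b <;>
      rw [a, b]
    · exact le_max_left _ _
    · rw [← Real.cos_neg, show -(-φ' - φ) = φ' + φ by ring]; exact le_max_right _ _
    · rw [sub_neg_eq_add]; exact le_max_right _ _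
    · rw [← Real.cos_neg, show -(-φ' - -φ) = φ' - φ by ring]; exact le_max_left _ _
  refine ⟨_, fun ζ η hζ hη => ⟨norm_cauchyKernel_le_of_cos h1 h2 (key ζ η hζ hη),
    norm_cauchyKernel_le_of_cos h1 h2 ?_⟩⟩
  rw [← Real.cos_neg, neg_sub]; exact key ζ η hζ hη

/-- The product of two contour integrals whose kernels satisfy a resolvent equation. -/
theorem sum_contourIntegral_mul {ι : Type*} [Fintype ι] {K : ℂ → E} {p q : ι → ℂ → E} {G : ℂ → ℂ}
    {F : ℂ → E} {φ φ' θ C δ : ℝ} (hφ0 : 0 < φ) (hφφ' : φ < φ') (hφ' : φ' < θ) (hθ : θ < Real.pi)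
    (hδ : 0 < δ) (hF : ∀ η : ℂ, |η.im| < θ → DifferentiableAt ℂ F η)
    (hFb : ∀ η : ℂ, |η.im| < θ → ‖F η‖ ≤ C * Real.exp (-δ * |η.re|))
    (hG : ∀ η : ℂ, |η.im| < θ → DifferentiableAt ℂ G η)
    (hGb : ∀ η : ℂ, |η.im| < θ → ‖G η‖ ≤ C * Real.exp (-δ * |η.re|))
    (hid : ∀ ζ η : ℂ, |ζ.im| = φ → |η.im| = φ' → (Complex.exp η - Complex.exp ζ) •
      ∑ j, p j ζ * q j η = K ζ - K η)
    (ip : ∀ j, ContourIntegrable φ fun ζ => Complex.exp ζ • G ζ • p j ζ)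
    (iq : ∀ j, ContourIntegrable φ' fun η => Complex.exp η • (q j η * F η))
    (iG : ContourIntegrable φ fun ζ => Complex.exp ζ • G ζ • K ζ)
    (iF : ContourIntegrable φ' fun η => Complex.exp η • (K η * F η)) :
    ∑ j, contourIntegral φ (fun ζ => Complex.exp ζ • G ζ • p j ζ) *
      contourIntegral φ' (fun η => Complex.exp η • (q j η * F η)) =
    (2 * Real.pi * Complex.I) •
      contourIntegral φ (fun ζ => Complex.exp ζ • (K ζ * (G ζ • F ζ))) := by
  have hφ'0 : 0 < φ' := hφ0.trans hφφ'
  obtain ⟨M, hM⟩ := exists_cauchyKernel_bound hφ0 hφφ' (hφ'.trans hθ)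
  set μ := contourMeasure
  have hx := abs_contourPt_im hφ0.le
  have hy := abs_contourPt_im hφ'0.le
  set U : Bool × ℝ → E := fun x => contourSign x •
    (Complex.exp (contourPt φ x) • G (contourPt φ x) • K (contourPt φ x)) with hU
  set W : Bool × ℝ → E := fun y => contourSign y •
    (Complex.exp (contourPt φ' y) • (K (contourPt φ' y) * F (contourPt φ' y))) with hW
  set f : Bool × ℝ → E := fun y => contourSign y • F (contourPt φ' y) with hf
  set g : Bool × ℝ → ℂ := fun x => contourSign x • G (contourPt φ x) with hg
  have iU : Integrable U μ := iG.integrable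
  have iW : Integrable W μ := iF.integrable
  have cf : ContourIntegrable φ' F := contourIntegrable_of_exp_decay hφ'0.le
    (fun η h => (hF η (by rw [h]; exact hφ')).continuousAt) hδ
    fun η h => hFb η (by rw [h]; exact hφ')
  have cg : ContourIntegrable φ G := contourIntegrable_of_exp_decay hφ0.le
    (fun η h => (hG η (by rw [h]; linarith)).continuousAt) hδ
    fun η h => hGb η (by rw [h]; linarith)
  have i_f : Integrable f μ := cf.integrable
  have ig : Integrable g μ := cg.integrable
  have mk1 : Measurable fun z : (Bool × ℝ) × (Bool × ℝ) =>
      cauchyKernel (contourPt φ z.1) (contourPt φ' z.2) :=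
    measurable_cauchyKernel.comp (((continuous_contourPt φ).measurable.comp measurable_fst).prodMk
      ((continuous_contourPt φ').measurable.comp measurable_snd))
  have mk2 : Measurable fun z : (Bool × ℝ) × (Bool × ℝ) =>
      cauchyKernel (contourPt φ' z.2) (contourPt φ z.1) :=
    measurable_cauchyKernel.comp (((continuous_contourPt φ').measurable.comp measurable_snd).prodMk
      ((continuous_contourPt φ).measurable.comp measurable_fst))
  -- The Cauchy kernel is bounded on pairs of boundary points, so each half of the split double
  -- integral is dominated by a product of two integrable functions, one of which is the
  -- exponentially decaying symbol.
  have i1 : Integrable (fun z : (Bool × ℝ) × (Bool × ℝ) =>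
      cauchyKernel (contourPt φ z.1) (contourPt φ' z.2) • (U z.1 * f z.2)) (μ.prod μ) :=
    (iU.mul_prod i_f).bdd_smul M mk1.aestronglyMeasurable
      (.of_forall fun z => (hM _ _ (hx _) (hy _)).1)
  have i2 : Integrable (fun z : (Bool × ℝ) × (Bool × ℝ) =>
      cauchyKernel (contourPt φ' z.2) (contourPt φ z.1) • (g z.1 • W z.2)) (μ.prod μ) :=
    (ig.smul_prod iW).bdd_smul M mk2.aestronglyMeasurable
      (.of_forall fun z => (hM _ _ (hx _) (hy _)).2)
  -- The point of angle φ lies inside the sector of half-angle φ': the outer integral reproduces F.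
  have inner1 : ∀ x, ∫ y, cauchyKernel (contourPt φ x) (contourPt φ' y) • (U x * f y) ∂μ =
      (2 * Real.pi * Complex.I) • (U x * F (contourPt φ x)) := by
    intro x
    have hxθ : |(contourPt φ x).im| < φ' := by rw [hx]; exact hφφ'
    have hc := cauchy_formula hθ hφ' hxθ hF hδ hFb
    have hci : ContourIntegrable φ' fun η => cauchyKernel (contourPt φ x) η • F η := by
      refine contourIntegrable_of_exp_decay (C := M * C) (δ := δ) hφ'0.le (fun η h => ?_) hδ fun η h => ?_
      · refine ((differentiableAt_cauchyKernel fun h0 => ?_).smul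
          (hF η (by rw [h]; exact hφ'))).continuousAt
        have := exp_eq_exp_of_im (by
          have := abs_sub η.im (contourPt φ x).im
          rw [h, hx] at this; linarith) h0
        rw [← this, h] at hxθ
        exact lt_irrefl _ hxθ
      · rw [norm_smul, mul_assoc]
        exact mul_le_mul (hM _ _ (hx x) h).1 (hFb η (by rw [h]; exact hφ')) (norm_nonneg _)
          ((norm_nonneg _).trans (hM _ _ (hx x) h).1)
    have h2 := contourIntegral_eq hci
    unfold contourIntegral at h2
    rw [hc] at h2
    have h3 := (ContinuousLinearMap.mul ℂ E (U x)).integral_comp_comm hci.integrable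
    rw [← h2] at h3
    simp only [ContinuousLinearMap.mul_apply'] at h3
    rw [mul_smul_comm] at h3
    rw [← h3]
    refine integral_congr_ae (.of_forall fun y => ?_)
    simp only [hf, mul_smul_comm, smul_comm (contourSign y)]
  -- The point of angle φ' lies outside the sector of half-angle φ: the inner integral of G
  -- vanishes.
  have inner2 : ∀ y, ∫ x, cauchyKernel (contourPt φ' y) (contourPt φ x) • (g x • W y) ∂μ = 0 := by
    intro y
    have hyθ : φ < |(contourPt φ' y).im| := by rw [hy]; exact hφφ'
    have hc := cauchy_integral_eq_zero hθ hφ0.le hyθ (by rw [hy]; exact hφ') hG hδ hGb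
    have hci : ContourIntegrable φ fun η => cauchyKernel (contourPt φ' y) η • G η := by
      refine contourIntegrable_of_exp_decay (C := M * C) (δ := δ) hφ0.le (fun η h => ?_) hδ fun η h => ?_
      · refine ((differentiableAt_cauchyKernel fun h0 => ?_).smul
          (hG η (by rw [h]; linarith))).continuousAt
        have := exp_eq_exp_of_im (by
          have := abs_sub η.im (contourPt φ' y).im
          rw [h, hy] at this; linarith) h0
        rw [← this, h] at hyθ
        exact lt_irrefl _ hyθ
      · rw [norm_smul, mul_assoc]
        exact mul_le_mul (hM _ _ h (hy y)).2 (hGb η (by rw [h]; linarith)) (norm_nonneg _)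
          ((norm_nonneg _).trans (hM _ _ h (hy y)).2)
    have h2 := contourIntegral_eq hci
    unfold contourIntegral at h2
    rw [hc] at h2
    have h3 := integral_smul_const (μ := μ) (𝕜 := ℂ) (fun x => contourSign x •
      cauchyKernel (contourPt φ' y) (contourPt φ x) • G (contourPt φ x)) (W y)
    rw [← h2, zero_smul] at h3
    rw [← h3]
    refine integral_congr_ae (.of_forall fun x => ?_)
    simp only [hg, smul_smul, smul_eq_mul]
    congr 1; ring
  -- The resolvent identity divided by exp η - exp ζ. The factors exp ζ and exp η from dz and dw are
  -- distributed so that each half contains one Cauchy kernel; the scalar G moves freely past the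
  -- operators.
  have point : ∀ x y, ∑ j, (contourSign x • (Complex.exp (contourPt φ x) • G (contourPt φ x) •
        p j (contourPt φ x))) * (contourSign y • (Complex.exp (contourPt φ' y) •
        (q j (contourPt φ' y) * F (contourPt φ' y)))) =
      cauchyKernel (contourPt φ x) (contourPt φ' y) • (U x * f y) +
      cauchyKernel (contourPt φ' y) (contourPt φ x) • (g x • W y) := by
    intro x y
    have hne : Complex.exp (contourPt φ' y) - Complex.exp (contourPt φ x) ≠ 0 := fun h0 => by
      have h1 := exp_eq_exp_of_im (by
        have := abs_sub (contourPt φ' y).im (contourPt φ x).im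
        rw [hx, hy] at this; linarith) h0
      have h2 := hx x
      rw [← h1, hy] at h2; linarith
    have h1 := hid _ _ (hx x) (hy y)
    simp only [hU, hW, hf, hg]
    generalize contourPt φ x = ζ at *
    generalize contourPt φ' y = η at *
    have h2 : ∑ j, p j ζ * q j η = (Complex.exp η - Complex.exp ζ)⁻¹ • (K ζ - K η) := by
      rw [← h1, smul_smul, inv_mul_cancel₀ hne, one_smul]
    have h3 : ∑ j, (contourSign x • (Complex.exp ζ • G ζ • p j ζ)) * (contourSign y •
        (Complex.exp η • (q j η * F η))) = (contourSign x * Complex.exp ζ * G ζ * contourSign y *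
          Complex.exp η) • ((∑ j, p j ζ * q j η) * F η) := by
      rw [Finset.sum_mul, Finset.smul_sum]
      refine Finset.sum_congr rfl fun j _ => ?_
      simp only [smul_mul_assoc, mul_smul_comm, smul_smul, mul_assoc]
      congr 1; ring
    rw [h3, h2]
    have hne' : Complex.exp ζ - Complex.exp η ≠ 0 := by rw [← neg_sub]; exact neg_ne_zero.2 hne
    simp only [smul_mul_assoc, mul_smul_comm, smul_smul, sub_mul, smul_sub, smul_eq_mul,
      cauchyKernel]
    rw [sub_eq_add_neg, ← neg_smul]
    congr 2
    · field_simp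
    · rw [show Complex.exp ζ - Complex.exp η = -(Complex.exp η - Complex.exp ζ) by ring]
      field_simp
  have lhs : ∀ j, contourIntegral φ (fun ζ => Complex.exp ζ • G ζ • p j ζ) *
      contourIntegral φ' (fun η => Complex.exp η • (q j η * F η)) =
      ∫ z, (contourSign z.1 • (Complex.exp (contourPt φ z.1) • G (contourPt φ z.1) •
        p j (contourPt φ z.1))) * (contourSign z.2 • (Complex.exp (contourPt φ' z.2) •
        (q j (contourPt φ' z.2) * F (contourPt φ' z.2)))) ∂(μ.prod μ) := by
    intro j
    have h1 := (ip j).integrable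
    have h2 := (iq j).integrable
    rw [integral_prod _ (h1.mul_prod h2), contourIntegral_eq (ip j), contourIntegral_eq (iq j)]
    have h3 := ((ContinuousLinearMap.mul ℂ E).flip (∫ y, contourSign y •
      (Complex.exp (contourPt φ' y) • (q j (contourPt φ' y) * F (contourPt φ' y))) ∂μ)).integral_comp_comm
      h1
    simp only [ContinuousLinearMap.flip_apply, ContinuousLinearMap.mul_apply'] at h3
    rw [← h3]
    refine integral_congr_ae (.of_forall fun x => ?_)
    exact ((ContinuousLinearMap.mul ℂ E _).integral_comp_comm h2).symm
  -- Integrability of the product integrand is not assumed: it is that of the inner integral in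
  -- Fubini's theorem. The second orientation sign only cancels the first.
  have cint : ContourIntegrable φ fun ζ => Complex.exp ζ • (K ζ * (G ζ • F ζ)) := by
    have := i1.integral_prod_left
    simp only [inner1] at this
    have h2 := this.smul ((2 * Real.pi * Complex.I : ℂ)⁻¹)
    have h3 : Integrable (fun x => contourSign x • (contourSign x • (Complex.exp (contourPt φ x) •
        (K (contourPt φ x) * (G (contourPt φ x) • F (contourPt φ x)))))) μ := by
      refine (h2.bdd_smul 1 continuous_contourSign.aestronglyMeasurable
        (.of_forall fun x => (norm_contourSign x).le)).congr (.of_forall fun x => ?_)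
      have hpi : (2 * Real.pi * Complex.I : ℂ) ≠ 0 := Complex.two_pi_I_ne_zero
      simp only [Pi.smul_apply', Pi.smul_apply, hU, smul_mul_assoc, mul_smul_comm, smul_smul]
      congr 1
      field_simp
    have h4 := integrable_contourMeasure_iff.1 h3
    exact ⟨by simpa [contourSign, contourPt] using h4.1, by simpa [contourSign, contourPt] using h4.2⟩
  simp_rw [lhs]
  rw [← integral_finsetSum _ fun j _ => ((ip j).integrable.mul_prod (iq j).integrable)]
  simp_rw [point]
  rw [integral_add i1 i2, integral_prod _ i1, integral_prod_symm _ i2]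
  simp only [inner1, inner2, integral_zero, add_zero]
  rw [integral_smul, contourIntegral_eq cint]
  congr 1
  refine integral_congr_ae (.of_forall fun x => ?_)
  simp only [hU, smul_mul_assoc, mul_smul_comm, smul_smul]

end ContourProduct

/-! ### Components of a right linear operator and its conjugate. -/

section Components

variable {V : Type*} [NormedAddCommGroup V] [NormedSpace ℝ V]
  [Module ℍ[ℝ] V] [Module ℍ[ℝ]ᵐᵒᵖ V] [SMulCommClass ℍ[ℝ] ℍ[ℝ]ᵐᵒᵖ V]

@[simp] theorem e_zero : e 0 = 1 := rfl
@[simp] theorem e_one : e 1 = e₁ := rfl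
@[simp] theorem e_two : e 2 = e₂ := rfl
@[simp] theorem e_three : e 3 = e₃ := rfl
@[simp] theorem e₁_re : e₁.re = 0 := rfl
@[simp] theorem e₁_imI : e₁.imI = 1 := rfl
@[simp] theorem e₁_imJ : e₁.imJ = 0 := rfl
@[simp] theorem e₁_imK : e₁.imK = 0 := rfl
@[simp] theorem e₂_re : e₂.re = 0 := rfl
@[simp] theorem e₂_imI : e₂.imI = 0 := rfl
@[simp] theorem e₂_imJ : e₂.imJ = 1 := rfl
@[simp] theorem e₂_imK : e₂.imK = 0 := rfl
@[simp] theorem e₃_re : e₃.re = 0 := rfl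
@[simp] theorem e₃_imI : e₃.imI = 0 := rfl
@[simp] theorem e₃_imJ : e₃.imJ = 0 := rfl
@[simp] theorem e₃_imK : e₃.imK = 1 := rfl
/-- The real coordinates of a quaternion in the basis `e`. -/
def coord (q : ℍ[ℝ]) : Fin 4 → ℝ := ![q.re, q.imI, q.imJ, q.imK]

theorem sum_coord (q : ℍ[ℝ]) : q = ∑ m, (coord q m : ℍ[ℝ]) * e m := by
  ext <;> simp [Fin.sum_univ_four, coord]

/-- The signs in the formula for the components. -/
def compSign (i j : Fin 4) : ℍ[ℝ] := if j = i then e j else -e j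

/-- The three coefficient identities that follow express, in this order, that the averaging formula
extracts the i-th coefficient of ∑ e_k w_k, that it is left linear, and that ∑ e_i T_i restores T.
-/
theorem comp_coeff (i k : Fin 4) :
    ∑ j, ((4⁻¹ : ℝ) : ℍ[ℝ]) * e i * compSign i j * (e k * e j) = if k = i then 1 else 0 := by
  simp only [Fin.sum_univ_four, compSign, Quaternion.coe_mul_eq_smul, smul_mul_assoc]
  fin_cases i <;> fin_cases k <;> ext <;> simp <;> norm_num

theorem comp_coeff_left (i m : Fin 4) (q : ℍ[ℝ]) :
    ∑ j, ((4⁻¹ : ℝ) : ℍ[ℝ]) * e i * compSign i j * (coord (e j * q) m : ℍ[ℝ]) =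
      q * (((4⁻¹ : ℝ) : ℍ[ℝ]) * e i * compSign i m) := by
  simp only [Fin.sum_univ_four, compSign, Quaternion.coe_mul_eq_smul, smul_mul_assoc, Quaternion.mul_coe_eq_smul, mul_smul_comm]
  fin_cases i <;> fin_cases m <;> ext <;> simp [coord]

theorem app_coeff (m : Fin 4) :
    ∑ i, e i * (((4⁻¹ : ℝ) : ℍ[ℝ]) * e i * compSign i m) = if m = 0 then 1 else 0 := by
  simp only [Fin.sum_univ_four, compSign, Quaternion.coe_mul_eq_smul, smul_mul_assoc, mul_smul_comm]
  fin_cases m <;> ext <;> simp <;> norm_num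
namespace RightOp

variable (T : RightOp V)

variable {T}

theorem smul_mem_dom {v : V} (hv : v ∈ T.dom) (q : ℍ[ℝ]) : q • v ∈ T.dom := T.smul_mem q v hv

theorem app_of_mem {v : V} (hv : v ∈ T.dom) : T.app v = T.toPMap ⟨v, hv⟩ := dif_pos hv

theorem app_add {u v : V} (hu : u ∈ T.dom) (hv : v ∈ T.dom) :
    T.app (u + v) = T.app u + T.app v := by
  rw [app_of_mem hu, app_of_mem hv, app_of_mem (add_mem hu hv)]
  exact T.toPMap.map_add ⟨u, hu⟩ ⟨v, hv⟩

theorem app_op_smul {v : V} (hv : v ∈ T.dom) (r : ℍ[ℝ]ᵐᵒᵖ) : T.app (r • v) = r • T.app v := by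
  rw [app_of_mem hv, app_of_mem (T.dom.smul_mem r hv)]
  exact T.toPMap.map_smul r ⟨v, hv⟩

theorem comp_of_mem {v : V} (hv : v ∈ T.dom) (i : Fin 4) : T.comp i v = T.compMap i ⟨v, hv⟩ :=
  dif_pos hv

theorem comp_add {u v : V} (hu : u ∈ T.dom) (hv : v ∈ T.dom) (i : Fin 4) :
    T.comp i (u + v) = T.comp i u + T.comp i v := by
  rw [comp_of_mem hu, comp_of_mem hv, comp_of_mem (add_mem hu hv), ← map_add]; rfl

theorem comp_op_smul {v : V} (hv : v ∈ T.dom) (i : Fin 4) (r : ℍ[ℝ]ᵐᵒᵖ) :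
    T.comp i (r • v) = r • T.comp i v := by
  rw [comp_of_mem hv, comp_of_mem (T.dom.smul_mem r hv), ← map_smul]; rfl

theorem comp_eq {v : V} (hv : v ∈ T.dom) (i : Fin 4) :
    T.comp i v = ∑ j, (((4⁻¹ : ℝ) : ℍ[ℝ]) * e i * compSign i j) • T.app (e j • v) := by
  rw [comp_of_mem hv]
  simp only [compMap, LinearMap.comp_apply, LinearMap.sum_apply]
  change (((4⁻¹ : ℝ) : ℍ[ℝ]) * e i) • (∑ j, compSign i j • T.toPMap ⟨e j • v, _⟩) = _
  rw [Finset.smul_sum]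
  refine Finset.sum_congr rfl fun j _ => ?_
  rw [app_of_mem (smul_mem_dom hv _), mul_smul, mul_smul, mul_smul]

theorem conj_app {v : V} (hv : v ∈ T.dom) : T.conj.app v =
    e 0 • T.comp 0 v - e 1 • T.comp 1 v - e 2 • T.comp 2 v - e 3 • T.comp 3 v := by
  rw [app_of_mem (T := T.conj) hv]
  simp only [comp_of_mem hv]
  rfl

variable [IsScalarTower ℝ ℍ[ℝ] V] [IsScalarTower ℝ ℍ[ℝ]ᵐᵒᵖ V]

theorem real_smul_eq (r : ℝ) (v : V) : (r : ℍ[ℝ]) • v = r • v := by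
  rw [← Quaternion.algebraMap_def, algebraMap_smul]

theorem op_real_smul_eq (r : ℝ) (v : V) : MulOpposite.op (r : ℍ[ℝ]) • v = r • v := by
  have : MulOpposite.op (r : ℍ[ℝ]) = r • (1 : ℍ[ℝ]ᵐᵒᵖ) := by
    rw [← MulOpposite.op_one, ← MulOpposite.op_smul]
    congr 1
    rw [← Quaternion.algebraMap_def, Algebra.algebraMap_eq_smul_one]
  rw [this, smul_assoc, one_smul]

/-- Real scalars act identically from both sides, so real coordinates of a left factor can be pulled
out of a map that is only right linear. -/
theorem real_smul_eq_op (r : ℝ) (v : V) : (r : ℍ[ℝ]) • v = MulOpposite.op (r : ℍ[ℝ]) • v := by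
  rw [real_smul_eq, op_real_smul_eq]

theorem app_sum {ι : Type*} (s : Finset ι) {v : ι → V} (hv : ∀ i ∈ s, v i ∈ T.dom) :
    T.app (∑ i ∈ s, v i) = ∑ i ∈ s, T.app (v i) := by
  classical
  induction s using Finset.induction_on with
  | empty =>
    have := app_op_smul (T := T) (zero_mem _) 0
    simpa using this
  | insert a s ha ih =>
    rw [Finset.sum_insert ha, Finset.sum_insert ha, app_add (hv a (by simp))
      (sum_mem fun i hi => hv i (by simp [hi])), ih fun i hi => hv i (by simp [hi])]

theorem app_smul_eq {v : V} (hv : v ∈ T.dom) (q : ℍ[ℝ]) :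
    T.app (q • v) = ∑ m, (coord q m : ℍ[ℝ]) • T.app (e m • v) := by
  conv_lhs => rw [sum_coord q, Finset.sum_smul]
  rw [app_sum _ fun m _ => smul_mem_dom hv _]
  refine Finset.sum_congr rfl fun m _ => ?_
  rw [mul_smul, real_smul_eq_op, app_op_smul (smul_mem_dom hv _), ← real_smul_eq_op]

/-- The components are left linear. -/
theorem comp_smul {v : V} (hv : v ∈ T.dom) (i : Fin 4) (q : ℍ[ℝ]) :
    T.comp i (q • v) = q • T.comp i v := by
  rw [comp_eq hv, comp_eq (smul_mem_dom hv q), Finset.smul_sum]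
  have : ∀ j, T.app (e j • q • v) = ∑ m, (coord (e j * q) m : ℍ[ℝ]) • T.app (e m • v) := by
    intro j; rw [smul_smul, app_smul_eq hv]
  simp_rw [this, Finset.smul_sum]
  rw [Finset.sum_comm]
  refine Finset.sum_congr rfl fun m _ => ?_
  simp_rw [smul_smul]
  rw [← Finset.sum_smul, comp_coeff_left]

theorem app_eq_sum {v : V} (hv : v ∈ T.dom) : T.app v = ∑ i, e i • T.comp i v := by
  simp_rw [comp_eq hv, Finset.smul_sum, smul_smul]
  rw [Finset.sum_comm]
  simp_rw [← Finset.sum_smul, app_coeff]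
  simp

theorem app_eq {v : V} (hv : v ∈ T.dom) : T.app v =
    e 0 • T.comp 0 v + e 1 • T.comp 1 v + e 2 • T.comp 2 v + e 3 • T.comp 3 v := by
  rw [app_eq_sum hv, Fin.sum_univ_four]

/-- The components are determined by the expansion `∑ e_k w_k`. -/
theorem comp_eq_of_app {v : V} (hv : v ∈ T.dom) {w : Fin 4 → V}
    (h : ∀ j, T.app (e j • v) = ∑ k, (e k * e j) • w k) (i : Fin 4) : T.comp i v = w i := by
  rw [comp_eq hv]
  simp_rw [h, Finset.smul_sum, smul_smul]
  rw [Finset.sum_comm]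
  simp_rw [← Finset.sum_smul, comp_coeff]
  simp

/-- The signs of the conjugation. -/
def conjSign : Fin 4 → ℝ := ![1, -1, -1, -1]

theorem conj_comp {v : V} (hv : v ∈ T.dom) (i : Fin 4) :
    T.conj.comp i v = conjSign i • T.comp i v := by
  refine comp_eq_of_app (T := T.conj) (w := fun i => conjSign i • T.comp i v) hv (fun j => ?_) i
  rw [conj_app (smul_mem_dom hv _)]
  simp only [comp_smul hv, Fin.sum_univ_four, conjSign, smul_smul]
  simp [sub_eq_add_neg]

theorem conj_comp_zero {v : V} (hv : v ∈ T.dom) : T.conj.comp 0 v = T.comp 0 v := by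
  rw [conj_comp hv]; simp [conjSign]

theorem conj_conj (T : RightOp V) : T.conj.conj = T := by
  have h : T.conj.conj.toPMap = T.toPMap := by
    refine LinearPMap.ext rfl fun x hx' hx => ?_
    change x ∈ T.dom at hx
    refine (app_of_mem (T := T.conj.conj) (v := x) hx').symm.trans
      (Eq.trans ?_ (app_of_mem (T := T) hx))
    rw [conj_app (T := T.conj) hx, app_eq hx]
    simp only [conj_comp hx]
    simp [conjSign]
  cases T
  simp only [conj] at h ⊢
  congr 1

theorem conj_absSq {v : V} (hv : v ∈ T.domSq) : T.conj.absSq v = T.absSq v := by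
  unfold absSq
  refine Finset.sum_congr rfl fun i _ => ?_
  rw [conj_comp hv.1]
  have h2 : ∀ r : ℝ, T.conj.comp i (r • T.comp i v) = conjSign i • r • T.comp i (T.comp i v) := by
    intro r
    rw [← real_smul_eq r (T.comp i v), conj_comp (smul_mem_dom (hv.2 i) _), comp_smul (hv.2 i),
      real_smul_eq]
  rw [h2, smul_smul]
  fin_cases i <;> simp [conjSign]

theorem conj_domSq : T.conj.domSq = T.domSq := by
  ext v
  refine and_congr_right fun hv => forall_congr' fun i => ?_
  change T.conj.comp i v ∈ T.dom ↔ _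
  rw [conj_comp (T := T) hv]
  fin_cases i <;> simp [conjSign]

theorem conj_Q {v : V} (hv : v ∈ T.domSq) (s : ℍ[ℝ]) : T.conj.Q s v = T.Q s v := by
  rw [Q, Q, conj_absSq hv, conj_comp_zero hv.1]

/-- For commuting components `T T̄ = |T|²`. -/
theorem app_conj_app {v : V} (hv : v ∈ T.domSq)
    (hc : ∀ i j, T.comp i (T.comp j v) = T.comp j (T.comp i v)) :
    T.app (T.conj.app v) = T.absSq v := by
  have hm : ∀ q i, q • T.comp i v ∈ T.dom := fun q i => smul_mem_dom (hv.2 i) q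
  have hmem : T.conj.app v ∈ T.dom := by
    rw [conj_app hv.1]
    exact sub_mem (sub_mem (sub_mem (hm _ _) (hm _ _)) (hm _ _)) (hm _ _)
  have hk : ∀ k, T.comp k (T.conj.app v) = e 0 • T.comp k (T.comp 0 v) +
      -e 1 • T.comp k (T.comp 1 v) + -e 2 • T.comp k (T.comp 2 v) +
      -e 3 • T.comp k (T.comp 3 v) := by
    intro k
    rw [conj_app hv.1, sub_eq_add_neg, sub_eq_add_neg, sub_eq_add_neg, ← neg_smul, ← neg_smul,
      ← neg_smul, comp_add (add_mem (add_mem (hm _ _) (hm _ _)) (hm _ _)) (hm _ _),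
      comp_add (add_mem (hm _ _) (hm _ _)) (hm _ _), comp_add (hm _ _) (hm _ _)]
    simp only [comp_smul (hv.2 _)]
  rw [app_eq hmem]
  simp only [hk, absSq, Fin.sum_univ_four, smul_add, smul_smul]
  -- Once the components are in a common order, the mixed imaginary terms cancel because distinct
  -- imaginary units anticommute, and the terms with T₀ cancel because of the conjugation.
  rw [hc 1 0, hc 2 0, hc 3 0, hc 2 1, hc 3 1, hc 3 2]
  have e11 : e 1 * e 1 = -1 := by ext <;> simp
  have e22 : e 2 * e 2 = -1 := by ext <;> simp
  have e33 : e 3 * e 3 = -1 := by ext <;> simp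
  have e21 : e 2 * e 1 = -(e 1 * e 2) := by ext <;> simp
  have e31 : e 3 * e 1 = -(e 1 * e 3) := by ext <;> simp
  have e32 : e 3 * e 2 = -(e 2 * e 3) := by ext <;> simp
  simp only [e_zero, mul_neg, e11, e22, e33, e21, e31, e32, one_mul, mul_one, neg_neg, one_smul,
    neg_smul]
  abel

end RightOp

end Components

/-! ### Planes ℂ_J and sectors in the quaternions. -/

section Geometry

theorem imSphere_mul_self {J : ℍ[ℝ]} (hJ : J ∈ imSphere) : J * J = -1 := by
  have h1 := Quaternion.normSq_eq_norm_mul_self J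
  rw [hJ.2, Quaternion.normSq_def', hJ.1] at h1
  ext <;> simp [hJ.1]
  · nlinarith
  all_goals ring

theorem imSphere_inv {J : ℍ[ℝ]} (hJ : J ∈ imSphere) : J⁻¹ = -J := by
  refine inv_eq_of_mul_eq_one_right ?_
  rw [mul_neg, imSphere_mul_self hJ, neg_neg]

/-- The point of the plane `ℂ_J` with complex coordinate `z`. -/
def planePt (J : ℍ[ℝ]) (z : ℂ) : ℍ[ℝ] := slicePt J (z.re, z.im)

theorem planePt_eq (J : ℍ[ℝ]) (z : ℂ) : planePt J z = (z.re : ℍ[ℝ]) + J * (z.im : ℍ[ℝ]) := rfl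

theorem planePt_re {J : ℍ[ℝ]} (hJ : J ∈ imSphere) (z : ℂ) : (planePt J z).re = z.re := by
  simp [planePt_eq, hJ.1]

theorem planePt_mul {J : ℍ[ℝ]} (hJ : J ∈ imSphere) (z w : ℂ) :
    planePt J (z * w) = planePt J z * planePt J w := by
  have h1 := imSphere_mul_self hJ
  simp only [planePt_eq, Quaternion.mul_coe_eq_smul, Complex.mul_re, Complex.mul_im]
  rw [add_mul, mul_add, mul_add]
  simp only [smul_mul_assoc, mul_smul_comm, h1, Quaternion.coe_mul_eq_smul,
    Quaternion.mul_coe_eq_smul]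
  ext <;> simp <;> ring

theorem normSq_planePt {J : ℍ[ℝ]} (hJ : J ∈ imSphere) (z : ℂ) :
    Quaternion.normSq (planePt J z) = Complex.normSq z := by
  have h1 := Quaternion.normSq_eq_norm_mul_self J
  rw [hJ.2, Quaternion.normSq_def', hJ.1] at h1
  rw [Quaternion.normSq_def', Complex.normSq_apply, planePt_eq, Quaternion.mul_coe_eq_smul]
  simp [hJ.1]
  linear_combination z.im ^ 2 * h1

theorem norm_planePt {J : ℍ[ℝ]} (hJ : J ∈ imSphere) (z : ℂ) : ‖planePt J z‖ = ‖z‖ := by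
  have h := normSq_planePt hJ z
  rw [Quaternion.normSq_eq_norm_mul_self, Complex.normSq_eq_norm_sq, ← pow_two] at h
  exact (pow_left_inj₀ (norm_nonneg _) (norm_nonneg _) two_ne_zero).1 h

theorem abs_re_le_norm (s : ℍ[ℝ]) : |s.re| ≤ ‖s‖ := by
  refine abs_le_of_sq_le_sq ?_ (norm_nonneg _)
  have h := Quaternion.normSq_eq_norm_mul_self s
  rw [Quaternion.normSq_def'] at h
  nlinarith [sq_nonneg s.imI, sq_nonneg s.imJ, sq_nonneg s.imK]

theorem cos_arccos_re_div (s : ℍ[ℝ]) :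
    Real.cos (Real.arccos (s.re / ‖s‖)) = s.re / ‖s‖ := by
  have := abs_le.1 (show |s.re / ‖s‖| ≤ 1 by
    rw [abs_div, abs_norm]; exact div_le_one_of_le₀ (abs_re_le_norm s) (norm_nonneg _))
  exact Real.cos_arccos this.1 this.2

/-- The cosine is decreasing on [0, π]. In this form the condition s ≠ 0 is automatic, and openness,
closure and invariance under a change of J are visible. -/
theorem mem_sector_iff {ω : ℝ} (h0 : 0 ≤ ω) (hπ : ω ≤ Real.pi) {s : ℍ[ℝ]} :
    s ∈ sector ω ↔ ‖s‖ * Real.cos ω < s.re := by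
  constructor
  · rintro ⟨hs, h⟩
    have h1 := Real.cos_lt_cos_of_nonneg_of_le_pi (Real.arccos_nonneg _) hπ h
    rw [cos_arccos_re_div, lt_div_iff₀ (norm_pos_iff.2 hs)] at h1
    linarith
  · intro h
    have hs : s ≠ 0 := by rintro rfl; simp at h
    refine ⟨hs, ?_⟩
    by_contra hle
    push Not at hle
    have h1 := Real.cos_le_cos_of_nonneg_of_le_pi h0 (Real.arccos_le_pi _) hle
    rw [cos_arccos_re_div, div_le_iff₀ (norm_pos_iff.2 hs)] at h1
    linarith

theorem closure_sector_subset {ω : ℝ} (h0 : 0 ≤ ω) (hπ : ω ≤ Real.pi) :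
    closure (sector ω) ⊆ {s | ‖s‖ * Real.cos ω ≤ s.re} := by
  refine closure_minimal (fun s hs => ((mem_sector_iff h0 hπ).1 hs).le) ?_
  exact isClosed_le (by fun_prop) Quaternion.continuous_re

/-- The complement of the closed sector of half-angle `ω` in the complex plane. -/
def coSector (ω : ℝ) : Set ℂ := {z | z.re < ‖z‖ * Real.cos ω}

theorem isOpen_coSector (ω : ℝ) : IsOpen (coSector ω) :=
  isOpen_lt Complex.continuous_re (by fun_prop)

theorem conj_mem_coSector {ω : ℝ} {z : ℂ} (hz : z ∈ coSector ω) :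
    starRingEnd ℂ z ∈ coSector ω := by
  simpa [coSector] using hz

theorem planePt_notMem_closure {ω : ℝ} (h0 : 0 ≤ ω) (hπ : ω ≤ Real.pi) {J : ℍ[ℝ]}
    (hJ : J ∈ imSphere) {z : ℂ} (hz : z ∈ coSector ω) : planePt J z ∉ closure (sector ω) := by
  intro h
  have h1 : ‖planePt J z‖ * Real.cos ω ≤ (planePt J z).re := closure_sector_subset h0 hπ h
  rw [norm_planePt hJ, planePt_re hJ] at h1
  have h2 : z.re < ‖z‖ * Real.cos ω := hz
  linarith

theorem e₁_mem_imSphere : e₁ ∈ imSphere := by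
  refine ⟨rfl, ?_⟩
  have h := Quaternion.normSq_eq_norm_mul_self e₁
  rw [Quaternion.normSq_def'] at h
  simp at h
  nlinarith [norm_nonneg e₁]

end Geometry

/-! ### The complex structure by right multiplication and the eigenprojections of J. -/

section ComplexStructure

variable {V : Type*} [NormedAddCommGroup V] [NormedSpace ℝ V]
  [Module ℍ[ℝ] V] [Module ℍ[ℝ]ᵐᵒᵖ V] [SMulCommClass ℍ[ℝ] ℍ[ℝ]ᵐᵒᵖ V]

/-- The ring homomorphism `ℂ → ℍᵐᵒᵖ` onto the plane spanned by `1` and `e₁`. -/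
def complexToOp : ℂ →+* ℍ[ℝ]ᵐᵒᵖ where
  toFun z := MulOpposite.op (z : ℍ[ℝ])
  map_one' := by simp
  map_zero' := by simp
  map_add' z w := by simp
  map_mul' z w := by rw [mul_comm, Quaternion.coeComplex_mul, MulOpposite.op_mul]

/-- Complex scalars act through right multiplication by the plane spanned by `1` and `e₁`. -/
class RightComplex (V : Type*) [NormedAddCommGroup V] [Module ℍ[ℝ]ᵐᵒᵖ V] [NormedSpace ℂ V] :
    Prop where
  smul_eq : ∀ (z : ℂ) (v : V), z • v = MulOpposite.op (z : ℍ[ℝ]) • v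

/-- The complex Banach space given by right multiplication. -/
@[reducible] def rightComplexSpace (V : Type*) [NormedAddCommGroup V] [Module ℍ[ℝ]ᵐᵒᵖ V]
    [NormSMulClass ℍ[ℝ]ᵐᵒᵖ V] : NormedSpace ℂ V where
  __ := Module.compHom V complexToOp
  norm_smul_le z v := by
    have : ‖MulOpposite.op (z : ℍ[ℝ])‖ = ‖z‖ := by
      rw [MulOpposite.norm_op]
      have h : Quaternion.normSq (z : ℍ[ℝ]) = Complex.normSq z := by
        rw [Quaternion.normSq_def', Complex.normSq_apply]; simp; ring
      rw [Quaternion.normSq_eq_norm_mul_self, Complex.normSq_eq_norm_sq, ← pow_two] at h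
      exact (pow_left_inj₀ (norm_nonneg _) (norm_nonneg _) two_ne_zero).1 h
    rw [← this]
    exact (norm_smul (MulOpposite.op (z : ℍ[ℝ])) v).le

theorem rightComplex_rightComplexSpace (V : Type*) [NormedAddCommGroup V] [Module ℍ[ℝ]ᵐᵒᵖ V]
    [NormSMulClass ℍ[ℝ]ᵐᵒᵖ V] : @RightComplex V _ _ (rightComplexSpace V) :=
  letI := rightComplexSpace V
  ⟨fun _ _ => rfl⟩

variable [NormedSpace ℂ V] [RightComplex V]

/-- Complex scalars act from the right, hence commute with left multiplication even by quaternions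
outside the plane of `e₁`. -/
instance : SMulCommClass ℍ[ℝ] ℂ V :=
  ⟨fun q z v => by rw [RightComplex.smul_eq, RightComplex.smul_eq, smul_comm]⟩

variable [IsScalarTower ℝ ℍ[ℝ] V] [IsScalarTower ℝ ℍ[ℝ]ᵐᵒᵖ V]

theorem real_complex_smul (r : ℝ) (v : V) : (r : ℂ) • v = r • v := by
  rw [RightComplex.smul_eq, Quaternion.coeComplex_coe, RightOp.op_real_smul_eq]

instance : IsScalarTower ℝ ℂ V :=
  ⟨fun r z v => by rw [Complex.real_smul, mul_smul, real_complex_smul]⟩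

variable [NormSMulClass ℍ[ℝ] V]

/-- Left multiplication as a complex linear operator. -/
def leftC (q : ℍ[ℝ]) : V →L[ℂ] V :=
  LinearMap.mkContinuous
    { toFun := fun v => q • v
      map_add' := smul_add q
      map_smul' := fun z v => smul_comm q z v } ‖q‖ fun v => (norm_smul q v).le

@[simp] theorem leftC_apply (q : ℍ[ℝ]) (v : V) : leftC q v = q • v := rfl

theorem norm_leftC_le (q : ℍ[ℝ]) : ‖(leftC q : V →L[ℂ] V)‖ ≤ ‖q‖ :=
  LinearMap.mkContinuous_norm_le _ (norm_nonneg _) _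

theorem leftC_mul (p q : ℍ[ℝ]) : (leftC (p * q) : V →L[ℂ] V) = leftC p * leftC q := by
  ext v; simp [mul_smul]

theorem leftC_add (p q : ℍ[ℝ]) : (leftC (p + q) : V →L[ℂ] V) = leftC p + leftC q := by
  ext v; simp [add_smul]

theorem leftC_neg (q : ℍ[ℝ]) : (leftC (-q) : V →L[ℂ] V) = -leftC q := by
  ext v; simp

theorem leftC_one : (leftC 1 : V →L[ℂ] V) = 1 := by
  ext v; simp

theorem leftC_coe (r : ℝ) : (leftC (r : ℍ[ℝ]) : V →L[ℂ] V) = (r : ℂ) • 1 := by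
  ext v; simp [RightOp.real_smul_eq]; exact (real_complex_smul r v).symm

/-- The projection onto `{v : J v = v e₁}`. -/
def projP (J : ℍ[ℝ]) : V →L[ℂ] V := (2⁻¹ : ℂ) • (1 - Complex.I • leftC J)

/-- The projection onto `{v : J v = -v e₁}`. -/
def projM (J : ℍ[ℝ]) : V →L[ℂ] V := (2⁻¹ : ℂ) • (1 + Complex.I • leftC J)

theorem projP_add_projM (J : ℍ[ℝ]) : (projP J + projM J : V →L[ℂ] V) = 1 := by
  rw [projP, projM, ← smul_add, sub_add_add_cancel, ← two_smul ℂ, smul_smul]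
  norm_num

variable {J : ℍ[ℝ]}

theorem leftC_sq (hJ : J ∈ imSphere) : (leftC J * leftC J : V →L[ℂ] V) = -1 := by
  rw [← leftC_mul, imSphere_mul_self hJ, leftC_neg, leftC_one]

theorem leftC_mul_projP (hJ : J ∈ imSphere) :
    (leftC J * projP J : V →L[ℂ] V) = Complex.I • projP J := by
  rw [projP, mul_smul_comm, mul_sub, mul_one, mul_smul_comm, leftC_sq hJ,
    smul_comm Complex.I (2⁻¹ : ℂ), smul_sub Complex.I, smul_smul Complex.I Complex.I,
    Complex.I_mul_I]
  congr 1
  module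

theorem leftC_mul_projM (hJ : J ∈ imSphere) :
    (leftC J * projM J : V →L[ℂ] V) = -Complex.I • projM J := by
  rw [projM, mul_smul_comm, mul_add, mul_one, mul_smul_comm, leftC_sq hJ,
    smul_comm (-Complex.I) (2⁻¹ : ℂ), smul_add (-Complex.I), smul_smul (-Complex.I) Complex.I,
    neg_mul, Complex.I_mul_I]
  congr 1
  module

theorem projP_mul_comm {A : V →L[ℂ] V} (h : A * leftC J = leftC J * A) :
    A * projP J = projP J * A := by
  simp only [projP, mul_smul_comm, smul_mul_assoc, mul_sub, sub_mul, mul_one, one_mul, h]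

theorem projM_mul_comm {A : V →L[ℂ] V} (h : A * leftC J = leftC J * A) :
    A * projM J = projM J * A := by
  simp only [projM, mul_smul_comm, smul_mul_assoc, mul_add, add_mul, mul_one, one_mul, h]

theorem projP_mul_projP (hJ : J ∈ imSphere) : (projP J * projP J : V →L[ℂ] V) = projP J := by
  nth_rw 1 [projP]
  rw [smul_mul_assoc, sub_mul, one_mul, smul_mul_assoc, leftC_mul_projP hJ, smul_smul,
    Complex.I_mul_I]
  module

theorem projM_mul_projP (hJ : J ∈ imSphere) : (projM J * projP J : V →L[ℂ] V) = 0 := by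
  nth_rw 1 [projM]
  rw [smul_mul_assoc, add_mul, one_mul, smul_mul_assoc, leftC_mul_projP hJ, smul_smul,
    Complex.I_mul_I]
  module

theorem projM_mul_projM (hJ : J ∈ imSphere) : (projM J * projM J : V →L[ℂ] V) = projM J := by
  nth_rw 1 [projM]
  rw [smul_mul_assoc, add_mul, one_mul, smul_mul_assoc, leftC_mul_projM hJ, smul_smul, mul_neg,
    Complex.I_mul_I]
  module

theorem projP_mul_projM (hJ : J ∈ imSphere) : (projP J * projM J : V →L[ℂ] V) = 0 := by
  nth_rw 1 [projP]
  rw [smul_mul_assoc, sub_mul, one_mul, smul_mul_assoc, leftC_mul_projM hJ, smul_smul, mul_neg,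
    Complex.I_mul_I]
  module

/-- On the range of `projP J` left multiplication by J is the scalar i, on that of `projM J` it is
-i. So the quaternion x + Jy acts as a central scalar on each range, as z on the first and as the
conjugate of z on the second. -/
theorem leftC_planePt_mul_projP (hJ : J ∈ imSphere) (z : ℂ) :
    (leftC (planePt J z) * projP J : V →L[ℂ] V) = z • projP J := by
  rw [planePt_eq, leftC_add, leftC_mul, leftC_coe, leftC_coe, add_mul, mul_smul_comm, mul_one,
    smul_mul_assoc, smul_mul_assoc, one_mul, leftC_mul_projP hJ, smul_smul, ← add_smul,
    Complex.re_add_im]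

theorem leftC_planePt_mul_projM (hJ : J ∈ imSphere) (z : ℂ) :
    (leftC (planePt J z) * projM J : V →L[ℂ] V) = starRingEnd ℂ z • projM J := by
  rw [planePt_eq, leftC_add, leftC_mul, leftC_coe, leftC_coe, add_mul, mul_smul_comm, mul_one,
    smul_mul_assoc, smul_mul_assoc, one_mul, leftC_mul_projM hJ, smul_smul, ← add_smul]
  congr 1
  apply Complex.ext <;> simp

theorem norm_projP_le (hJ : J ∈ imSphere) : ‖(projP J : V →L[ℂ] V)‖ ≤ 1 := by
  have h1 : ‖(1 : V →L[ℂ] V)‖ ≤ 1 := ContinuousLinearMap.norm_id_le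
  have h2 := norm_leftC_le (V := V) J
  rw [hJ.2] at h2
  rw [projP, norm_smul]
  have h3 : ‖(1 : V →L[ℂ] V) - Complex.I • leftC J‖ ≤ 2 := by
    refine (norm_sub_le _ _).trans ?_
    rw [norm_smul, Complex.norm_I, one_mul]; linarith
  norm_num
  linarith

theorem norm_projM_le (hJ : J ∈ imSphere) : ‖(projM J : V →L[ℂ] V)‖ ≤ 1 := by
  have h1 : ‖(1 : V →L[ℂ] V)‖ ≤ 1 := ContinuousLinearMap.norm_id_le
  have h2 := norm_leftC_le (V := V) J
  rw [hJ.2] at h2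
  rw [projM, norm_smul]
  have h3 : ‖(1 : V →L[ℂ] V) + Complex.I • leftC J‖ ≤ 2 := by
    refine (norm_add_le _ _).trans ?_
    rw [norm_smul, Complex.norm_I, one_mul]; linarith
  norm_num
  linarith

end ComplexStructure

/-! ### The inverse of Q_z, the resolvents of T and T̄, and their commutation. -/

section Resolvents

variable {V : Type*} [NormedAddCommGroup V] [NormedSpace ℝ V]
  [Module ℍ[ℝ] V] [Module ℍ[ℝ]ᵐᵒᵖ V] [SMulCommClass ℍ[ℝ] ℍ[ℝ]ᵐᵒᵖ V]
  [IsScalarTower ℝ ℍ[ℝ] V] [IsScalarTower ℝ ℍ[ℝ]ᵐᵒᵖ V]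

namespace RightOp

/-- The structure of an operator of type `(α, β, ω)` without the growth estimates. -/
structure IsCore (T : RightOp V) (D : Submodule ℍ[ℝ]ᵐᵒᵖ V) (ω : ℝ) : Prop where
  isKC : T.IsKC
  isKC_conj : T.conj.IsKC
  admissible : T.IsAdmissibleDomain D
  bijOn : ∀ s ∉ closure (sector ω), BijOn (T.Q s) (D : Set V) univ

theorem IsOfType.isCore {T : RightOp V} {D : Submodule ℍ[ℝ]ᵐᵒᵖ V} {α β ω : ℝ}
    (h : T.IsOfType D α β ω) : T.IsCore D ω where
  isKC := h.isKC
  isKC_conj := h.isKC_conj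
  admissible := h.admissible
  bijOn s hs := by
    by_contra hb
    exact hs (h.specF_subset hb)

variable {T : RightOp V} {D : Submodule ℍ[ℝ]ᵐᵒᵖ V} {ω : ℝ}

/-- T and T̄ share T₀, |T|² and their domains, hence Q; every later result for T thereby also holds
for T̄. -/
theorem IsCore.conj (h : T.IsCore D ω) : T.conj.IsCore D ω where
  isKC := h.isKC_conj
  isKC_conj := by rw [conj_conj]; exact h.isKC
  admissible :=
    { smul_mem := h.admissible.smul_mem
      dense := h.admissible.dense
      subset_domSq := by rw [conj_domSq]; exact h.admissible.subset_domSq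
      comp_mem := fun v hv hm i => by
        have hv' := h.admissible.subset_domSq hv
        rw [conj_absSq hv'] at hm
        rw [conj_comp hv'.1, ← op_real_smul_eq]
        exact D.smul_mem _ (h.admissible.comp_mem v hv hm i)
      isClosed_Q := fun s => by
        convert h.admissible.isClosed_Q s using 1
        ext p
        refine and_congr_right fun hp => ?_
        rw [conj_Q (h.admissible.subset_domSq hp)] }
  bijOn s hs := (h.bijOn s hs).congr fun v hv =>
    (conj_Q (h.admissible.subset_domSq hv) s).symm

theorem absSq_add {u v : V} (hu : u ∈ T.domSq) (hv : v ∈ T.domSq) :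
    T.absSq (u + v) = T.absSq u + T.absSq v := by
  simp only [absSq, comp_add hu.1 hv.1, comp_add (hu.2 _) (hv.2 _), Finset.sum_add_distrib]

theorem absSq_smul {v : V} (hv : v ∈ T.domSq) (q : ℍ[ℝ]) : T.absSq (q • v) = q • T.absSq v := by
  simp only [absSq, comp_smul hv.1, comp_smul (hv.2 _), Finset.smul_sum]

theorem absSq_op_smul {v : V} (hv : v ∈ T.domSq) (r : ℍ[ℝ]ᵐᵒᵖ) :
    T.absSq (r • v) = r • T.absSq v := by
  simp only [absSq, comp_op_smul hv.1, comp_op_smul (hv.2 _), Finset.smul_sum]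

theorem Q_add {u v : V} (hu : u ∈ T.domSq) (hv : v ∈ T.domSq) (s : ℍ[ℝ]) :
    T.Q s (u + v) = T.Q s u + T.Q s v := by
  simp only [Q, absSq_add hu hv, comp_add hu.1 hv.1, smul_add]
  abel

theorem Q_op_smul {v : V} (hv : v ∈ T.domSq) (s : ℍ[ℝ]) (r : ℍ[ℝ]ᵐᵒᵖ) :
    T.Q s (r • v) = r • T.Q s v := by
  simp only [Q, absSq_op_smul hv, comp_op_smul hv.1, smul_add, smul_sub, smul_comm _ r]

theorem Q_smul {v : V} (hv : v ∈ T.domSq) {s q : ℍ[ℝ]} (hq : q * s = s * q) :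
    T.Q s (q • v) = q • T.Q s v := by
  have h2 : (2 * s) * q = q * (2 * s) := by
    rw [mul_assoc, ← hq, two_mul, two_mul, mul_add]
  have h3 : s ^ 2 * q = q * s ^ 2 := by rw [pow_two, mul_assoc, ← hq, ← mul_assoc, ← hq, mul_assoc]
  simp only [Q, absSq_smul hv, comp_smul hv.1, smul_add, smul_sub, smul_smul, h2, h3]

/-- Closed graph theorem: Q is closed on D, so its everywhere defined inverse has a closed graph. -/
theorem IsCore.exists_Qinv [CompleteSpace V] (h : T.IsCore D ω) {s : ℍ[ℝ]}
    (hs : s ∉ closure (sector ω)) : ∃ A : V →L[ℝ] V,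
    ⇑A = Function.invFunOn (T.Q s) (D : Set V) := by
  have hb := h.bijOn s hs
  have hD := h.admissible.subset_domSq
  set R := Function.invFunOn (T.Q s) (D : Set V)
  have hR : ∀ v, R v ∈ D ∧ T.Q s (R v) = v := fun v => by
    have := hb.surjOn (mem_univ v)
    exact ⟨Function.invFunOn_mem this, Function.invFunOn_eq this⟩
  have hsm : ∀ (r : ℝ) (v : V), v ∈ D → r • v ∈ D := fun r v hv => by
    rw [← op_real_smul_eq]; exact D.smul_mem _ hv
  let L : V →ₗ[ℝ] V :=
    { toFun := R
      map_add' := fun u v => hb.injOn (hR _).1 (D.add_mem (hR u).1 (hR v).1) (by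
        rw [(hR _).2, Q_add (hD (hR u).1) (hD (hR v).1), (hR u).2, (hR v).2])
      map_smul' := fun r v => hb.injOn (hR _).1 (hsm _ _ (hR v).1) (by
        rw [(hR _).2, RingHom.id_apply, ← op_real_smul_eq r (R v), Q_op_smul (hD (hR v).1),
          (hR v).2, op_real_smul_eq]) }
  have hc : Continuous L := by
    refine L.continuous_of_isClosed_graph ?_
    have := (h.admissible.isClosed_Q s).preimage (continuous_swap (X := V) (Y := V))
    convert this using 1
    ext ⟨v, u⟩
    simp only [SetLike.mem_coe, LinearMap.mem_graph_iff, mem_preimage, Prod.swap_prod_mk,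
      mem_ofPred_eq]
    constructor
    · rintro rfl
      exact ⟨(hR v).1, (hR v).2.symm⟩
    · rintro ⟨h1, h2⟩
      exact hb.injOn h1 (hR v).1 ((hR v).2.trans h2).symm
  exact ⟨⟨L, hc⟩, rfl⟩

theorem IsCore.Qinv_spec [CompleteSpace V] (h : T.IsCore D ω) {s : ℍ[ℝ]}
    (hs : s ∉ closure (sector ω)) :
    (∀ v, T.Qinv D s v ∈ D ∧ T.Q s (T.Qinv D s v) = v) ∧ ∀ u ∈ D, T.Qinv D s (T.Q s u) = u := by
  have hb := h.bijOn s hs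
  have hex := h.exists_Qinv hs
  have he : ⇑(T.Qinv D s) = Function.invFunOn (T.Q s) (D : Set V) := by
    rw [Qinv, toBounded, dif_pos hex]
    exact hex.choose_spec
  have h1 : ∀ v, T.Qinv D s v ∈ D ∧ T.Q s (T.Qinv D s v) = v := fun v => by
    have := hb.surjOn (mem_univ v)
    rw [he]
    exact ⟨Function.invFunOn_mem this, Function.invFunOn_eq this⟩
  exact ⟨h1, fun u hu => hb.injOn (h1 _).1 hu (h1 _).2⟩

variable [NormedSpace ℂ V] [RightComplex V]

theorem csmul_mem {W : Submodule ℍ[ℝ]ᵐᵒᵖ V} {v : V} (hv : v ∈ W) (z : ℂ) : z • v ∈ W := by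
  rw [RightComplex.smul_eq]; exact W.smul_mem _ hv

theorem comp_csmul {v : V} (hv : v ∈ T.dom) (i : Fin 4) (z : ℂ) :
    T.comp i (z • v) = z • T.comp i v := by
  rw [RightComplex.smul_eq, comp_op_smul hv, ← RightComplex.smul_eq]

theorem app_csmul {v : V} (hv : v ∈ T.dom) (z : ℂ) : T.app (z • v) = z • T.app v := by
  rw [RightComplex.smul_eq, app_op_smul hv, ← RightComplex.smul_eq]

theorem absSq_csmul {v : V} (hv : v ∈ T.domSq) (z : ℂ) : T.absSq (z • v) = z • T.absSq v := by
  rw [RightComplex.smul_eq, absSq_op_smul hv, ← RightComplex.smul_eq]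

/-- `z² - 2 z T₀ + |T|²` with a central complex number `z`. -/
def Qc (T : RightOp V) (z : ℂ) (v : V) : V := z ^ 2 • v - (2 * z) • T.comp 0 v + T.absSq v

theorem Qc_add {u v : V} (hu : u ∈ T.domSq) (hv : v ∈ T.domSq) (z : ℂ) :
    T.Qc z (u + v) = T.Qc z u + T.Qc z v := by
  simp only [Qc, absSq_add hu hv, comp_add hu.1 hv.1, smul_add]
  abel

theorem Qc_smul {v : V} (hv : v ∈ T.domSq) (z : ℂ) (q : ℍ[ℝ]) :
    T.Qc z (q • v) = q • T.Qc z v := by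
  simp only [Qc, absSq_smul hv, comp_smul hv.1, smul_add, smul_sub, smul_comm q]

theorem Qc_csmul {v : V} (hv : v ∈ T.domSq) (z c : ℂ) : T.Qc z (c • v) = c • T.Qc z v := by
  simp only [Qc, absSq_csmul hv, comp_csmul hv.1, smul_add, smul_sub, smul_comm c]

/-- As T₀ is linear for both actions, it maps an eigenvector of s with eigenvalue z to one of the
same kind. -/
theorem Q_eq_Qc {v : V} {s : ℍ[ℝ]} {z : ℂ} (hv : v ∈ T.domSq) (h : s • v = z • v) :
    T.Q s v = T.Qc z v := by
  have h2 : s • T.comp 0 v = z • T.comp 0 v := by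
    rw [← comp_smul hv.1, h, comp_csmul hv.1]
  have h3 : s ^ 2 • v = z ^ 2 • v := by
    rw [pow_two, pow_two, mul_smul, mul_smul, h, smul_comm s z v, h]
  rw [Q, Qc, h3, two_mul, two_mul, add_smul, add_smul, h2]

variable [NormSMulClass ℍ[ℝ] V]

theorem planePt_smul_projP {J : ℍ[ℝ]} (hJ : J ∈ imSphere) (z : ℂ) (v : V) :
    planePt J z • projP J v = z • projP J v :=
  congrArg (fun A : V →L[ℂ] V => A v) (leftC_planePt_mul_projP hJ z)

theorem planePt_conj_smul_projM {J : ℍ[ℝ]} (hJ : J ∈ imSphere) (z : ℂ) (v : V) :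
    planePt J (starRingEnd ℂ z) • projM J v = z • projM J v := by
  have := congrArg (fun A : V →L[ℂ] V => A v) (leftC_planePt_mul_projM hJ (starRingEnd ℂ z))
  simpa using this

theorem projP_apply (J : ℍ[ℝ]) (v : V) :
    projP J v = (2⁻¹ : ℂ) • (v - Complex.I • J • v) := rfl

theorem projM_apply (J : ℍ[ℝ]) (v : V) :
    projM J v = (2⁻¹ : ℂ) • (v + Complex.I • J • v) := rfl

theorem projP_add_projM_apply (J : ℍ[ℝ]) (v : V) : projP J v + projM J v = v :=
  congrArg (fun A : V →L[ℂ] V => A v) (projP_add_projM J)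

theorem IsCore.smul_mem (h : T.IsCore D ω) {v : V} (hv : v ∈ D) (q : ℍ[ℝ]) : q • v ∈ D :=
  h.admissible.smul_mem q v hv

theorem IsCore.projP_mem (h : T.IsCore D ω) {v : V} (hv : v ∈ D) (J : ℍ[ℝ]) :
    projP J v ∈ D := by
  rw [projP_apply]
  exact csmul_mem (sub_mem hv (csmul_mem (h.smul_mem hv J) _)) _

theorem IsCore.projM_mem (h : T.IsCore D ω) {v : V} (hv : v ∈ D) (J : ℍ[ℝ]) :
    projM J v ∈ D := by
  rw [projM_apply]
  exact csmul_mem (add_mem hv (csmul_mem (h.smul_mem hv J) _)) _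

theorem planePt_comm {J : ℍ[ℝ]} (z : ℂ) : J * planePt J z = planePt J z * J := by
  rw [planePt_eq, mul_add, add_mul, Quaternion.mul_coe_eq_smul, Quaternion.coe_mul_eq_smul,
    Quaternion.mul_coe_eq_smul, smul_mul_assoc, mul_smul_comm]

theorem IsCore.Qc_projP (h : T.IsCore D ω) {u : V} (hu : u ∈ D) (J : ℍ[ℝ]) (z : ℂ) :
    T.Qc z (projP J u) = projP J (T.Qc z u) := by
  have hD := h.admissible.subset_domSq
  have h1 := h.smul_mem hu J
  rw [projP_apply, projP_apply, Qc_csmul (hD (sub_mem hu (csmul_mem h1 _))), sub_eq_add_neg,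
    ← neg_smul, Qc_add (hD hu) (hD (csmul_mem h1 _)), Qc_csmul (hD h1), Qc_smul (hD hu),
    neg_smul, ← sub_eq_add_neg]

theorem IsCore.Qc_projM (h : T.IsCore D ω) {u : V} (hu : u ∈ D) (J : ℍ[ℝ]) (z : ℂ) :
    T.Qc z (projM J u) = projM J (T.Qc z u) := by
  have hD := h.admissible.subset_domSq
  have h1 := h.smul_mem hu J
  rw [projM_apply, projM_apply, Qc_csmul (hD (add_mem hu (csmul_mem h1 _))),
    Qc_add (hD hu) (hD (csmul_mem h1 _)), Qc_csmul (hD h1), Qc_smul (hD hu)]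

variable [CompleteSpace V]

/-- A two-sided inverse of `Q_z` exists as a complex linear operator. -/
theorem IsCore.exists_rho (h : T.IsCore D ω) (h0 : 0 ≤ ω) (hπ : ω ≤ Real.pi) {z : ℂ}
    (hz : z ∈ coSector ω) : ∃ A : V →L[ℂ] V,
      (∀ v, A v ∈ D ∧ T.Qc z (A v) = v) ∧ ∀ u ∈ D, A (T.Qc z u) = u := by
  have hD := h.admissible.subset_domSq
  have hJ := e₁_mem_imSphere
  set J := e₁
  -- The inverse at a point of ℂ_J is right linear, hence complex linear, and it commutes with J
  -- because J commutes with that point.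
  have key : ∀ w ∈ coSector ω, ∃ R : V →L[ℂ] V,
      (∀ v, R v ∈ D ∧ T.Q (planePt J w) (R v) = v ∧ J • R v = R (J • v)) ∧
      ∀ u ∈ D, R (T.Q (planePt J w) u) = u := by
    intro w hw
    obtain ⟨h1, h2⟩ := h.Qinv_spec (planePt_notMem_closure h0 hπ hJ hw)
    refine ⟨⟨⟨(T.Qinv D (planePt J w)).toLinearMap.toAddHom, fun c v => ?_⟩,
      (T.Qinv D (planePt J w)).cont⟩, fun v => ⟨(h1 v).1, (h1 v).2, ?_⟩, h2⟩
    · change T.Qinv D (planePt J w) (c • v) = c • T.Qinv D (planePt J w) v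
      rw [← h2 _ (csmul_mem (h1 v).1 c), RightComplex.smul_eq c (T.Qinv D _ v),
        Q_op_smul (hD (h1 v).1), (h1 v).2, RightComplex.smul_eq]
    · change J • T.Qinv D (planePt J w) v = T.Qinv D (planePt J w) (J • v)
      rw [← h2 _ (h.smul_mem (h1 v).1 J), Q_smul (hD (h1 v).1) (planePt_comm w), (h1 v).2]
  obtain ⟨R, hR, hR'⟩ := key z hz
  obtain ⟨S, hS, hS'⟩ := key _ (conj_mem_coSector hz)
  have cP : ∀ v, R (projP J v) = projP J (R v) := fun v => by
    rw [projP_apply, projP_apply, map_smul, map_sub, map_smul, (hR v).2.2]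
  have cM : ∀ v, S (projM J v) = projM J (S v) := fun v => by
    rw [projM_apply, projM_apply, map_smul, map_add, map_smul, (hS v).2.2]
  have qP : ∀ u ∈ D, T.Q (planePt J z) (projP J u) = T.Qc z (projP J u) := fun u hu =>
    Q_eq_Qc (hD (h.projP_mem hu J)) (planePt_smul_projP hJ z u)
  have qM : ∀ u ∈ D, T.Q (planePt J (starRingEnd ℂ z)) (projM J u) = T.Qc z (projM J u) :=
    fun u hu => Q_eq_Qc (hD (h.projM_mem hu J)) (planePt_conj_smul_projM hJ z u)
  -- Q_z agrees with the quaternionic Q at x + Jy on the range of P, and with that at x - Jy on the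
  -- range of M. All these operators commute with the projections, so the two inverses can be glued.
  refine ⟨R * projP J + S * projM J, fun v => ?_, fun u hu => ?_⟩
  · change R (projP J v) + S (projM J v) ∈ D ∧ T.Qc z (R (projP J v) + S (projM J v)) = v
    have m1 := (hR (projP J v)).1
    have m2 := (hS (projM J v)).1
    refine ⟨add_mem m1 m2, ?_⟩
    rw [Qc_add (hD m1) (hD m2), cP, cM, ← qP _ (hR v).1, ← qM _ (hS v).1, ← cP, ← cM,
      (hR _).2.1, (hS _).2.1, projP_add_projM_apply]
  · change R (projP J (T.Qc z u)) + S (projM J (T.Qc z u)) = u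
    rw [← h.Qc_projP hu, ← h.Qc_projM hu, ← qP _ hu, ← qM _ hu, hR' _ (h.projP_mem hu J),
      hS' _ (h.projM_mem hu J), projP_add_projM_apply]

open Classical in
/-- The inverse `ρ(z)` of `Q_z`, as a complex linear operator. -/
def rho (T : RightOp V) (D : Submodule ℍ[ℝ]ᵐᵒᵖ V) (z : ℂ) : V →L[ℂ] V :=
  if h : ∃ A : V →L[ℂ] V, (∀ v, A v ∈ D ∧ T.Qc z (A v) = v) ∧ ∀ u ∈ D, A (T.Qc z u) = u then
    h.choose else 0

/-- An operator with complete bookkeeping of the angle of the sector. -/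
structure IsCoreIn (T : RightOp V) (D : Submodule ℍ[ℝ]ᵐᵒᵖ V) (ω : ℝ) : Prop extends
    T.IsCore D ω where
  nonneg : 0 ≤ ω
  le_pi : ω ≤ Real.pi

theorem IsCoreIn.conj (h : T.IsCoreIn D ω) : T.conj.IsCoreIn D ω :=
  ⟨h.toIsCore.conj, h.nonneg, h.le_pi⟩

variable (h : T.IsCoreIn D ω) {z w : ℂ} (hz : z ∈ coSector ω) (hw : w ∈ coSector ω)

include h hz

theorem IsCoreIn.rho_spec : (∀ v, T.rho D z v ∈ D ∧ T.Qc z (T.rho D z v) = v) ∧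
    ∀ u ∈ D, T.rho D z (T.Qc z u) = u := by
  have hex := h.toIsCore.exists_rho h.nonneg h.le_pi hz
  rw [rho, dif_pos hex]
  exact hex.choose_spec

theorem IsCoreIn.rho_mem (v : V) : T.rho D z v ∈ D := ((h.rho_spec hz).1 v).1

theorem IsCoreIn.rho_mem_domSq (v : V) : T.rho D z v ∈ T.domSq :=
  h.admissible.subset_domSq (h.rho_mem hz v)

theorem IsCoreIn.rho_smul (q : ℍ[ℝ]) (v : V) : T.rho D z (q • v) = q • T.rho D z v := by
  obtain ⟨h1, h2⟩ := h.rho_spec hz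
  rw [← h2 _ (h.toIsCore.smul_mem (h1 v).1 q), Qc_smul (h.rho_mem_domSq hz v), (h1 v).2]

/-- This is where admissibility of D enters. For u = ρ(z)v the equation Q_z u = v shows that |T|²u
lies in dom T, so T_i u stays in D. Commutation at u and at T_j u then gives Q_z T_i u = T_i Q_z u =
T_i v. -/
theorem IsCoreIn.rho_comp {v : V} (hv : v ∈ T.dom) (i : Fin 4) :
    T.comp i (T.rho D z v) ∈ D ∧ T.rho D z (T.comp i v) = T.comp i (T.rho D z v) := by
  obtain ⟨h1, h2⟩ := h.rho_spec hz
  have hD := h.admissible.subset_domSq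
  set u := T.rho D z v with hu
  have hq : T.Qc z u = v := (h1 v).2
  have huD : u ∈ D := (h1 v).1
  have hus := hD huD
  have habs : T.absSq u = v - z ^ 2 • u + (2 * z) • T.comp 0 u := by
    rw [← hq, Qc]; abel
  have habsm : T.absSq u ∈ T.dom := by
    rw [habs]
    exact add_mem (sub_mem hv (csmul_mem hus.1 _)) (csmul_mem (hus.2 0) _)
  have hm := h.admissible.comp_mem u huD habsm
  refine ⟨hm i, ?_⟩
  rw [← h2 _ (hm i)]
  congr 1
  have hc := h.isKC.2
  have e1 : T.absSq (T.comp i u) = T.comp i (T.absSq u) := by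
    have : ∀ s : Finset (Fin 4), T.comp i (∑ j ∈ s, T.comp j (T.comp j u)) =
        ∑ j ∈ s, T.comp i (T.comp j (T.comp j u)) ∧ ∑ j ∈ s, T.comp j (T.comp j u) ∈ T.dom := by
      intro s
      classical
      induction s using Finset.induction_on with
      | empty =>
        have := comp_op_smul (T := T) (zero_mem _) i 0
        simpa using this
      | insert a s ha ih =>
        have ha' := (hD (hm a)).2 a
        rw [Finset.sum_insert ha, Finset.sum_insert ha, comp_add ha' ih.2, ih.1]
        exact ⟨rfl, add_mem ha' ih.2⟩
    rw [absSq, absSq, (this _).1]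
    refine Finset.sum_congr rfl fun j _ => ?_
    rw [hc u hus j i, hc _ (hD (hm j)) i j]
  rw [Qc, e1, hc u hus 0 i, ← comp_csmul (hus.2 0), ← comp_csmul hus.1, sub_eq_add_neg,
    show -T.comp i ((2 * z) • T.comp 0 u) = T.comp i (-(2 * z) • T.comp 0 u) by
      rw [comp_csmul (hus.2 0), comp_csmul (hus.2 0), neg_smul],
    ← comp_add (csmul_mem hus.1 _) (csmul_mem (hus.2 0) _),
    ← comp_add (add_mem (csmul_mem hus.1 _) (csmul_mem (hus.2 0) _)) habsm]
  congr 1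
  conv_lhs => rw [← hq, Qc]
  rw [neg_smul, sub_eq_add_neg]

theorem IsCoreIn.rho_app {v : V} (hv : v ∈ T.dom) :
    T.rho D z (T.app v) = T.app (T.rho D z v) := by
  rw [app_eq_sum hv, app_eq_sum (h.rho_mem_domSq hz v).1, map_sum]
  refine Finset.sum_congr rfl fun i _ => ?_
  rw [h.rho_smul hz, (h.rho_comp hz hv i).2]

omit h hz in
theorem Qc_conj {v : V} (hv : v ∈ T.domSq) (z : ℂ) : T.conj.Qc z v = T.Qc z v := by
  rw [Qc, Qc, conj_absSq hv, conj_comp_zero hv.1]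

theorem IsCoreIn.rho_conj : T.conj.rho D z = T.rho D z := by
  ext v
  obtain ⟨h1, h2⟩ := h.rho_spec hz
  obtain ⟨h3, h4⟩ := h.conj.rho_spec hz
  rw [← h2 _ (h3 v).1, ← Qc_conj (h.admissible.subset_domSq (h3 v).1), (h3 v).2]

omit z hz h in
theorem app_mem_of_domSq {v : V} (hv : v ∈ T.domSq) : T.app v ∈ T.dom := by
  rw [app_eq_sum hv.1]
  exact sum_mem fun i _ => smul_mem_dom (hv.2 i) _

omit z hz h in
theorem conj_app_mem_of_domSq {v : V} (hv : v ∈ T.domSq) : T.conj.app v ∈ T.dom :=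
  app_mem_of_domSq (T := T.conj) (by rwa [conj_domSq])

/-- T̄ is closed and ρ(z) is bounded with range in its domain, so T̄ρ(z) is bounded by the closed
graph theorem. -/
theorem IsCoreIn.exists_resol :
    ∃ A : V →L[ℂ] V, ∀ v, A v = z • T.rho D z v - T.conj.app (T.rho D z v) := by
  have hd : ∀ v, T.rho D z v ∈ T.conj.dom := fun v => (h.rho_mem_domSq hz v).1
  let L : V →ₗ[ℂ] V :=
    { toFun := fun v => T.conj.app (T.rho D z v)
      map_add' := fun u v => by rw [map_add, app_add (hd u) (hd v)]
      map_smul' := fun c v => by rw [map_smul, app_csmul (hd v), RingHom.id_apply] }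
  have hc : Continuous L := by
    refine L.continuous_of_isClosed_graph ?_
    have hcont : Continuous fun p : V × V => (T.rho D z p.1, p.2) :=
      ((T.rho D z).continuous.comp continuous_fst).prodMk continuous_snd
    convert (h.isKC_conj.1).preimage hcont using 1
    ext ⟨v, u⟩
    simp only [SetLike.mem_coe, LinearMap.mem_graph_iff, mem_preimage, LinearPMap.mem_graph_iff]
    change u = T.conj.app (T.rho D z v) ↔ _
    rw [app_of_mem (hd v)]
    constructor
    · rintro rfl; exact ⟨⟨_, hd v⟩, rfl, rfl⟩
    · rintro ⟨y, hy1, rfl⟩; congr 1; exact Subtype.ext hy1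
  exact ⟨z • T.rho D z - ⟨L, hc⟩, fun v => rfl⟩

omit z hz h in
open Classical in
/-- The resolvent `(z - T̄) ρ(z) = (z - T)⁻¹`, as a complex linear operator. -/
def resol (T : RightOp V) (D : Submodule ℍ[ℝ]ᵐᵒᵖ V) (z : ℂ) : V →L[ℂ] V :=
  if h : ∃ A : V →L[ℂ] V, ∀ v, A v = z • T.rho D z v - T.conj.app (T.rho D z v) then
    h.choose else 0

theorem IsCoreIn.resol_apply (v : V) :
    T.resol D z v = z • T.rho D z v - T.conj.app (T.rho D z v) := by
  have hex := h.exists_resol hz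
  rw [resol, dif_pos hex]
  exact hex.choose_spec v

theorem IsCoreIn.conj_resol_apply (v : V) :
    T.conj.resol D z v = z • T.rho D z v - T.app (T.rho D z v) := by
  rw [h.conj.resol_apply hz, h.rho_conj hz, conj_conj]

theorem IsCoreIn.resol_mem (v : V) : T.resol D z v ∈ T.dom := by
  rw [h.resol_apply hz]
  exact sub_mem (csmul_mem (h.rho_mem_domSq hz v).1 _)
    (conj_app_mem_of_domSq (h.rho_mem_domSq hz v))

omit z hz h in
theorem app_sub {u v : V} (hu : u ∈ T.dom) (hv : v ∈ T.dom) :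
    T.app (u - v) = T.app u - T.app v := by
  have h1 : T.app (-v) = -T.app v := by
    have := app_csmul hv (-1)
    simpa using this
  rw [sub_eq_add_neg, app_add hu (neg_mem hv), h1, ← sub_eq_add_neg]

omit z hz h in
theorem app_add_conj_app {v : V} (hv : v ∈ T.dom) :
    T.app v + T.conj.app v = (2 : ℂ) • T.comp 0 v := by
  rw [app_eq hv, conj_app hv, two_smul]
  simp only [e_zero, one_smul]
  abel

omit hz in
-- The factorization Q_z = (z - T)(z - T̄), from T + T̄ = 2T₀ and T T̄ = |T|².
theorem IsCoreIn.Qc_eq {v : V} (hv : v ∈ T.domSq) (z : ℂ) :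
    T.Qc z v = z • (z • v - T.conj.app v) - T.app (z • v - T.conj.app v) := by
  rw [app_sub (csmul_mem hv.1 z) (conj_app_mem_of_domSq hv), app_csmul hv.1,
    app_conj_app hv (h.isKC.2 v hv), Qc, mul_comm, mul_smul, ← app_add_conj_app hv.1, smul_sub,
    smul_smul, pow_two, smul_add]
  abel

/-- `(z - T) (z - T)⁻¹ = 1`. -/
theorem IsCoreIn.sub_app_resol (v : V) :
    z • T.resol D z v - T.app (T.resol D z v) = v := by
  rw [h.resol_apply hz, ← h.Qc_eq (h.rho_mem_domSq hz v), ((h.rho_spec hz).1 v).2]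

/-- `(z - T)⁻¹ (z - T) = 1`. -/
theorem IsCoreIn.resol_sub_app {u : V} (hu : u ∈ T.dom) :
    T.resol D z (z • u - T.app u) = u := by
  have hs := h.rho_mem_domSq hz u
  -- The left inverse needs the factors in the opposite order, which is the same factorization for
  -- T̄, together with the commutation of ρ(z) and T.
  have hcQ := h.conj.Qc_eq (v := T.rho D z u) (by rwa [conj_domSq]) z
  rw [conj_conj, Qc_conj hs, ((h.rho_spec hz).1 u).2] at hcQ
  rw [h.resol_apply hz, map_sub, map_smul, h.rho_app hz hu]
  exact hcQ.symm

include hw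

theorem IsCoreIn.resol_sub_resol :
    T.resol D z - T.resol D w = (w - z) • (T.resol D z * T.resol D w) := by
  ext v
  have h1 := h.sub_app_resol hw v
  have h2 := h.resol_sub_app hz (h.resol_mem hw v)
  change T.resol D z v - T.resol D w v = (w - z) • T.resol D z (T.resol D w v)
  have h3 : z • T.resol D w v - T.app (T.resol D w v) = v + (z - w) • T.resol D w v := by
    nth_rw 3 [← h1]
    rw [sub_smul]; abel
  rw [h3, map_add, map_smul] at h2
  rw [eq_sub_of_add_eq h2, ← neg_sub w z, neg_smul]; abel

theorem IsCoreIn.resol_comm : T.resol D z * T.resol D w = T.resol D w * T.resol D z := by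
  by_cases hzw : z = w
  · rw [hzw]
  have h1 := h.resol_sub_resol hz hw
  have h2 := h.resol_sub_resol hw hz
  rw [← neg_sub, h2, ← neg_smul, neg_sub] at h1
  exact (smul_right_injective _ (sub_ne_zero.2 (Ne.symm hzw)) h1).symm

/-- R̄(w) = (w - T)ρ(w) commutes with T on dom T, and therefore with (z - T)⁻¹. -/
theorem IsCoreIn.resol_conj_comm :
    T.resol D z * T.conj.resol D w = T.conj.resol D w * T.resol D z := by
  ext v
  change T.resol D z (T.conj.resol D w v) = T.conj.resol D w (T.resol D z v)
  set u := T.resol D z v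
  have hu : u ∈ T.dom := h.resol_mem hz v
  have huv : z • u - T.app u = v := h.sub_app_resol hz v
  have hm : T.conj.resol D w u ∈ T.dom := h.conj.resol_mem hw u
  have hs := h.rho_mem_domSq hw u
  have hT : T.conj.resol D w (T.app u) = T.app (T.conj.resol D w u) := by
    rw [h.conj_resol_apply hw, h.conj_resol_apply hw, h.rho_app hw hu,
      app_sub (csmul_mem hs.1 _) (app_mem_of_domSq hs), app_csmul hs.1]
  rw [← h.resol_sub_app hz hm, ← hT, ← map_smul, ← map_sub, huv]

omit hw w in
-- R̄(z) = (z - T)ρ(z), and R(z) cancels z - T. Through this every kernel becomes a polynomial in R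
-- and R̄.
theorem IsCoreIn.resol_mul_conj_resol : T.resol D z * T.conj.resol D z = T.rho D z := by
  ext v
  change T.resol D z (T.conj.resol D z v) = T.rho D z v
  rw [h.conj_resol_apply hz, h.resol_sub_app hz (h.rho_mem_domSq hz v).1]

end RightOp

end Resolvents

/-! ### Quaternionic kernels as slices of complex ones. -/

section Kernels

variable {V : Type*} [NormedAddCommGroup V] [NormedSpace ℝ V]
  [Module ℍ[ℝ] V] [Module ℍ[ℝ]ᵐᵒᵖ V] [SMulCommClass ℍ[ℝ] ℍ[ℝ]ᵐᵒᵖ V]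
  [IsScalarTower ℝ ℍ[ℝ] V] [IsScalarTower ℝ ℍ[ℝ]ᵐᵒᵖ V] [NormSMulClass ℍ[ℝ] V]
  [NormedSpace ℂ V] [RightComplex V] [CompleteSpace V]

open RightOp

variable {T : RightOp V} {D : Submodule ℍ[ℝ]ᵐᵒᵖ V} {ω : ℝ}

theorem toBounded_eq {F : V → V} (A : V →L[ℝ] V) (h : ⇑A = F) : toBounded F = A := by
  have hex : ∃ A : V →L[ℝ] V, ⇑A = F := ⟨A, h⟩
  rw [toBounded, dif_pos hex]
  exact DFunLike.coe_injective (hex.choose_spec.trans h.symm)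

/-- A complex linear operator as a real linear one. -/
def toReal (A : V →L[ℂ] V) : V →L[ℝ] V := A.restrictScalars ℝ

@[simp] theorem toReal_apply (A : V →L[ℂ] V) (v : V) : toReal A v = A v := rfl

theorem toReal_mul (A B : V →L[ℂ] V) : toReal (A * B) = toReal A * toReal B := rfl

theorem toReal_add (A B : V →L[ℂ] V) : toReal (A + B) = toReal A + toReal B := rfl

theorem toReal_sub (A B : V →L[ℂ] V) : toReal (A - B) = toReal A - toReal B := rfl

theorem toReal_real_smul (r : ℝ) (A : V →L[ℂ] V) : toReal ((r : ℂ) • A) = r • toReal A := by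
  ext v; exact real_complex_smul r _

theorem norm_toReal (A : V →L[ℂ] V) : ‖toReal A‖ = ‖A‖ := A.norm_restrictScalars

theorem toReal_leftC (q : ℍ[ℝ]) :
    toReal (leftC q : V →L[ℂ] V) = ContinuousLinearMap.lsmul ℝ ℍ[ℝ] q := rfl

/-- The quaternionic kernel at `x + J y` made from a complex kernel. -/
def slice (J : ℍ[ℝ]) (K : ℂ → V →L[ℂ] V) (z : ℂ) : V →L[ℂ] V :=
  K z * projP J + K (starRingEnd ℂ z) * projM J

theorem slice_apply (J : ℍ[ℝ]) (K : ℂ → V →L[ℂ] V) (z : ℂ) (v : V) :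
    slice J K z v = K z (projP J v) + K (starRingEnd ℂ z) (projM J v) := rfl

variable {J : ℍ[ℝ]}

/-- If the right factor commutes with J, it commutes with both projections and the cross terms
vanish; nothing is required of the left factor. This suits `P2L` and `FL`, whose left factor R does
not commute with J in general. -/
theorem slice_mul (hJ : J ∈ imSphere) {K L : ℂ → V →L[ℂ] V} {z : ℂ}
    (h : L z * leftC J = leftC J * L z)
    (h' : L (starRingEnd ℂ z) * leftC J = leftC J * L (starRingEnd ℂ z)) :
    slice J K z * slice J L z = slice J (fun z => K z * L z) z := by
  simp only [slice, add_mul, mul_add]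
  have e1 : K z * projP J * (L z * projP J) = K z * L z * projP J := by
    rw [projP_mul_comm h, mul_assoc, ← mul_assoc (projP J), projP_mul_projP hJ,
      ← projP_mul_comm h, mul_assoc]
  have e2 : K z * projP J * (L (starRingEnd ℂ z) * projM J) = 0 := by
    rw [projM_mul_comm h', mul_assoc, ← mul_assoc (projP J), projP_mul_projM hJ, zero_mul, mul_zero]
  have e3 : K (starRingEnd ℂ z) * projM J * (L z * projP J) = 0 := by
    rw [projP_mul_comm h, mul_assoc, ← mul_assoc (projM J), projM_mul_projP hJ, zero_mul, mul_zero]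
  have e4 : K (starRingEnd ℂ z) * projM J * (L (starRingEnd ℂ z) * projM J) =
      K (starRingEnd ℂ z) * L (starRingEnd ℂ z) * projM J := by
    rw [projM_mul_comm h', mul_assoc, ← mul_assoc (projM J), projM_mul_projM hJ,
      ← projM_mul_comm h', mul_assoc]
  rw [e1, e2, e3, e4, add_zero, zero_add]

theorem slice_conj_apply_projM (hJ : J ∈ imSphere) (K : ℂ → V →L[ℂ] V) (z : ℂ) :
    slice J K (starRingEnd ℂ z) * projM J = K z * projM J := by
  rw [slice, add_mul, mul_assoc, projP_mul_projM hJ, mul_zero, zero_add, mul_assoc,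
    projM_mul_projM hJ, Complex.conj_conj]

theorem slice_mul_projP (hJ : J ∈ imSphere) (K : ℂ → V →L[ℂ] V) (z : ℂ) :
    slice J K z * projP J = K z * projP J := by
  rw [slice, add_mul, mul_assoc, projP_mul_projP hJ, mul_assoc, projM_mul_projP hJ, mul_zero,
    add_zero]

/-- The complex kernel is recovered from the quaternionic one at x + Jy and x - Jy, by restricting
to the ranges of P and M. This carries resolvent estimates over to the complex side. -/
theorem norm_le_slice (hJ : J ∈ imSphere) (K : ℂ → V →L[ℂ] V) (z : ℂ) :
    ‖K z‖ ≤ ‖slice J K z‖ + ‖slice J K (starRingEnd ℂ z)‖ := by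
  have h1 : K z = slice J K z * projP J + slice J K (starRingEnd ℂ z) * projM J := by
    rw [slice_mul_projP hJ, slice_conj_apply_projM hJ, ← mul_add, projP_add_projM, mul_one]
  calc ‖K z‖ = ‖slice J K z * projP J + slice J K (starRingEnd ℂ z) * projM J‖ :=
        congrArg _ h1
    _ ≤ ‖slice J K z‖ * 1 + ‖slice J K (starRingEnd ℂ z)‖ * 1 := by
        refine (norm_add_le _ _).trans (add_le_add ?_ ?_)
        · exact (norm_mul_le _ _).trans
            (mul_le_mul_of_nonneg_left (norm_projP_le hJ) (norm_nonneg _))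
        · exact (norm_mul_le _ _).trans
            (mul_le_mul_of_nonneg_left (norm_projM_le hJ) (norm_nonneg _))
    _ = _ := by rw [mul_one, mul_one]

/-- The kernels of the calculi with a central complex variable. -/
def Calculus.kernelC (k : Calculus) (T : RightOp V) (D : Submodule ℍ[ℝ]ᵐᵒᵖ V) (z : ℂ) :
    V →L[ℂ] V :=
  match k with
  | .S => T.resol D z
  | .Q => (-2 : ℂ) • T.rho D z
  | .P2 => (2 : ℂ) • (T.resol D z * (T.resol D z + T.conj.resol D z))
  | .F => (-4 : ℂ) • (T.resol D z * T.rho D z)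

namespace RightOp

variable (h : T.IsCoreIn D ω) {z : ℂ} (hz : z ∈ coSector ω) (hJ : J ∈ imSphere)

include h hz in
theorem IsCoreIn.rho_mul_leftC (q : ℍ[ℝ]) : T.rho D z * leftC q = leftC q * T.rho D z := by
  ext v; exact h.rho_smul hz q v

include h hz in
-- In R + R̄ = 2(z - T₀)ρ(z) the imaginary components have cancelled, and the components and ρ(z)
-- are left linear.
theorem IsCoreIn.resol_add_mul_leftC (q : ℍ[ℝ]) :
    (T.resol D z + T.conj.resol D z) * leftC q = leftC q * (T.resol D z + T.conj.resol D z) := by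
  have key : ∀ v, T.resol D z v + T.conj.resol D z v =
      (2 : ℂ) • (z • T.rho D z v - T.comp 0 (T.rho D z v)) := by
    intro v
    rw [h.resol_apply hz, h.conj_resol_apply hz, smul_sub,
      ← app_add_conj_app (h.rho_mem_domSq hz v).1, two_smul]
    abel
  ext v
  change T.resol D z (q • v) + T.conj.resol D z (q • v) =
    q • (T.resol D z v + T.conj.resol D z v)
  rw [key, key, h.rho_smul hz, comp_smul (h.rho_mem_domSq hz v).1, smul_comm q (2 : ℂ), smul_sub q,
    smul_comm q z]

include h hz hJ

theorem IsCoreIn.Qinv_planePt : T.Qinv D (planePt J z) = toReal (slice J (T.rho D) z) := by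
  have hz' := conj_mem_coSector hz
  obtain ⟨h1, h2⟩ := h.Qinv_spec (planePt_notMem_closure h.nonneg h.le_pi hJ hz)
  have hD := h.admissible.subset_domSq
  ext v
  rw [toReal_apply, slice_apply]
  set u₁ := T.rho D z (projP J v) with hu₁
  set u₂ := T.rho D (starRingEnd ℂ z) (projM J v) with hu₂
  have m₁ : u₁ ∈ D := h.rho_mem hz _
  have m₂ : u₂ ∈ D := h.rho_mem hz' _
  have s₁ : planePt J z • u₁ = z • u₁ := by
    rw [hu₁, ← h.rho_smul hz, planePt_smul_projP hJ, map_smul]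
  have s₂ : planePt J z • u₂ = starRingEnd ℂ z • u₂ := by
    have := planePt_conj_smul_projM hJ (starRingEnd ℂ z) v
    rw [Complex.conj_conj] at this
    rw [hu₂, ← h.rho_smul hz', this, map_smul]
  have : T.Q (planePt J z) (u₁ + u₂) = v := by
    rw [Q_add (hD m₁) (hD m₂), Q_eq_Qc (hD m₁) s₁, Q_eq_Qc (hD m₂) s₂,
      ((h.rho_spec hz).1 _).2, ((h.rho_spec hz').1 _).2, projP_add_projM_apply]
  rw [← h2 _ (add_mem m₁ m₂), this]

theorem IsCoreIn.SL_planePt : T.SL D (planePt J z) = toReal (slice J (T.resol D) z) := by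
  have hz' := conj_mem_coSector hz
  refine toBounded_eq _ (funext fun v => ?_)
  rw [h.Qinv_planePt hz hJ]
  simp only [toReal_apply, slice_apply]
  rw [h.resol_apply hz, h.resol_apply hz', app_add (T := T.conj) (h.rho_mem_domSq hz _).1
    (h.rho_mem_domSq hz' _).1, smul_add]
  have s₁ : planePt J z • T.rho D z (projP J v) = z • T.rho D z (projP J v) := by
    rw [← h.rho_smul hz, planePt_smul_projP hJ, map_smul]
  have s₂ : planePt J z • T.rho D (starRingEnd ℂ z) (projM J v) =
      starRingEnd ℂ z • T.rho D (starRingEnd ℂ z) (projM J v) := by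
    have := planePt_conj_smul_projM hJ (starRingEnd ℂ z) v
    rw [Complex.conj_conj] at this
    rw [← h.rho_smul hz', this, map_smul]
  rw [s₁, s₂]
  abel

/-- The quaternionic kernels on the plane `ℂ_J` in terms of the complex ones. -/
theorem IsCoreIn.kernel_planePt (k : Calculus) :
    k.kernel T D (planePt J z) = toReal (slice J (k.kernelC T D) z) := by
  have hz' := conj_mem_coSector hz
  have hreal : ∀ (r : ℝ) (c : ℂ) (K : ℂ → V →L[ℂ] V), (r : ℂ) = c →
      r • toReal (slice J K z) = toReal (slice J (fun z => c • K z) z) := by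
    rintro r c K rfl
    rw [← toReal_real_smul]
    simp only [slice, smul_add, smul_mul_assoc]
  cases k with
  | S => exact h.SL_planePt hz hJ
  | Q =>
    simp only [Calculus.kernel]
    rw [h.Qinv_planePt hz hJ, hreal _ (-2) _ (by push_cast; rfl)]
    rfl
  | P2 =>
    simp only [Calculus.kernel, P2L]
    have e1 : toReal (slice J (T.resol D) z) + toReal (slice J (T.conj.resol D) z) =
        toReal (slice J (fun z => T.resol D z + T.conj.resol D z) z) := by
      rw [← toReal_add]
      simp only [slice, add_mul]
      congr 1; abel
    rw [h.SL_planePt hz hJ, h.conj.SL_planePt hz hJ, e1, ← toReal_mul,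
      slice_mul hJ (h.resol_add_mul_leftC hz J) (h.resol_add_mul_leftC hz' J),
      hreal _ 2 _ (by push_cast; rfl)]
    rfl
  | F =>
    simp only [Calculus.kernel, FL]
    rw [h.SL_planePt hz hJ, h.Qinv_planePt hz hJ, ← toReal_mul,
      slice_mul hJ (h.rho_mul_leftC hz J) (h.rho_mul_leftC hz' J),
      hreal _ (-4) _ (by push_cast; rfl)]
    rfl

omit h hz hJ in
theorem sum_e_mul_conjSign (k : Fin 4) :
    ∑ j, e j * ((conjSign k : ℍ[ℝ]) * e k) * e j = ((-2 : ℝ) : ℍ[ℝ]) * e k := by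
  simp only [Fin.sum_univ_four, Quaternion.coe_mul_eq_smul]
  fin_cases k <;> ext <;> simp [conjSign] <;> norm_num

omit hJ

/-- Averaging exchanges T and T̄: ∑ e_j q̄ e_j = -2q for every quaternion q, hence R̄ = -½ ∑ e_j R
e_j. The four terms give the factor 2, and the growth condition imposed on T alone passes to T̄. -/
theorem IsCoreIn.norm_conj_resol_le : ‖T.conj.resol D z‖ ≤ 2 * ‖T.resol D z‖ := by
  have key : ∀ v, (2 : ℂ) • T.conj.resol D z v = -∑ j, e j • T.resol D z (e j • v) +
      0 := by
    intro v
    set u := T.rho D z v with hu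
    have hus := h.rho_mem_domSq hz v
    have h1 : ∀ j, e j • T.resol D z (e j • v) = z • (e j * e j) • u - e j • T.conj.app (e j • u) := by
      intro j
      rw [h.resol_apply hz, h.rho_smul hz, smul_sub, smul_comm (e j) z, smul_smul]
    have h2 : ∑ j, e j • T.conj.app (e j • u) = -(2 : ℂ) • T.app u := by
      have h3 : ∀ j, e j • T.conj.app (e j • u) =
          ∑ k, (e j * ((conjSign k : ℍ[ℝ]) * e k) * e j) • T.comp k u := by
        intro j
        have hm : e j • u ∈ T.conj.dom := smul_mem_dom (T := T) hus.1 _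
        rw [app_eq_sum hm, Finset.smul_sum]
        refine Finset.sum_congr rfl fun k _ => ?_
        rw [conj_comp (T := T) hm, comp_smul hus.1, ← real_smul_eq, smul_smul, smul_smul, smul_smul]
        congr 1
        simp only [Quaternion.coe_mul_eq_smul, mul_smul_comm, smul_mul_assoc, mul_assoc,
          Quaternion.mul_coe_eq_smul]
      simp_rw [h3]
      rw [Finset.sum_comm]
      simp_rw [← Finset.sum_smul, sum_e_mul_conjSign, mul_smul]
      rw [← Finset.smul_sum, ← app_eq_sum hus.1]
      rw [real_smul_eq, ← real_complex_smul]
      push_cast; rfl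
    have h4 : ∑ j, (e j * e j) • u = -(2 : ℂ) • u := by
      rw [← Finset.sum_smul]
      have h5 : ∑ j, e j * e j = ((-2 : ℝ) : ℍ[ℝ]) := by
        rw [Fin.sum_univ_four]; ext <;> simp <;> norm_num
      rw [h5, real_smul_eq, ← real_complex_smul]
      push_cast; rfl
    simp_rw [h1]
    rw [Finset.sum_sub_distrib, ← Finset.smul_sum, h2, h4, h.conj_resol_apply hz]
    rw [add_zero, smul_sub, smul_comm z]
    simp only [neg_smul]
    abel
  have bound : ∀ v, ‖T.conj.resol D z v‖ ≤ 2 * ‖T.resol D z‖ * ‖v‖ := by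
    intro v
    have h1 : ‖(2 : ℂ) • T.conj.resol D z v‖ ≤ ∑ _j : Fin 4, ‖T.resol D z‖ * ‖v‖ := by
      rw [key, add_zero, norm_neg]
      refine (norm_sum_le _ _).trans (Finset.sum_le_sum fun j _ => ?_)
      have hj : ‖e j‖ = 1 := by
        have hh := Quaternion.normSq_eq_norm_mul_self (e j)
        have : Quaternion.normSq (e j) = 1 := by
          rw [Quaternion.normSq_def']
          fin_cases j <;> simp
        rw [this] at hh
        nlinarith [norm_nonneg (e j)]
      rw [norm_smul, hj, one_mul]
      refine ((T.resol D z).le_opNorm _).trans (le_of_eq ?_)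
      rw [norm_smul, hj, one_mul]
    rw [norm_smul] at h1
    norm_num at h1
    linarith
  exact ContinuousLinearMap.opNorm_le_bound _ (by positivity) bound

/-- The resolvent is holomorphic. -/
theorem IsCoreIn.differentiableAt_resol : DifferentiableAt ℂ (T.resol D) z := by
  set A := T.resol D z
  have hd : DifferentiableAt ℂ (fun w : ℂ => 1 + (w - z) • A) z := by fun_prop
  have h1 : (1 : V →L[ℂ] V) + (z - z) • A = 1 := by rw [sub_self, zero_smul, add_zero]
  -- By the resolvent equation R(w) = R(z)(1 + (w - z)R(z))⁻¹ for w near z.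
  have hinv : DifferentiableAt ℂ (fun w : ℂ => A * Ring.inverse (1 + (w - z) • A)) z := by
    refine DifferentiableAt.const_mul ?_ A
    refine DifferentiableAt.comp z (g := Ring.inverse) (f := fun w : ℂ => 1 + (w - z) • A) ?_ hd
    rw [h1]
    exact differentiableAt_inverse isUnit_one
  refine hinv.congr_of_eventuallyEq ?_
  have hu : ∀ᶠ w in nhds z, IsUnit ((1 : V →L[ℂ] V) + (w - z) • A) := by
    refine hd.continuousAt.eventually_mem (Units.isOpen.mem_nhds ?_)
    rw [h1]; exact isUnit_one
  filter_upwards [hu, (isOpen_coSector ω).mem_nhds hz] with w hw hwm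
  have hr := h.resol_sub_resol hwm hz
  have : T.resol D w * (1 + (w - z) • A) = A := by
    rw [mul_add, mul_one, mul_smul_comm, ← neg_sub z w, neg_smul, ← hr]; abel
  obtain ⟨U, hU⟩ := hw
  rw [← hU] at this ⊢
  rw [Ring.inverse_unit, ← this, mul_assoc, Units.mul_inv, mul_one]

theorem IsCoreIn.differentiableAt_rho : DifferentiableAt ℂ (T.rho D) z := by
  refine ((h.differentiableAt_resol hz).mul (h.conj.differentiableAt_resol hz)).congr_of_eventuallyEq ?_
  filter_upwards [(isOpen_coSector ω).mem_nhds hz] with w hw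
  exact (h.resol_mul_conj_resol hw).symm

theorem IsCoreIn.differentiableAt_kernelC (k : Calculus) :
    DifferentiableAt ℂ (k.kernelC T D) z := by
  have h1 := h.differentiableAt_resol hz
  have h2 := h.conj.differentiableAt_resol hz
  have h3 := h.differentiableAt_rho hz
  cases k with
  | S => exact h1
  | Q => exact h3.const_smul (-2 : ℂ)
  | P2 => exact (h1.mul (h1.add h2)).const_smul (2 : ℂ)
  | F => exact (h1.mul h3).const_smul (-4 : ℂ)

end RightOp

end Kernels

/-! ### Sectors in the logarithmic coordinate, and holomorphy from Cauchy–Riemann. -/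

section LogCoordinate

theorem exp_mem_coSector {ω : ℝ} (h0 : 0 ≤ ω) {η : ℂ} (h : ω < |η.im|) (hπ : |η.im| ≤ Real.pi) :
    Complex.exp η ∈ coSector ω := by
  have h1 := Real.cos_lt_cos_of_nonneg_of_le_pi h0 hπ h
  rw [Real.cos_abs] at h1
  change (Complex.exp η).re < ‖Complex.exp η‖ * _
  rw [Complex.exp_re, Complex.norm_exp]
  exact mul_lt_mul_of_pos_left h1 (Real.exp_pos _)

theorem planePt_exp_notMem_sector {φ : ℝ} (h0 : 0 ≤ φ) {η : ℂ} (h : φ ≤ |η.im|)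
    (hπ : |η.im| ≤ Real.pi) {J : ℍ[ℝ]} (hJ : J ∈ imSphere) :
    planePt J (Complex.exp η) ∉ sector φ := by
  rw [mem_sector_iff h0 (h.trans hπ), norm_planePt hJ, planePt_re hJ, Complex.exp_re,
    Complex.norm_exp, not_lt]
  have h1 := Real.cos_le_cos_of_nonneg_of_le_pi h0 hπ h
  rw [Real.cos_abs] at h1
  exact mul_le_mul_of_nonneg_left h1 (Real.exp_pos _).le

theorem planePt_exp_mem_sector {θ : ℝ} (hπ : θ ≤ Real.pi) {η : ℂ} (h : |η.im| < θ)
    {J : ℍ[ℝ]} (hJ : J ∈ imSphere) : planePt J (Complex.exp η) ∈ sector θ := by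
  rw [mem_sector_iff ((abs_nonneg _).trans h.le) hπ, norm_planePt hJ, planePt_re hJ,
    Complex.exp_re, Complex.norm_exp]
  have h1 := Real.cos_lt_cos_of_nonneg_of_le_pi (abs_nonneg _) hπ h
  rw [Real.cos_abs] at h1
  exact mul_lt_mul_of_pos_left h1 (Real.exp_pos _)

theorem mem_reduced_sector_iff {θ : ℝ} (h0 : 0 ≤ θ) (hπ : θ ≤ Real.pi) {p : ℝ × ℝ} :
    p ∈ reduced (sector θ) ↔ ‖(⟨p.1, p.2⟩ : ℂ)‖ * Real.cos θ < p.1 := by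
  have key : ∀ J ∈ imSphere, (slicePt J p ∈ sector θ ↔
      ‖(⟨p.1, p.2⟩ : ℂ)‖ * Real.cos θ < p.1) := by
    intro J hJ
    have := mem_sector_iff h0 hπ (s := planePt J ⟨p.1, p.2⟩)
    rwa [norm_planePt hJ, planePt_re hJ] at this
  exact ⟨fun h => (key _ e₁_mem_imSphere).1 (h _ e₁_mem_imSphere),
    fun h J hJ => (key J hJ).2 h⟩

theorem isOpen_reduced_sector {θ : ℝ} (h0 : 0 ≤ θ) (hπ : θ ≤ Real.pi) :
    IsOpen (reduced (sector θ)) := by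
  have : reduced (sector θ) =
      {p : ℝ × ℝ | ‖Complex.equivRealProdCLM.symm p‖ * Real.cos θ < p.1} := by
    ext p
    rw [mem_reduced_sector_iff h0 hπ]
    rfl
  rw [this]
  exact isOpen_lt (by fun_prop) continuous_fst

theorem re_im_exp_mem_reduced {θ : ℝ} (hπ : θ ≤ Real.pi) {η : ℂ} (h : |η.im| < θ) :
    ((Complex.exp η).re, (Complex.exp η).im) ∈ reduced (sector θ) :=
  fun _ hJ => planePt_exp_mem_sector hπ h hJ

/-- The target is left open to serve two purposes: `leftC` produces the operator valued symbol of f,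
and the real part the scalar symbol of g. A continuous additive map is real linear, so the
Cauchy–Riemann equations survive. -/
theorem differentiableAt_of_cauchyRiemann {E : Type*} [NormedAddCommGroup E] [NormedSpace ℂ E]
    (ℓ : ℍ[ℝ] →+ E) (hℓ : Continuous ℓ) {a b : ℝ × ℝ → ℍ[ℝ]} {z : ℂ}
    (ha : DifferentiableAt ℝ a (z.re, z.im)) (hb : DifferentiableAt ℝ b (z.re, z.im))
    (h1 : fderiv ℝ a (z.re, z.im) (1, 0) = fderiv ℝ b (z.re, z.im) (0, 1))
    (h2 : fderiv ℝ a (z.re, z.im) (0, 1) = -fderiv ℝ b (z.re, z.im) (1, 0)) :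
    DifferentiableAt ℂ (fun w : ℂ => ℓ (a (w.re, w.im)) + Complex.I • ℓ (b (w.re, w.im))) z := by
  set L := ℓ.toRealLinearMap hℓ with hL
  set P : ℂ →L[ℝ] ℝ × ℝ := Complex.equivRealProdCLM.toContinuousLinearMap
  have hA : HasFDerivAt (fun w : ℂ => L (a (P w))) (L ∘L (fderiv ℝ a (z.re, z.im)) ∘L P) z :=
    L.hasFDerivAt.comp z (HasFDerivAt.comp z (g := a) ha.hasFDerivAt P.hasFDerivAt)
  have hB : HasFDerivAt (fun w : ℂ => L (b (P w))) (L ∘L (fderiv ℝ b (z.re, z.im)) ∘L P) z :=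
    L.hasFDerivAt.comp z (HasFDerivAt.comp z (g := b) hb.hasFDerivAt P.hasFDerivAt)
  have hH := hA.add (hB.const_smul Complex.I)
  refine differentiableAt_complex_iff_differentiableAt_real.2 ⟨hH.differentiableAt, ?_⟩
  have e := hH.fderiv
  have e' : fderiv ℝ (fun w : ℂ => ℓ (a (w.re, w.im)) + Complex.I • ℓ (b (w.re, w.im))) z = _ := e
  rw [e']
  have pI : P Complex.I = (0, 1) := by simp [P]
  have p1 : P 1 = (1, 0) := by simp [P]
  simp only [add_apply, smul_apply,
    ContinuousLinearMap.comp_apply, pI, p1, h1, h2, map_neg, smul_add, smul_smul,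
    Complex.I_mul_I, neg_smul, one_smul]
  abel

end LogCoordinate

/-! ### Holomorphic symbols of slice hyperholomorphic and intrinsic functions. -/

section Symbols

variable {V : Type*} [NormedAddCommGroup V] [NormedSpace ℝ V]
  [Module ℍ[ℝ] V] [Module ℍ[ℝ]ᵐᵒᵖ V] [SMulCommClass ℍ[ℝ] ℍ[ℝ]ᵐᵒᵖ V]
  [IsScalarTower ℝ ℍ[ℝ] V] [IsScalarTower ℝ ℍ[ℝ]ᵐᵒᵖ V] [NormSMulClass ℍ[ℝ] V]
  [NormedSpace ℂ V] [RightComplex V]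

/-- `F` is the holomorphic operator valued function, in the coordinate `η = log z`, from which the
left multiplications by the values of `f` on the sector are built. -/
structure IsSymbol (θ : ℝ) (f : ℍ[ℝ] → ℍ[ℝ]) (F : ℂ → V →L[ℂ] V) : Prop where
  differentiableAt : ∀ η : ℂ, |η.im| < θ → DifferentiableAt ℂ F η
  decomp : ∀ η : ℂ, |η.im| < θ → ∀ J ∈ imSphere,
    leftC (f (planePt J (Complex.exp η))) = projP J * F η + projM J * F (starRingEnd ℂ η)

/-- The symbol is a + ib, read as left multiplications. Since J = i(P - M), the operator a + Jb
splits into P(a + ib) + M(a - ib), and by the even-odd conditions a - ib is the symbol at the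
conjugate point. -/
theorem exists_isSymbol {θ : ℝ} (h0 : 0 ≤ θ) (hπ : θ ≤ Real.pi) {f : ℍ[ℝ] → ℍ[ℝ]}
    (hf : IsLeftSlice (sector θ) f) : ∃ F : ℂ → V →L[ℂ] V, IsSymbol θ f F := by
  obtain ⟨a, b, h⟩ := hf
  have ho := isOpen_reduced_sector h0 hπ
  let ℓ : ℍ[ℝ] →+ (V →L[ℂ] V) := AddMonoidHom.mk' leftC leftC_add
  have hℓ : Continuous ℓ :=
    AddMonoidHomClass.continuous_of_bound ℓ 1 fun q => by
      rw [one_mul]; exact norm_leftC_le q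
  let H : ℂ → V →L[ℂ] V := fun w => ℓ (a (w.re, w.im)) + Complex.I • ℓ (b (w.re, w.im))
  refine ⟨fun η => H (Complex.exp η), fun η hη => ?_, fun η hη J hJ => ?_⟩
  · have hp := re_im_exp_mem_reduced hπ hη
    refine DifferentiableAt.comp η (g := H) ?_ Complex.differentiableAt_exp
    exact differentiableAt_of_cauchyRiemann ℓ hℓ
      ((h.contDiffOn_a.differentiableOn one_ne_zero).differentiableAt (ho.mem_nhds hp))
      ((h.contDiffOn_b.differentiableOn one_ne_zero).differentiableAt (ho.mem_nhds hp))
      (h.cauchyRiemann₁ _ hp) (h.cauchyRiemann₂ _ hp)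
  · have hp := re_im_exp_mem_reduced hπ hη
    have hc : H (Complex.exp (starRingEnd ℂ η)) =
        leftC (a ((Complex.exp η).re, (Complex.exp η).im)) -
          Complex.I • leftC (b ((Complex.exp η).re, (Complex.exp η).im)) := by
      rw [Complex.exp_conj]
      have ea := h.even_a _ hp
      have eb := h.odd_b _ hp
      simp only at ea eb
      simp only [H, Complex.conj_re, Complex.conj_im, ea, eb, map_neg, smul_neg, ← sub_eq_add_neg]
      rfl
    rw [show planePt J (Complex.exp η) = slicePt J ((Complex.exp η).re, (Complex.exp η).im) from rfl,
      h.decomp _ hp J hJ, leftC_add, leftC_mul, hc]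
    change _ = projP J * (leftC _ + Complex.I • leftC _) + _
    set A : V →L[ℂ] V := leftC (a ((Complex.exp η).re, (Complex.exp η).im))
    set B : V →L[ℂ] V := leftC (b ((Complex.exp η).re, (Complex.exp η).im))
    have hA : A = projP J * A + projM J * A := by rw [← add_mul, projP_add_projM, one_mul]
    have hB : leftC J * B = projP J * (Complex.I • B) - projM J * (Complex.I • B) := by
      rw [mul_smul_comm, mul_smul_comm, ← smul_sub, ← sub_mul]
      have : (leftC J : V →L[ℂ] V) = Complex.I • (projP J - projM J) := by
        rw [projP, projM, ← smul_sub, smul_smul]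
        rw [show (1 : V →L[ℂ] V) - Complex.I • leftC J - (1 + Complex.I • leftC J) =
          (-2 * Complex.I) • leftC J by module, smul_smul]
        have : Complex.I * 2⁻¹ * (-2 * Complex.I) = 1 := by
          linear_combination (-1 : ℂ) * Complex.I_mul_I
        rw [this, one_smul]
      rw [this, smul_mul_assoc]
    rw [mul_add, mul_sub, hB]
    nth_rw 1 [hA]
    abel

variable {θ : ℝ} {f g : ℍ[ℝ] → ℍ[ℝ]} {F : ℂ → V →L[ℂ] V} {J : ℍ[ℝ]}

theorem IsSymbol.projP_mul (h : IsSymbol θ f F) (hJ : J ∈ imSphere) {η : ℂ} (hη : |η.im| < θ) :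
    projP J * leftC (f (planePt J (Complex.exp η))) = projP J * F η := by
  rw [h.decomp η hη J hJ, mul_add, ← mul_assoc, ← mul_assoc, projP_mul_projP hJ,
    projP_mul_projM hJ, zero_mul, add_zero]

theorem IsSymbol.projM_mul (h : IsSymbol θ f F) (hJ : J ∈ imSphere) {η : ℂ} (hη : |η.im| < θ) :
    projM J * leftC (f (planePt J (Complex.exp η))) = projM J * F (starRingEnd ℂ η) := by
  rw [h.decomp η hη J hJ, mul_add, ← mul_assoc, ← mul_assoc, projM_mul_projM hJ,
    projM_mul_projP hJ, zero_mul, zero_add]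

theorem IsSymbol.norm_le (h : IsSymbol θ f F) {η : ℂ} (hη : |η.im| < θ) :
    ‖F η‖ ≤ ‖f (planePt e₁ (Complex.exp η))‖ + ‖f (planePt e₁ (Complex.exp (starRingEnd ℂ η)))‖ := by
  have hJ := e₁_mem_imSphere
  have hη' : |(starRingEnd ℂ η).im| < θ := by simpa using hη
  have h1 : F η = projP e₁ * leftC (f (planePt e₁ (Complex.exp η))) +
      projM e₁ * leftC (f (planePt e₁ (Complex.exp (starRingEnd ℂ η)))) := by
    rw [h.projP_mul hJ hη, h.projM_mul hJ hη', Complex.conj_conj, ← add_mul, projP_add_projM,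
      one_mul]
  rw [h1]
  refine (norm_add_le _ _).trans (add_le_add ?_ ?_)
  · refine (norm_mul_le _ _).trans ?_
    calc _ ≤ 1 * ‖f (planePt e₁ (Complex.exp η))‖ :=
          mul_le_mul (norm_projP_le hJ) (norm_leftC_le _) (norm_nonneg _) zero_le_one
      _ = _ := one_mul _
  · refine (norm_mul_le _ _).trans ?_
    calc _ ≤ 1 * ‖f (planePt e₁ (Complex.exp (starRingEnd ℂ η)))‖ :=
          mul_le_mul (norm_projM_le hJ) (norm_leftC_le _) (norm_nonneg _) zero_le_one
      _ = _ := one_mul _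

theorem Decays.exp_bound {a b : ℝ} (hπ : θ ≤ Real.pi) (h : Decays a b θ f) :
    ∃ δ > (0 : ℝ), ∃ C ≥ (0 : ℝ), ∀ η : ℂ, |η.im| < θ → ∀ J ∈ imSphere,
      (η.re ≤ 0 → ‖f (planePt J (Complex.exp η))‖ ≤ C * Real.exp ((a - 1 + δ) * η.re)) ∧
      (0 ≤ η.re → ‖f (planePt J (Complex.exp η))‖ ≤ C * Real.exp ((b - 1 - δ) * η.re)) := by
  obtain ⟨δ, hδ, C, hC, h⟩ := h
  refine ⟨δ, hδ, C, hC, fun η hη J hJ => ?_⟩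
  have h1 := h _ (planePt_exp_mem_sector hπ hη hJ)
  rw [norm_planePt hJ, Complex.norm_exp, Real.exp_le_one_iff, Real.one_le_exp_iff,
    ← Real.exp_mul, ← Real.exp_mul, mul_comm η.re, mul_comm η.re] at h1
  exact h1

theorem IsSymbol.exp_bound {a b : ℝ} (hπ : θ ≤ Real.pi) (hF : IsSymbol θ f F)
    (h : Decays a b θ f) : ∃ δ > (0 : ℝ), ∃ C ≥ (0 : ℝ), ∀ η : ℂ, |η.im| < θ →
      (η.re ≤ 0 → ‖F η‖ ≤ C * Real.exp ((a - 1 + δ) * η.re)) ∧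
      (0 ≤ η.re → ‖F η‖ ≤ C * Real.exp ((b - 1 - δ) * η.re)) := by
  obtain ⟨δ, hδ, C, hC, h⟩ := h.exp_bound hπ
  refine ⟨δ, hδ, 2 * C, by positivity, fun η hη => ?_⟩
  have hη' : |(starRingEnd ℂ η).im| < θ := by simpa using hη
  have h1 := h η hη _ e₁_mem_imSphere
  have h2 := h _ hη' _ e₁_mem_imSphere
  rw [Complex.conj_re] at h2
  have h3 := hF.norm_le hη
  exact ⟨fun hr => by linarith [h1.1 hr, h2.1 hr], fun hr => by linarith [h1.2 hr, h2.2 hr]⟩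

/-- `G` is the holomorphic function, in the coordinate `η = log z`, that the intrinsic function `g`
extends to the quaternions. -/
structure IsScalarSymbol (θ : ℝ) (g : ℍ[ℝ] → ℍ[ℝ]) (G : ℂ → ℂ) : Prop where
  differentiableAt : ∀ η : ℂ, |η.im| < θ → DifferentiableAt ℂ G η
  decomp : ∀ η : ℂ, |η.im| < θ → ∀ J ∈ imSphere,
    g (planePt J (Complex.exp η)) = planePt J (G η)
  conj : ∀ η : ℂ, |η.im| < θ → G (starRingEnd ℂ η) = starRingEnd ℂ (G η)

theorem exists_isScalarSymbol (h0 : 0 ≤ θ) (hπ : θ ≤ Real.pi)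
    (hg : IsIntrinsic (sector θ) g) : ∃ G : ℂ → ℂ, IsScalarSymbol θ g G := by
  obtain ⟨a, b, h, hr⟩ := hg
  have ho := isOpen_reduced_sector h0 hπ
  let ℓ : ℍ[ℝ] →+ ℂ := AddMonoidHom.mk' (fun q => (q.re : ℂ)) (by simp)
  have hℓ : Continuous ℓ := Complex.continuous_ofReal.comp Quaternion.continuous_re
  let H : ℂ → ℂ := fun w => ℓ (a (w.re, w.im)) + Complex.I • ℓ (b (w.re, w.im))
  refine ⟨fun η => H (Complex.exp η), fun η hη => ?_, fun η hη J hJ => ?_, fun η hη => ?_⟩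
  · have hp := re_im_exp_mem_reduced hπ hη
    refine DifferentiableAt.comp η (g := H) ?_ Complex.differentiableAt_exp
    exact differentiableAt_of_cauchyRiemann ℓ hℓ
      ((h.contDiffOn_a.differentiableOn one_ne_zero).differentiableAt (ho.mem_nhds hp))
      ((h.contDiffOn_b.differentiableOn one_ne_zero).differentiableAt (ho.mem_nhds hp))
      (h.cauchyRiemann₁ _ hp) (h.cauchyRiemann₂ _ hp)
  · have hp := re_im_exp_mem_reduced hπ hη
    rw [show planePt J (Complex.exp η) = slicePt J ((Complex.exp η).re, (Complex.exp η).im) from rfl,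
      h.decomp _ hp J hJ, planePt_eq]
    have coe : ∀ q : ℍ[ℝ], q.im = 0 → q = (q.re : ℍ[ℝ]) := fun q hq => by
      conv_lhs => rw [← Quaternion.re_add_im q, hq, add_zero]
    have e1 : (H (Complex.exp η)).re = (a ((Complex.exp η).re, (Complex.exp η).im)).re := by
      simp [H, ℓ]
    have e2 : (H (Complex.exp η)).im = (b ((Complex.exp η).re, (Complex.exp η).im)).re := by
      simp [H, ℓ]
    rw [e1, e2, ← coe _ (hr _ hp).1, ← coe _ (hr _ hp).2]
  · have hp := re_im_exp_mem_reduced hπ hη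
    have ea := h.even_a _ hp
    have eb := h.odd_b _ hp
    simp only at ea eb
    rw [Complex.exp_conj]
    apply Complex.ext <;> simp [H, ℓ, ea, eb]

variable {G : ℂ → ℂ}

theorem IsScalarSymbol.exp_bound {a b : ℝ} (hπ : θ ≤ Real.pi) (hG : IsScalarSymbol θ g G)
    (h : Decays a b θ g) : ∃ δ > (0 : ℝ), ∃ C ≥ (0 : ℝ), ∀ η : ℂ, |η.im| < θ →
      (η.re ≤ 0 → ‖G η‖ ≤ C * Real.exp ((a - 1 + δ) * η.re)) ∧
      (0 ≤ η.re → ‖G η‖ ≤ C * Real.exp ((b - 1 - δ) * η.re)) := by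
  obtain ⟨δ, hδ, C, hC, h⟩ := h.exp_bound hπ
  refine ⟨δ, hδ, C, hC, fun η hη => ?_⟩
  have h1 := h η hη _ e₁_mem_imSphere
  rwa [hG.decomp η hη _ e₁_mem_imSphere, norm_planePt e₁_mem_imSphere] at h1

theorem leftC_planePt (hJ : J ∈ imSphere) (z : ℂ) :
    (leftC (planePt J z) : V →L[ℂ] V) = z • projP J + starRingEnd ℂ z • projM J := by
  rw [← leftC_planePt_mul_projP hJ, ← leftC_planePt_mul_projM hJ, ← mul_add, projP_add_projM,
    mul_one]

theorem projP_mul_leftC_planePt (hJ : J ∈ imSphere) (z : ℂ) :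
    (projP J * leftC (planePt J z) : V →L[ℂ] V) = z • projP J := by
  rw [leftC_planePt hJ, mul_add, mul_smul_comm, mul_smul_comm, projP_mul_projP hJ,
    projP_mul_projM hJ, smul_zero, add_zero]

theorem projM_mul_leftC_planePt (hJ : J ∈ imSphere) (z : ℂ) :
    (projM J * leftC (planePt J z) : V →L[ℂ] V) = starRingEnd ℂ z • projM J := by
  rw [leftC_planePt hJ, mul_add, mul_smul_comm, mul_smul_comm, projM_mul_projM hJ,
    projM_mul_projP hJ, smul_zero, zero_add]

/-- Left multiplication by g is G on the range of P and its conjugate on that of M; these scalars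
commute with the projections. -/
theorem IsScalarSymbol.isSymbol_mul (hG : IsScalarSymbol θ g G) (hF : IsSymbol θ f F) :
    IsSymbol θ (g * f) fun η => G η • F η := by
  refine ⟨fun η hη => (hG.differentiableAt η hη).smul (hF.differentiableAt η hη),
    fun η hη J hJ => ?_⟩
  rw [Pi.mul_apply, leftC_mul, hG.decomp η hη J hJ, leftC_planePt hJ, add_mul, smul_mul_assoc,
    smul_mul_assoc, hF.projP_mul hJ hη, hF.projM_mul hJ hη, hG.conj η hη, mul_smul_comm,
    mul_smul_comm]

theorem IsScalarSymbol.isSymbol (hG : IsScalarSymbol θ g G) :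
    IsSymbol θ g fun η => G η • (1 : V →L[ℂ] V) := by
  refine ⟨fun η hη => (hG.differentiableAt η hη).smul_const _, fun η hη J hJ => ?_⟩
  rw [hG.decomp η hη J hJ, leftC_planePt hJ, hG.conj η hη, mul_smul_comm, mul_smul_comm, mul_one,
    mul_one]

end Symbols

/-! ### Growth of the complex integrands and independence of the angle. -/

section LogIntegrand

variable {V : Type*} [NormedAddCommGroup V] [NormedSpace ℝ V]
  [Module ℍ[ℝ] V] [Module ℍ[ℝ]ᵐᵒᵖ V] [SMulCommClass ℍ[ℝ] ℍ[ℝ]ᵐᵒᵖ V]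
  [IsScalarTower ℝ ℍ[ℝ] V] [IsScalarTower ℝ ℍ[ℝ]ᵐᵒᵖ V] [NormSMulClass ℍ[ℝ] V]
  [NormedSpace ℂ V] [RightComplex V] [CompleteSpace V]

variable {T : RightOp V} {D : Submodule ℍ[ℝ]ᵐᵒᵖ V} {α β ω θ : ℝ}

namespace RightOp

/-- The type `(α, β, ω)` condition in terms of the complex resolvent, in the coordinate
`η = log z`. -/
structure IsSectorial (T : RightOp V) (D : Submodule ℍ[ℝ]ᵐᵒᵖ V) (α β ω : ℝ) : Prop extends
    T.IsCoreIn D ω where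
  bound : ∀ φ ∈ Ioo ω Real.pi, ∃ C ≥ (0 : ℝ), ∀ η : ℂ, φ ≤ |η.im| → |η.im| ≤ Real.pi →
    (η.re ≤ 0 → ‖T.resol D (Complex.exp η)‖ ≤ C * Real.exp (-α * η.re)) ∧
    (0 ≤ η.re → ‖T.resol D (Complex.exp η)‖ ≤ C * Real.exp (-β * η.re))

theorem IsOfType.isSectorial (h : T.IsOfType D α β ω) (h0 : 0 ≤ ω) (hπ : ω ≤ Real.pi) :
    T.IsSectorial D α β ω := by
  have hc : T.IsCoreIn D ω := ⟨h.isCore, h0, hπ⟩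
  refine ⟨hc, fun φ hφ => ?_⟩
  obtain ⟨C, hC, hb⟩ := h.bound φ hφ
  have hJ := e₁_mem_imSphere
  have key : ∀ η : ℂ, φ ≤ |η.im| → |η.im| ≤ Real.pi →
      (η.re ≤ 0 → ‖slice e₁ (T.resol D) (Complex.exp η)‖ ≤ C * Real.exp (-α * η.re)) ∧
      (0 ≤ η.re → ‖slice e₁ (T.resol D) (Complex.exp η)‖ ≤ C * Real.exp (-β * η.re)) := by
    intro η h1 h2
    have hm := exp_mem_coSector h0 (hφ.1.trans_le h1) h2
    have h3 := hb _ (planePt_exp_notMem_sector (h0.trans hφ.1.le) h1 h2 hJ) (by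
      rw [← norm_pos_iff, norm_planePt hJ, Complex.norm_exp]; exact Real.exp_pos _)
    rw [norm_planePt hJ, Complex.norm_exp, Real.exp_le_one_iff, Real.one_le_exp_iff,
      ← Real.exp_mul, ← Real.exp_mul, mul_comm η.re, mul_comm η.re, hc.SL_planePt hm hJ,
      norm_toReal] at h3
    exact h3
  refine ⟨2 * C, by positivity, fun η h1 h2 => ?_⟩
  have k1 := key η h1 h2
  have k2 := key (starRingEnd ℂ η) (by simpa using h1) (by simpa using h2)
  rw [Complex.exp_conj, Complex.conj_re] at k2
  have k3 := norm_le_slice hJ (T.resol D) (Complex.exp η)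
  exact ⟨fun hr => by linarith [k1.1 hr, k2.1 hr], fun hr => by linarith [k1.2 hr, k2.2 hr]⟩

theorem IsSectorial.conj (h : T.IsSectorial D α β ω) : T.conj.IsSectorial D α β ω := by
  refine ⟨h.toIsCoreIn.conj, fun φ hφ => ?_⟩
  obtain ⟨C, hC, hb⟩ := h.bound φ hφ
  refine ⟨2 * C, by positivity, fun η h1 h2 => ?_⟩
  have k1 := hb η h1 h2
  have k2 := h.toIsCoreIn.norm_conj_resol_le (exp_mem_coSector h.nonneg (hφ.1.trans_le h1) h2)
  exact ⟨fun hr => by linarith [k1.1 hr], fun hr => by linarith [k1.2 hr]⟩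

/-- Each kernel is a combination of products of `k.order` factors R or R̄, as ρ = R R̄. -/
theorem IsSectorial.kernelC_bound (h : T.IsSectorial D α β ω) (k : Calculus) :
    ∀ φ ∈ Ioo ω Real.pi, ∃ C ≥ (0 : ℝ), ∀ η : ℂ, φ ≤ |η.im| → |η.im| ≤ Real.pi →
    (η.re ≤ 0 → ‖k.kernelC T D (Complex.exp η)‖ ≤ C * Real.exp (-(k.order * α) * η.re)) ∧
    (0 ≤ η.re → ‖k.kernelC T D (Complex.exp η)‖ ≤ C * Real.exp (-(k.order * β) * η.re)) := by
  intro φ hφ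
  obtain ⟨C, hC, hb⟩ := h.bound φ hφ
  obtain ⟨C', hC', hb'⟩ := h.conj.bound φ hφ
  set M := max C C'
  have hM : 0 ≤ M := hC.le.trans (le_max_left _ _)
  -- The four kernels need the constants M, 2M², 4M² and 4M³; their common bound is M + 4M² + 4M³.
  have main : ∀ η : ℂ, φ ≤ |η.im| → |η.im| ≤ Real.pi → ∀ x : ℝ, 0 < x →
      ‖T.resol D (Complex.exp η)‖ ≤ M * x → ‖T.conj.resol D (Complex.exp η)‖ ≤ M * x →
      ‖k.kernelC T D (Complex.exp η)‖ ≤ (M + 4 * M ^ 2 + 4 * M ^ 3) * x ^ k.order := by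
    intro η h1 h2 x hx hA hB
    have hm := exp_mem_coSector h.nonneg (hφ.1.trans_le h1) h2
    have hR : ‖T.rho D (Complex.exp η)‖ ≤ (M * x) * (M * x) := by
      rw [← h.toIsCoreIn.resol_mul_conj_resol hm]
      exact (norm_mul_le _ _).trans (mul_le_mul hA hB (norm_nonneg _) (by positivity))
    have e2 : x ^ (2 : ℝ) = x ^ 2 := by norm_cast
    have e3 : x ^ (3 : ℝ) = x ^ 3 := by norm_cast
    cases k with
    | S =>
      simp only [Calculus.kernelC, Calculus.order, Real.rpow_one]
      refine hA.trans (mul_le_mul_of_nonneg_right ?_ hx.le)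
      nlinarith [pow_nonneg hM 2, pow_nonneg hM 3]
    | Q =>
      simp only [Calculus.kernelC, Calculus.order, e2]
      calc _ ≤ 2 * ((M * x) * (M * x)) := by
            rw [norm_smul]; norm_num; linarith
        _ = 2 * M ^ 2 * x ^ 2 := by ring
        _ ≤ _ := mul_le_mul_of_nonneg_right (by nlinarith [pow_nonneg hM 2, pow_nonneg hM 3])
              (by positivity)
    | P2 =>
      simp only [Calculus.kernelC, Calculus.order, e2]
      calc _ ≤ 2 * ((M * x) * (M * x + M * x)) := by
            rw [norm_smul]
            norm_num
            exact (norm_mul_le _ _).trans (mul_le_mul hA ((norm_add_le _ _).trans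
              (add_le_add hA hB)) (norm_nonneg _) (by positivity))
        _ = 4 * M ^ 2 * x ^ 2 := by ring
        _ ≤ _ := mul_le_mul_of_nonneg_right (by nlinarith [pow_nonneg hM 2, pow_nonneg hM 3])
              (by positivity)
    | F =>
      simp only [Calculus.kernelC, Calculus.order, e3]
      calc _ ≤ 4 * ((M * x) * ((M * x) * (M * x))) := by
            rw [norm_smul]
            norm_num
            exact (norm_mul_le _ _).trans (mul_le_mul hA hR (norm_nonneg _) (by positivity))
        _ = 4 * M ^ 3 * x ^ 3 := by ring
        _ ≤ _ := mul_le_mul_of_nonneg_right (by nlinarith [pow_nonneg hM 2, pow_nonneg hM 3])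
              (by positivity)
  have hexp : ∀ a r : ℝ, Real.exp (-a * r) ^ k.order = Real.exp (-(k.order * a) * r) := by
    intro a r; rw [← Real.exp_mul]; ring_nf
  refine ⟨M + 4 * M ^ 2 + 4 * M ^ 3, by positivity, fun η h1 h2 => ⟨fun hr => ?_, fun hr => ?_⟩⟩
  · rw [← hexp]
    refine main η h1 h2 _ (Real.exp_pos _) (((hb η h1 h2).1 hr).trans ?_)
      (((hb' η h1 h2).1 hr).trans ?_)
    · exact mul_le_mul_of_nonneg_right (le_max_left _ _) (Real.exp_pos _).le
    · exact mul_le_mul_of_nonneg_right (le_max_right _ _) (Real.exp_pos _).le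
  · rw [← hexp]
    refine main η h1 h2 _ (Real.exp_pos _) (((hb η h1 h2).2 hr).trans ?_)
      (((hb' η h1 h2).2 hr).trans ?_)
    · exact mul_le_mul_of_nonneg_right (le_max_left _ _) (Real.exp_pos _).le
    · exact mul_le_mul_of_nonneg_right (le_max_right _ _) (Real.exp_pos _).le

end RightOp

theorem Calculus.order_le_three (k : Calculus) : k.order ≤ 3 := by
  cases k <;> norm_num [Calculus.order]

theorem Calculus.one_le_order (k : Calculus) : 1 ≤ k.order := by
  cases k <;> norm_num [Calculus.order]

/-- The integrand of a calculus in the coordinate `η = log z`. -/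
def Calculus.logIntegrand (k : Calculus) (T : RightOp V) (D : Submodule ℍ[ℝ]ᵐᵒᵖ V)
    (F : ℂ → V →L[ℂ] V) (η : ℂ) : V →L[ℂ] V :=
  Complex.exp η • (k.kernelC T D (Complex.exp η) * F η)

variable {f : ℍ[ℝ] → ℍ[ℝ]} {F : ℂ → V →L[ℂ] V} {k : Calculus}

theorem RightOp.IsCoreIn.differentiableAt_kernelC_exp (h : T.IsCoreIn D ω) (k : Calculus) {η : ℂ}
    (h1 : ω < |η.im|) (h2 : |η.im| ≤ Real.pi) :
    DifferentiableAt ℂ (fun η => k.kernelC T D (Complex.exp η)) η :=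
  DifferentiableAt.comp η (g := k.kernelC T D)
    (h.differentiableAt_kernelC (exp_mem_coSector h.nonneg h1 h2) k) Complex.differentiableAt_exp

theorem Calculus.differentiableAt_logIntegrand (h : T.IsCoreIn D ω) (hF : IsSymbol θ f F)
    (hθ : θ ≤ Real.pi) (k : Calculus) {η : ℂ} (h1 : ω < |η.im|) (h2 : |η.im| < θ) :
    DifferentiableAt ℂ (k.logIntegrand T D F) η :=
  Complex.differentiableAt_exp.smul
    ((h.differentiableAt_kernelC_exp k h1 (h2.le.trans hθ)).mul (hF.differentiableAt η h2))

/-- With n = `k.order`, the exponents of dz, K and F add up to (3 - n)α + δ ≥ δ at the origin, so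
the single weight 3α serves all kernels. At infinity they add up to b - nβ - δ. -/
theorem Calculus.logIntegrand_bound (h : T.IsSectorial D α β ω) (hα : 0 ≤ α)
    (hF : IsSymbol θ f F) (hθ : θ ≤ Real.pi) {b : ℝ} (hf : Decays (3 * α) b θ f) (k : Calculus)
    {φ : ℝ} (hφ : φ ∈ Ioo ω θ) :
    ∃ δ > (0 : ℝ), ∃ C ≥ (0 : ℝ), ∀ η : ℂ, φ ≤ |η.im| → |η.im| < θ →
      (η.re ≤ 0 → ‖k.logIntegrand T D F η‖ ≤ C * Real.exp (δ * η.re)) ∧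
      (0 ≤ η.re → ‖k.logIntegrand T D F η‖ ≤ C * Real.exp ((b - k.order * β - δ) * η.re)) := by
  obtain ⟨δ, hδ, C, hC, hb⟩ := hF.exp_bound hθ hf
  obtain ⟨C', hC', hk⟩ := h.kernelC_bound k φ ⟨hφ.1, hφ.2.trans_le hθ⟩
  have est : ∀ η : ℂ, ∀ x y : ℝ, ‖k.kernelC T D (Complex.exp η)‖ ≤ C' * Real.exp (x * η.re) →
      ‖F η‖ ≤ C * Real.exp (y * η.re) →
      ‖k.logIntegrand T D F η‖ ≤ C' * C * Real.exp ((1 + x + y) * η.re) := by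
    intro η x y hx hy
    rw [Calculus.logIntegrand, norm_smul, Complex.norm_exp]
    calc _ ≤ Real.exp η.re * ((C' * Real.exp (x * η.re)) * (C * Real.exp (y * η.re))) :=
          mul_le_mul_of_nonneg_left ((norm_mul_le _ _).trans
            (mul_le_mul hx hy (norm_nonneg _) (by positivity))) (Real.exp_pos _).le
      _ = C' * C * Real.exp ((1 + x + y) * η.re) := by
          rw [add_mul, add_mul, Real.exp_add, Real.exp_add, one_mul]; ring
  refine ⟨δ, hδ, C' * C, by positivity, fun η h1 h2 => ⟨fun hr => ?_, fun hr => ?_⟩⟩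
  · refine (est η _ _ ((hk η h1 (h2.le.trans hθ)).1 hr) ((hb η h2).1 hr)).trans ?_
    refine mul_le_mul_of_nonneg_left (Real.exp_le_exp.2 ?_) (by positivity)
    have : 0 ≤ (3 - k.order) * α := mul_nonneg (by linarith [k.order_le_three]) hα
    nlinarith
  · refine (est η _ _ ((hk η h1 (h2.le.trans hθ)).2 hr) ((hb η h2).2 hr)).trans (le_of_eq ?_)
    ring_nf

theorem abs_exp_bound {C δ : ℝ} {x : ℝ} {η : ℂ}
    (h1 : η.re ≤ 0 → x ≤ C * Real.exp (δ * η.re))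
    (h2 : 0 ≤ η.re → x ≤ C * Real.exp (-δ * η.re)) : x ≤ C * Real.exp (-δ * |η.re|) := by
  rcases le_total η.re 0 with h | h
  · rw [abs_of_nonpos h, neg_mul_neg]; exact h1 h
  · rw [abs_of_nonneg h]; exact h2 h

/-- For b = 3β the integrand may grow at infinity, but the exponent is at most 2β - δ ≤ 1 - δ. This
suffices for `integral_line_eq_of_growth`, given integrability on the rays. -/
theorem Calculus.contourIntegral_logIntegrand_eq (h : T.IsSectorial D α β ω) (hα : 0 ≤ α)
    (hβ0 : 0 ≤ β) (hβ : β ≤ 1 / 3) (hF : IsSymbol θ f F) (hθ : θ < Real.pi) (k : Calculus)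
    (hf : Decays (3 * α) (3 * β) θ f)
    (hi : ∀ φ ∈ Ioo ω θ, ContourIntegrable φ (k.logIntegrand T D F)) {φ φ' : ℝ}
    (hφ : φ ∈ Ioo ω θ) (hφ' : φ' ∈ Ioo ω θ) :
    contourIntegral φ (k.logIntegrand T D F) = contourIntegral φ' (k.logIntegrand T D F) := by
  wlog hle : φ ≤ φ' generalizing φ φ'
  · exact (this hφ' hφ (le_of_not_ge hle)).symm
  obtain ⟨δ, hδ, C, hC, hb⟩ := k.logIntegrand_bound h hα hF hθ.le hf hφ
  have h0 : 0 ≤ φ := h.nonneg.trans hφ.1.le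
  have hdiff : ∀ η : ℂ, φ ≤ |η.im| → |η.im| ≤ φ' →
      DifferentiableAt ℂ (k.logIntegrand T D F) η := fun η h1 h2 =>
    k.differentiableAt_logIntegrand h.toIsCoreIn hF hθ.le (hφ.1.trans_le h1) (h2.trans_lt hφ'.2)
  have hr : ∀ η : ℂ, φ ≤ |η.im| → |η.im| ≤ φ' → 0 ≤ η.re →
      ‖k.logIntegrand T D F η‖ ≤ C * Real.exp ((1 - δ) * η.re) := fun η h1 h2 h3 => by
    refine ((hb η h1 (h2.trans_lt hφ'.2)).2 h3).trans
      (mul_le_mul_of_nonneg_left (Real.exp_le_exp.2 (mul_le_mul_of_nonneg_right ?_ h3)) hC.le)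
    have := mul_le_mul_of_nonneg_right k.one_le_order hβ0
    linarith
  rw [contourIntegral, contourIntegral]
  congr 1
  · have a1 : ∀ η : ℂ, -φ' ≤ η.im → η.im ≤ -φ → φ ≤ |η.im| ∧ |η.im| ≤ φ' := fun η h1 h2 => by
      rw [abs_of_nonpos (by linarith)]; constructor <;> linarith
    exact (integral_line_eq_of_growth (by linarith) hθ (by linarith [hφ'.2]) (by linarith [hφ'.2])
      (fun η h1 h2 => hdiff η (a1 η h1 h2).1 (a1 η h1 h2).2) hδ hC.le
      (fun η h1 h2 => (hb η (a1 η h1 h2).1 ((a1 η h1 h2).2.trans_lt hφ'.2)).1)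
      (fun η h1 h2 => hr η (a1 η h1 h2).1 (a1 η h1 h2).2) (hi _ hφ').1 (hi _ hφ).1).symm
  · have a1 : ∀ η : ℂ, φ ≤ η.im → η.im ≤ φ' → φ ≤ |η.im| ∧ |η.im| ≤ φ' := fun η h1 h2 => by
      rw [abs_of_nonneg (by linarith)]; constructor <;> linarith
    exact integral_line_eq_of_growth hle hθ (by linarith [hφ'.2]) hφ'.2.le
      (fun η h1 h2 => hdiff η (a1 η h1 h2).1 (a1 η h1 h2).2) hδ hC.le
      (fun η h1 h2 => (hb η (a1 η h1 h2).1 ((a1 η h1 h2).2.trans_lt hφ'.2)).1)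
      (fun η h1 h2 => hr η (a1 η h1 h2).1 (a1 η h1 h2).2) (hi _ hφ).2 (hi _ hφ').2

end LogIntegrand

/-! ### The substitution t = ±exp u. -/

section ExpSubstitution

variable {E : Type*} [NormedAddCommGroup E] [NormedSpace ℝ E]

theorem exp_image_univ : Real.exp '' univ = Ioi 0 := by
  rw [image_univ, Real.range_exp]

theorem neg_exp_image_univ : (fun u => -Real.exp u) '' univ = Iio 0 := by
  ext t
  simp only [mem_image, mem_univ, true_and, mem_Iio]
  exact ⟨fun ⟨u, hu⟩ => by rw [← hu]; exact neg_neg_of_pos (Real.exp_pos u),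
    fun ht => ⟨Real.log (-t), by rw [Real.exp_log (by linarith), neg_neg]⟩⟩

theorem injective_neg_exp : Function.Injective fun u => -Real.exp u :=
  fun _ _ h => Real.exp_injective (neg_injective h)

theorem integrable_iff_exp {f : ℝ → E} : Integrable f ↔
    Integrable (fun u => Real.exp u • f (Real.exp u)) ∧
      Integrable fun u => Real.exp u • f (-Real.exp u) := by
  have h1 := integrableOn_image_iff_integrableOn_abs_deriv_smul MeasurableSet.univ
    (fun x _ => (Real.hasDerivAt_exp x).hasDerivWithinAt) Real.exp_injective.injOn f
  have h2 := integrableOn_image_iff_integrableOn_abs_deriv_smul MeasurableSet.univ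
    (fun x _ => (show HasDerivAt (fun u => -Real.exp u) (-Real.exp x) x from
      (Real.hasDerivAt_exp x).neg).hasDerivWithinAt) injective_neg_exp.injOn f
  rw [exp_image_univ, integrableOn_univ] at h1
  rw [neg_exp_image_univ, integrableOn_univ] at h2
  simp only [abs_neg, Real.abs_exp] at h1 h2
  rw [← h1, ← h2, ← integrableOn_univ, ← Iic_union_Ioi (a := (0 : ℝ)), integrableOn_union,
    integrableOn_Iic_iff_integrableOn_Iio, and_comm]

theorem integral_eq_exp {f : ℝ → E} (hf : Integrable f) : ∫ t, f t =
    (∫ u, Real.exp u • f (Real.exp u)) + ∫ u, Real.exp u • f (-Real.exp u) := by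
  have h1 := integral_image_eq_integral_abs_deriv_smul MeasurableSet.univ
    (fun x _ => (Real.hasDerivAt_exp x).hasDerivWithinAt) Real.exp_injective.injOn f
  have h2 := integral_image_eq_integral_abs_deriv_smul MeasurableSet.univ
    (fun x _ => (show HasDerivAt (fun u => -Real.exp u) (-Real.exp x) x from
      (Real.hasDerivAt_exp x).neg).hasDerivWithinAt) injective_neg_exp.injOn f
  rw [exp_image_univ, setIntegral_univ] at h1
  rw [neg_exp_image_univ, setIntegral_univ] at h2
  simp only [abs_neg, Real.abs_exp] at h1 h2
  rw [← h1, ← h2, ← integral_Iic_eq_integral_Iio, add_comm,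
    intervalIntegral.integral_Iic_add_Ioi hf.integrableOn hf.integrableOn]

end ExpSubstitution

/-! ### The boundary path in the logarithmic coordinate. -/

section Path

variable {J : ℍ[ℝ]} {φ : ℝ}

theorem coe_mul_planePt (J : ℍ[ℝ]) (r : ℝ) (z : ℂ) :
    (r : ℍ[ℝ]) * planePt J z = planePt J (r * z) := by
  simp only [planePt_eq, Complex.re_ofReal_mul, Complex.im_ofReal_mul, Quaternion.coe_mul, mul_add,
    ← mul_assoc]
  rw [(Quaternion.coe_commutes r J).symm]

theorem exp_linePt (c u : ℝ) :
    Complex.exp (linePt c u) = (Real.exp u : ℂ) * ⟨Real.cos c, Real.sin c⟩ := by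
  rw [linePt, Complex.exp_add, Complex.exp_mul_I, ← Complex.ofReal_exp, ← Complex.ofReal_cos,
    ← Complex.ofReal_sin]
  rw [Complex.mk_eq_add_mul_I, Complex.ofReal_exp]

theorem path_exp (φ : ℝ) (J : ℍ[ℝ]) (u : ℝ) :
    path φ J (Real.exp u) = planePt J (Complex.exp (linePt (-φ) u)) := by
  rw [path, if_neg (Real.exp_pos u).not_gt, exp_linePt, ← coe_mul_planePt, Real.cos_neg,
    Real.sin_neg]
  rfl

theorem path_neg_exp (φ : ℝ) (J : ℍ[ℝ]) (u : ℝ) :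
    path φ J (-Real.exp u) = planePt J (Complex.exp (linePt φ u)) := by
  rw [path, if_pos (neg_neg_of_pos (Real.exp_pos u)), neg_neg, exp_linePt, ← coe_mul_planePt]
  rfl

theorem hasDerivAt_coe_mul (c : ℍ[ℝ]) (t : ℝ) :
    HasDerivAt (fun t : ℝ => (t : ℍ[ℝ]) * c) c t := by
  have h := (hasDerivAt_id t).smul_const c
  rw [one_smul] at h
  refine h.congr_of_eventuallyEq (Filter.Eventually.of_forall fun t => ?_)
  exact Quaternion.coe_mul_eq_smul t c

theorem exp_mul_deriv_path_exp (φ : ℝ) (J : ℍ[ℝ]) (u : ℝ) :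
    (Real.exp u : ℍ[ℝ]) * deriv (path φ J) (Real.exp u) =
      planePt J (Complex.exp (linePt (-φ) u)) := by
  have h : HasDerivAt (path φ J) (slicePt J (Real.cos φ, -Real.sin φ)) (Real.exp u) := by
    refine (hasDerivAt_coe_mul _ _).congr_of_eventuallyEq ?_
    filter_upwards [lt_mem_nhds (Real.exp_pos u)] with t ht
    rw [path, if_neg ht.not_gt]
  rw [h.deriv, ← path_exp, path, if_neg (Real.exp_pos u).not_gt]

theorem exp_mul_deriv_path_neg_exp (φ : ℝ) (J : ℍ[ℝ]) (u : ℝ) :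
    (Real.exp u : ℍ[ℝ]) * deriv (path φ J) (-Real.exp u) =
      -planePt J (Complex.exp (linePt φ u)) := by
  have h : HasDerivAt (path φ J) (-slicePt J (Real.cos φ, Real.sin φ)) (-Real.exp u) := by
    have h1 := hasDerivAt_coe_mul (-slicePt J (Real.cos φ, Real.sin φ)) (-Real.exp u)
    refine h1.congr_of_eventuallyEq ?_
    filter_upwards [gt_mem_nhds (neg_neg_of_pos (Real.exp_pos u))] with t ht
    rw [path, if_pos ht, mul_neg, Quaternion.coe_neg, neg_mul]
  rw [h.deriv, ← path_neg_exp, path, if_pos (neg_neg_of_pos (Real.exp_pos u)), neg_neg, mul_neg]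

end Path

/-! ### From quaternionic contour integrals to complex ones. -/

section Bridge

variable {V : Type*} [NormedAddCommGroup V] [NormedSpace ℝ V]
  [Module ℍ[ℝ] V] [Module ℍ[ℝ]ᵐᵒᵖ V] [SMulCommClass ℍ[ℝ] ℍ[ℝ]ᵐᵒᵖ V]
  [IsScalarTower ℝ ℍ[ℝ] V] [NormSMulClass ℍ[ℝ] V]

variable {T : RightOp V} {D : Submodule ℍ[ℝ]ᵐᵒᵖ V} {α β ω θ φ : ℝ} {J : ℍ[ℝ]}
  {f g : ℍ[ℝ] → ℍ[ℝ]} {k : Calculus}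

/-- The integrand `K_L(s, T) s J⁻¹ f(s)` at the point `s = e^η` of the plane `ℂ_J`. -/
def Calculus.planeIntegrand (k : Calculus) (T : RightOp V) (D : Submodule ℍ[ℝ]ᵐᵒᵖ V) (J : ℍ[ℝ])
    (f : ℍ[ℝ] → ℍ[ℝ]) (η : ℂ) : V →L[ℝ] V :=
  k.kernel T D (planePt J (Complex.exp η)) * ContinuousLinearMap.lsmul ℝ ℍ[ℝ]
    (planePt J (Complex.exp η) * J⁻¹ * f (planePt J (Complex.exp η)))

theorem Calculus.exp_smul_integrand (k : Calculus) (T : RightOp V) (D : Submodule ℍ[ℝ]ᵐᵒᵖ V)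
    (φ : ℝ) (J : ℍ[ℝ]) (f : ℍ[ℝ] → ℍ[ℝ]) (u : ℝ) :
    Real.exp u • k.integrand T D φ J f (Real.exp u) =
      k.planeIntegrand T D J f (linePt (-φ) u) := by
  rw [Calculus.integrand, planeIntegrand, ← path_exp, ← mul_smul_comm, ← map_smul,
    ← Quaternion.coe_mul_eq_smul, ← mul_assoc, ← mul_assoc, exp_mul_deriv_path_exp, path_exp]

theorem Calculus.exp_smul_integrand_neg (k : Calculus) (T : RightOp V)
    (D : Submodule ℍ[ℝ]ᵐᵒᵖ V) (φ : ℝ) (J : ℍ[ℝ]) (f : ℍ[ℝ] → ℍ[ℝ]) (u : ℝ) :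
    Real.exp u • k.integrand T D φ J f (-Real.exp u) =
      -k.planeIntegrand T D J f (linePt φ u) := by
  rw [← neg_eq_iff_eq_neg, Calculus.integrand, planeIntegrand, ← path_neg_exp, ← mul_smul_comm,
    ← map_smul, ← Quaternion.coe_mul_eq_smul, ← mul_neg, ← map_neg, ← mul_assoc, ← mul_assoc,
    exp_mul_deriv_path_neg_exp, path_neg_exp, neg_mul, neg_mul, neg_neg]

theorem Calculus.integrable_integrand_iff : Integrable (k.integrand T D φ J f) ↔
    ContourIntegrable φ (k.planeIntegrand T D J f) := by
  rw [integrable_iff_exp, ContourIntegrable]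
  simp_rw [exp_smul_integrand, exp_smul_integrand_neg]
  exact and_congr Iff.rfl ⟨fun h => by simpa using h.neg, fun h => h.neg⟩

theorem Calculus.integral_integrand (h : Integrable (k.integrand T D φ J f)) :
    ∫ t, k.integrand T D φ J f t = (∫ u, k.planeIntegrand T D J f (linePt (-φ) u)) -
      ∫ u, k.planeIntegrand T D J f (linePt φ u) := by
  rw [integral_eq_exp h]
  simp_rw [exp_smul_integrand, exp_smul_integrand_neg, integral_neg, sub_eq_add_neg]

/-- Equality holds because left multiplication by q ≠ 0 is undone by that by q⁻¹. The exact norm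
makes integrability depend on f only through |f|. -/
theorem norm_mul_lsmul (A : V →L[ℝ] V) (q : ℍ[ℝ]) :
    ‖A * ContinuousLinearMap.lsmul ℝ ℍ[ℝ] q‖ = ‖A‖ * ‖q‖ := by
  have le : ∀ (A : V →L[ℝ] V) (q : ℍ[ℝ]),
      ‖A * ContinuousLinearMap.lsmul ℝ ℍ[ℝ] q‖ ≤ ‖A‖ * ‖q‖ := by
    intro A q
    refine (norm_mul_le _ _).trans (mul_le_mul_of_nonneg_left ?_ (norm_nonneg _))
    exact ContinuousLinearMap.opNorm_le_bound _ (norm_nonneg _) fun v => (norm_smul q v).le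
  refine le_antisymm (le A q) ?_
  rcases eq_or_ne q 0 with rfl | hq
  · simp
  have h1 : A * ContinuousLinearMap.lsmul ℝ ℍ[ℝ] q * ContinuousLinearMap.lsmul ℝ ℍ[ℝ] q⁻¹ = A := by
    ext v
    change A (q • q⁻¹ • v) = A v
    rw [smul_smul, mul_inv_cancel₀ hq, one_smul]
  have h2 := le (A * ContinuousLinearMap.lsmul ℝ ℍ[ℝ] q) q⁻¹
  rw [h1, norm_inv] at h2
  have := norm_pos_iff.2 hq
  calc ‖A‖ * ‖q‖ ≤ _ * ‖q‖⁻¹ * ‖q‖ := mul_le_mul_of_nonneg_right h2 this.le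
    _ = _ := by rw [mul_assoc, inv_mul_cancel₀ this.ne', mul_one]

theorem Calculus.norm_planeIntegrand (hJ : J ∈ imSphere) (η : ℂ) :
    ‖k.planeIntegrand T D J f η‖ = ‖k.kernel T D (planePt J (Complex.exp η))‖ *
      (‖Complex.exp η‖ * ‖f (planePt J (Complex.exp η))‖) := by
  rw [planeIntegrand, norm_mul_lsmul, norm_mul, norm_mul, norm_inv, hJ.2, inv_one, mul_one,
    norm_planePt hJ]

theorem integral_addMonoidHom_smul_sub {X E F : Type*} [MeasurableSpace X] {μ : Measure X}
    [NormedAddCommGroup E] [NormedSpace ℂ E] [CompleteSpace E] [NormedAddCommGroup F]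
    [NormedSpace ℝ F] [CompleteSpace F] (ψ : E →+ F) (hψ : Continuous ψ) (c : ℂ) {f g : X → E}
    (hf : Integrable f μ) (hg : Integrable g μ) :
    ∫ x, ψ (c • (f x - g x)) ∂μ = ψ (c • ((∫ x, f x ∂μ) - ∫ x, g x ∂μ)) := by
  rw [← integral_sub hf hg, ← integral_smul]
  exact (ψ.toRealLinearMap hψ).integral_comp_comm ((hf.sub hg).smul c)

variable [IsScalarTower ℝ ℍ[ℝ]ᵐᵒᵖ V] [NormedSpace ℂ V] [RightComplex V] [CompleteSpace V]

variable {F : ℂ → V →L[ℂ] V}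

theorem planePt_neg_I (hJ : J ∈ imSphere) : planePt J (-Complex.I) = J⁻¹ := by
  rw [planePt_eq, imSphere_inv hJ]; simp

theorem continuous_toReal : Continuous (toReal : (V →L[ℂ] V) → V →L[ℝ] V) := by
  have : Isometry (toReal : (V →L[ℂ] V) → V →L[ℝ] V) :=
    Isometry.of_dist_eq fun A B => by
      rw [dist_eq_norm, dist_eq_norm, ← toReal_sub, norm_toReal]
  exact this.continuous

section

variable (h : T.IsCoreIn D ω) (hF : IsSymbol θ f F) (hθ : θ ≤ Real.pi) (hJ : J ∈ imSphere) {η : ℂ}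
  (h1 : ω < |η.im|) (h2 : |η.im| < θ)

include h hF hθ hJ h1 h2

/-- J⁻¹ is the point of ℂ_J with coordinate -i, so s J⁻¹ acts as -i exp η on the P part and as its
conjugate on the M part. -/
theorem Calculus.planeIntegrand_eq (k : Calculus) : k.planeIntegrand T D J f η =
    toReal (-Complex.I • (Complex.exp η • (k.kernelC T D (Complex.exp η) * projP J * F η)) +
      Complex.I • (Complex.exp (starRingEnd ℂ η) •
        (k.kernelC T D (Complex.exp (starRingEnd ℂ η)) * projM J * F (starRingEnd ℂ η)))) := by
  have hm := exp_mem_coSector h.nonneg h1 (h2.le.trans hθ)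
  rw [planeIntegrand, h.kernel_planePt hm hJ, ← toReal_leftC, ← toReal_mul, slice, leftC_mul,
    ← planePt_neg_I hJ, ← planePt_mul hJ, ← Complex.exp_conj]
  congr 1
  rw [add_mul, mul_assoc, ← mul_assoc (projP J), projP_mul_leftC_planePt hJ, smul_mul_assoc,
    hF.projP_mul hJ h2, mul_assoc _ (projM J), ← mul_assoc (projM J), projM_mul_leftC_planePt hJ,
    smul_mul_assoc, hF.projM_mul hJ h2, mul_smul_comm, mul_smul_comm, map_mul, map_neg,
    Complex.conj_I, neg_neg, ← Complex.exp_conj, smul_smul, smul_smul, mul_comm _ (-Complex.I),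
    mul_comm _ Complex.I, mul_assoc, mul_assoc]

/-- The P part at η and the M part at the conjugate of η carry the same kernel and symbol.
Subtraction matches their signs, and P + M = 1 removes J. -/
theorem Calculus.planeIntegrand_conj_sub (k : Calculus) :
    k.planeIntegrand T D J f (starRingEnd ℂ η) - k.planeIntegrand T D J f η =
      toReal (-Complex.I • (k.logIntegrand T D F (starRingEnd ℂ η) - k.logIntegrand T D F η)) := by
  have h1' : ω < |(starRingEnd ℂ η).im| := by simpa using h1
  have h2' : |(starRingEnd ℂ η).im| < θ := by simpa using h2
  rw [k.planeIntegrand_eq h hF hθ hJ h1 h2, k.planeIntegrand_eq h hF hθ hJ h1' h2', ← toReal_sub,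
    Complex.conj_conj]
  congr 1
  have split : ∀ A B : V →L[ℂ] V, A * B = A * projP J * B + A * projM J * B := fun A B => by
    rw [← add_mul, ← mul_add, projP_add_projM, mul_one]
  rw [logIntegrand, logIntegrand, split (k.kernelC T D (Complex.exp η)) (F η),
    split (k.kernelC T D (Complex.exp (starRingEnd ℂ η))) (F (starRingEnd ℂ η))]
  module

/-- Writing K F = K P F + K M F expresses the complex integrand through the quaternionic one on both
conjugate rays, so absolute convergence passes to each complex ray separately. -/
theorem Calculus.norm_logIntegrand_le (k : Calculus) : ‖k.logIntegrand T D F η‖ ≤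
    ‖k.planeIntegrand T D J f η‖ + ‖k.planeIntegrand T D J f (starRingEnd ℂ η)‖ := by
  have hm := exp_mem_coSector h.nonneg h1 (h2.le.trans hθ)
  have hm' := conj_mem_coSector hm
  have h2' : |(starRingEnd ℂ η).im| < θ := by simpa using h2
  have e : k.kernelC T D (Complex.exp η) * F η =
      slice J (k.kernelC T D) (Complex.exp η) * projP J * leftC (f (planePt J (Complex.exp η))) +
      slice J (k.kernelC T D) (starRingEnd ℂ (Complex.exp η)) * projM J *
        leftC (f (planePt J (Complex.exp (starRingEnd ℂ η)))) := by
    rw [slice_mul_projP hJ, slice_conj_apply_projM hJ, mul_assoc, mul_assoc, hF.projP_mul hJ h2,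
      hF.projM_mul hJ h2', Complex.conj_conj, ← mul_add, ← add_mul, projP_add_projM, one_mul]
  have hn : ‖Complex.exp (starRingEnd ℂ η)‖ = ‖Complex.exp η‖ := by
    rw [Complex.norm_exp, Complex.norm_exp, Complex.conj_re]
  have prod : ∀ (A P : V →L[ℂ] V) (q : ℍ[ℝ]), ‖P‖ ≤ 1 → ‖A * P * leftC q‖ ≤ ‖A‖ * ‖q‖ := by
    intro A P q hP
    refine (norm_mul_le _ _).trans (mul_le_mul ?_ (norm_leftC_le q) (norm_nonneg _)
      (norm_nonneg _))
    exact (norm_mul_le _ _).trans (mul_le_of_le_one_right (norm_nonneg _) hP)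
  rw [norm_planeIntegrand hJ, norm_planeIntegrand hJ, hn, Complex.exp_conj,
    h.kernel_planePt hm hJ, h.kernel_planePt hm' hJ, norm_toReal, norm_toReal, logIntegrand, e,
    norm_smul, ← Complex.exp_conj]
  rw [Complex.exp_conj] at e ⊢
  calc _ ≤ ‖Complex.exp η‖ * (‖slice J (k.kernelC T D) (Complex.exp η)‖ *
        ‖f (planePt J (Complex.exp η))‖ +
        ‖slice J (k.kernelC T D) (starRingEnd ℂ (Complex.exp η))‖ *
        ‖f (planePt J (starRingEnd ℂ (Complex.exp η)))‖) :=
        mul_le_mul_of_nonneg_left ((norm_add_le _ _).trans (add_le_add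
          (prod _ _ _ (norm_projP_le hJ)) (prod _ _ _ (norm_projM_le hJ)))) (norm_nonneg _)
    _ = _ := by ring

theorem Calculus.continuousAt_planeIntegrand (k : Calculus) :
    ContinuousAt (k.planeIntegrand T D J f) η := by
  have hd : ∀ ζ : ℂ, ω < |ζ.im| → |ζ.im| < θ → ∀ P : V →L[ℂ] V, ContinuousAt (fun ζ =>
      Complex.exp ζ • (k.kernelC T D (Complex.exp ζ) * P * F ζ)) ζ := fun ζ a1 a2 P =>
    (Complex.continuous_exp.continuousAt).smul
      (((h.differentiableAt_kernelC_exp k a1 (a2.le.trans hθ)).continuousAt.mul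
        continuousAt_const).mul (hF.differentiableAt ζ a2).continuousAt)
  have h1' : ω < |(starRingEnd ℂ η).im| := by simpa using h1
  have h2' : |(starRingEnd ℂ η).im| < θ := by simpa using h2
  have c1 := (hd η h1 h2 (projP J)).const_smul (-Complex.I)
  have c2 := (ContinuousAt.comp (f := starRingEnd ℂ) (hd _ h1' h2' (projM J))
    Complex.continuous_conj.continuousAt).const_smul Complex.I
  refine ((continuous_toReal.continuousAt).comp (c1.add c2)).congr ?_
  have ho : IsOpen {ζ : ℂ | ω < |ζ.im| ∧ |ζ.im| < θ} :=
    (isOpen_lt continuous_const Complex.continuous_im.abs).inter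
      (isOpen_lt Complex.continuous_im.abs continuous_const)
  filter_upwards [ho.mem_nhds ⟨h1, h2⟩] with ζ hζ
  exact (k.planeIntegrand_eq h hF hθ hJ hζ.1 hζ.2).symm

end

theorem conj_linePt (c u : ℝ) : starRingEnd ℂ (linePt c u) = linePt (-c) u :=
  Complex.ext (by simp) (by simp)

section

variable (h : T.IsCoreIn D ω) (hF : IsSymbol θ f F) (hθ : θ ≤ Real.pi) (hφ : φ ∈ Ioo ω θ)

include h hF hθ hφ

theorem Calculus.contourIntegrable_of_integrable (hJ : J ∈ imSphere)
    (hi : Integrable (k.integrand T D φ J f)) : ContourIntegrable φ (k.logIntegrand T D F) := by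
  have h0 : 0 ≤ φ := h.nonneg.trans hφ.1.le
  obtain ⟨i1, i2⟩ := Calculus.integrable_integrand_iff.1 hi
  have hs := i1.norm.add i2.norm
  have hc : ∀ c, |c| = φ → Continuous fun u => k.logIntegrand T D F (linePt c u) := fun c hc =>
    continuous_comp_linePt fun η hη => (k.differentiableAt_logIntegrand h hF hθ
      (by rw [hη, hc]; exact hφ.1) (by rw [hη, hc]; exact hφ.2)).continuousAt
  have hb : ∀ c u, |c| = φ → ‖k.logIntegrand T D F (linePt c u)‖ ≤
      ‖k.planeIntegrand T D J f (linePt c u)‖ + ‖k.planeIntegrand T D J f (linePt (-c) u)‖ := by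
    intro c u hc
    rw [← conj_linePt]
    exact k.norm_logIntegrand_le h hF hθ hJ (by rw [linePt_im, hc]; exact hφ.1)
      (by rw [linePt_im, hc]; exact hφ.2)
  refine ⟨hs.mono' (hc (-φ) (by rw [abs_neg, abs_of_nonneg h0])).aestronglyMeasurable
    (Filter.Eventually.of_forall fun u => ?_),
    hs.mono' (hc φ (abs_of_nonneg h0)).aestronglyMeasurable
    (Filter.Eventually.of_forall fun u => ?_)⟩
  · have := hb (-φ) u (by rw [abs_neg, abs_of_nonneg h0])
    rwa [neg_neg] at this
  · rw [Pi.add_apply, add_comm]; exact hb φ u (abs_of_nonneg h0)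

theorem Calculus.eval_eq (hJ : J ∈ imSphere) (hi : Integrable (k.integrand T D φ J f)) :
    k.eval T D φ J f =
      toReal ((2 * Real.pi * Complex.I)⁻¹ • contourIntegral φ (k.logIntegrand T D F)) := by
  have h0 : 0 ≤ φ := h.nonneg.trans hφ.1.le
  obtain ⟨c1, c2⟩ := Calculus.contourIntegrable_of_integrable h hF hθ hφ hJ hi
  obtain ⟨i1, i2⟩ := Calculus.integrable_integrand_iff.1 hi
  let ψ : (V →L[ℂ] V) →+ (V →L[ℝ] V) := AddMonoidHom.mk' toReal toReal_add
  have e : ∀ u, k.planeIntegrand T D J f (linePt (-φ) u) - k.planeIntegrand T D J f (linePt φ u) =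
      ψ (-Complex.I • (k.logIntegrand T D F (linePt (-φ) u) - k.logIntegrand T D F (linePt φ u))) := by
    intro u
    rw [← conj_linePt φ u]
    exact k.planeIntegrand_conj_sub h hF hθ hJ (by rw [linePt_im, abs_of_nonneg h0]; exact hφ.1)
      (by rw [linePt_im, abs_of_nonneg h0]; exact hφ.2)
  rw [Calculus.eval, Calculus.integral_integrand hi, ← integral_sub i1 i2]
  simp_rw [e]
  rw [integral_addMonoidHom_smul_sub ψ continuous_toReal (-Complex.I) c1 c2]
  change _ • toReal _ = _
  rw [← toReal_real_smul, smul_smul, contourIntegral]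
  congr 2
  push_cast
  rw [mul_inv _ Complex.I, mul_inv, Complex.inv_I]

end

end Bridge

/-! ### The product of an intrinsic and a left slice hyperholomorphic function. -/

section FunctionProduct

variable {f g : ℍ[ℝ] → ℍ[ℝ]} {a b α β θ : ℝ}

theorem IsLeftSlice.intrinsic_mul (h0 : 0 ≤ θ) (hπ : θ ≤ Real.pi)
    (hg : IsIntrinsic (sector θ) g) (hf : IsLeftSlice (sector θ) f) :
    IsLeftSlice (sector θ) (g * f) := by
  obtain ⟨a, b, h, hr⟩ := hg
  obtain ⟨a', b', h'⟩ := hf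
  have ho := isOpen_reduced_sector h0 hπ
  have coe : ∀ q : ℍ[ℝ], q.im = 0 → q = (q.re : ℍ[ℝ]) := fun q hq => by
    conv_lhs => rw [← Quaternion.re_add_im q, hq, add_zero]
  have d : ∀ {u : ℝ × ℝ → ℍ[ℝ]}, ContDiffOn ℝ 1 u (reduced (sector θ)) →
      ∀ p ∈ reduced (sector θ), HasFDerivAt u (fderiv ℝ u p) p := fun hu p hp =>
    ((hu.differentiableOn one_ne_zero).differentiableAt (ho.mem_nhds hp)).hasFDerivAt
  have da : ∀ p ∈ reduced (sector θ), ∀ v, fderiv ℝ (fun p => a p * a' p - b p * b' p) p v =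
      a p * fderiv ℝ a' p v + fderiv ℝ a p v * a' p -
        (b p * fderiv ℝ b' p v + fderiv ℝ b p v * b' p) := by
    intro p hp v
    have := HasFDerivAt.fderiv (((d h.contDiffOn_a p hp).mul' (d h'.contDiffOn_a p hp)).sub
      ((d h.contDiffOn_b p hp).mul' (d h'.contDiffOn_b p hp)))
    exact DFunLike.congr_fun this v
  have db : ∀ p ∈ reduced (sector θ), ∀ v, fderiv ℝ (fun p => a p * b' p + b p * a' p) p v =
      a p * fderiv ℝ b' p v + fderiv ℝ a p v * b' p +
        (b p * fderiv ℝ a' p v + fderiv ℝ b p v * a' p) := by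
    intro p hp v
    have := HasFDerivAt.fderiv (((d h.contDiffOn_a p hp).mul' (d h'.contDiffOn_b p hp)).add
      ((d h.contDiffOn_b p hp).mul' (d h'.contDiffOn_a p hp)))
    exact DFunLike.congr_fun this v
  refine ⟨fun p => a p * a' p - b p * b' p, fun p => a p * b' p + b p * a' p,
    (h.contDiffOn_a.mul h'.contDiffOn_a).sub (h.contDiffOn_b.mul h'.contDiffOn_b),
    (h.contDiffOn_a.mul h'.contDiffOn_b).add (h.contDiffOn_b.mul h'.contDiffOn_a), ?_, ?_, ?_,
    ?_, ?_⟩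
  · intro p hp J hJ
    rw [Pi.mul_apply, h.decomp p hp J hJ, h'.decomp p hp J hJ]
    -- The only place where g must be intrinsic: its real components commute with J.
    have ca : a p * J = J * a p := by
      rw [coe _ (hr p hp).1, Quaternion.coe_commutes]
    have cb : b p * J = J * b p := by
      rw [coe _ (hr p hp).2, Quaternion.coe_commutes]
    have e : J * b p * (J * b' p) = -(b p * b' p) := by
      rw [← cb, mul_assoc, ← mul_assoc J, imSphere_mul_self hJ, neg_one_mul, mul_neg]
    rw [add_mul, mul_add, mul_add, e, ← mul_assoc (a p), ca]
    noncomm_ring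
  · intro p hp
    simp only [h.even_a p hp, h.odd_b p hp, h'.even_a p hp, h'.odd_b p hp, neg_mul_neg]
  · intro p hp
    simp only [h.even_a p hp, h.odd_b p hp, h'.even_a p hp, h'.odd_b p hp]
    noncomm_ring
  · intro p hp
    rw [da p hp, db p hp, h.cauchyRiemann₁ p hp, h'.cauchyRiemann₁ p hp, h.cauchyRiemann₂ p hp,
      h'.cauchyRiemann₂ p hp]
    noncomm_ring
  · intro p hp
    rw [da p hp, db p hp, h.cauchyRiemann₁ p hp, h'.cauchyRiemann₁ p hp, h.cauchyRiemann₂ p hp,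
      h'.cauchyRiemann₂ p hp]
    noncomm_ring

/-- Used with a = 3α and b = 3β: a bounded g preserves decay and absolute convergence when it
multiplies f. -/
theorem Decays.bounded (ha : 1 ≤ a) (hb : b ≤ 1) (h : Decays a b θ f) :
    ∃ M : ℝ, 0 ≤ M ∧ ∀ s ∈ sector θ, ‖f s‖ ≤ M := by
  obtain ⟨δ, hδ, C, hC, h⟩ := h
  refine ⟨C, hC, fun s hs => ?_⟩
  rcases le_total ‖s‖ 1 with h1 | h1
  · refine ((h s hs).1 h1).trans (mul_le_of_le_one_right hC ?_)
    exact Real.rpow_le_one (norm_nonneg _) h1 (by linarith)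
  · refine ((h s hs).2 h1).trans (mul_le_of_le_one_right hC ?_)
    exact Real.rpow_le_one_of_one_le_of_nonpos h1 (by linarith)

theorem Decays.bounded_mul {M : ℝ} (hM : 0 ≤ M) (hg : ∀ s ∈ sector θ, ‖g s‖ ≤ M)
    (h : Decays a b θ f) : Decays a b θ (g * f) := by
  obtain ⟨δ, hδ, C, hC, h⟩ := h
  have key : ∀ s ∈ sector θ, ‖(g * f) s‖ ≤ M * ‖f s‖ := fun s hs => by
    rw [Pi.mul_apply, norm_mul]
    exact mul_le_mul_of_nonneg_right (hg s hs) (norm_nonneg _)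
  refine ⟨δ, hδ, M * C, by positivity, fun s hs => ⟨fun h1 => (key s hs).trans ?_,
    fun h1 => (key s hs).trans ?_⟩⟩
  · rw [mul_assoc]; exact mul_le_mul_of_nonneg_left ((h s hs).1 h1) hM
  · rw [mul_assoc]; exact mul_le_mul_of_nonneg_left ((h s hs).2 h1) hM

theorem Decays.log_decay {E : Type*} [NormedAddCommGroup E] {F : ℂ → E} {δ C : ℝ} (ha : 1 ≤ a)
    (hb : b ≤ 1) (hC : 0 ≤ C) {δ' C' : ℝ} (hδ' : δ' ≤ δ) (hC' : C ≤ C') {η : ℂ}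
    (h : (η.re ≤ 0 → ‖F η‖ ≤ C * Real.exp ((a - 1 + δ) * η.re)) ∧
      (0 ≤ η.re → ‖F η‖ ≤ C * Real.exp ((b - 1 - δ) * η.re))) :
    ‖F η‖ ≤ C' * Real.exp (-δ' * |η.re|) := by
  refine abs_exp_bound (fun hr => (h.1 hr).trans ?_) (fun hr => (h.2 hr).trans ?_)
  · refine mul_le_mul hC' (Real.exp_le_exp.2 ?_) (Real.exp_pos _).le (hC.trans hC')
    exact mul_le_mul_of_nonpos_right (by linarith) hr
  · refine mul_le_mul hC' (Real.exp_le_exp.2 ?_) (Real.exp_pos _).le (hC.trans hC')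
    exact mul_le_mul_of_nonneg_right (by linarith) hr

end FunctionProduct

/-! ### The resolvent equations of the kernels. -/

section ResolventIdentities

variable {E : Type*} [Ring E] [Algebra ℂ E]

-- Here a, a' stand for R(z), R(w), b, b' for R̄(z), R̄(w) and c for w - z, so that ab = ρ(z) and
-- a'b' = ρ(w). In the commutative subalgebra generated by the four elements each identity is a
-- combination of the two resolvent equations.
open scoped IsMulCommutative in
theorem commuting_resolvent_identities {a a' b b' : E} {c : ℂ} (haa : a * a' = a' * a)
    (hbb : b * b' = b' * b) (hab : a * b = b * a) (hab' : a * b' = b' * a) (ha'b : a' * b = b * a')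
    (ha'b' : a' * b' = b' * a') (ha : a - a' = c • (a * a')) (hb : b - b' = c • (b * b')) :
    c • (a * b * a' + b * (a' * b')) = a * b - a' * b' ∧
    c • (a * b * b' + a * (a' * b')) = a * b - a' * b' ∧
    c • (a * (a + b) * a' + a * (a' * (a' + b')) - a * b * a' + a * b * b') =
      a * (a + b) - a' * (a' + b') ∧
    c • (a * (a * b) * a' + a * (a' * (a' * b')) + a * b * (a' * b')) =
      a * (a * b) - a' * (a' * b') := by
  have hcomm : ∀ x ∈ ({a, a', b, b'} : Set E), ∀ y ∈ ({a, a', b, b'} : Set E), x * y = y * x := by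
    rintro x (rfl | rfl | rfl | rfl) y (rfl | rfl | rfl | rfl) <;> first | rfl | assumption |
      exact Eq.symm (by assumption)
  have := Algebra.isMulCommutative_adjoin ℂ hcomm
  let x : Algebra.adjoin ℂ ({a, a', b, b'} : Set E) := ⟨a, Algebra.subset_adjoin (by simp)⟩
  let x' : Algebra.adjoin ℂ ({a, a', b, b'} : Set E) := ⟨a', Algebra.subset_adjoin (by simp)⟩
  let y : Algebra.adjoin ℂ ({a, a', b, b'} : Set E) := ⟨b, Algebra.subset_adjoin (by simp)⟩
  let y' : Algebra.adjoin ℂ ({a, a', b, b'} : Set E) := ⟨b', Algebra.subset_adjoin (by simp)⟩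
  have hx : x - x' = c • (x * x') := Subtype.ext ha
  have hy : y - y' = c • (y * y') := Subtype.ext hb
  rw [Algebra.smul_def] at hx hy
  refine ⟨congrArg Subtype.val (show c • (x * y * x' + y * (x' * y')) = x * y - x' * y' from ?_),
    congrArg Subtype.val (show c • (x * y * y' + x * (x' * y')) = x * y - x' * y' from ?_),
    congrArg Subtype.val (show c • (x * (x + y) * x' + x * (x' * (x' + y')) - x * y * x' +
      x * y * y') = x * (x + y) - x' * (x' + y') from ?_),
    congrArg Subtype.val (show c • (x * (x * y) * x' + x * (x' * (x' * y')) + x * y * (x' * y')) =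
      x * (x * y) - x' * (x' * y') from ?_)⟩ <;> rw [Algebra.smul_def]
  · linear_combination -y * hx - x' * hy
  · linear_combination -x * hy - y' * hx
  · linear_combination -(x + x' + y') * hx - x * hy
  · linear_combination -(x * y + x' * y') * hx - x * x' * hy

end ResolventIdentities

/-! ### Convergence criteria and the general product rule. -/

section Products

variable {V : Type*} [NormedAddCommGroup V] [NormedSpace ℝ V]
  [Module ℍ[ℝ] V] [Module ℍ[ℝ]ᵐᵒᵖ V] [SMulCommClass ℍ[ℝ] ℍ[ℝ]ᵐᵒᵖ V]
  [IsScalarTower ℝ ℍ[ℝ] V] [IsScalarTower ℝ ℍ[ℝ]ᵐᵒᵖ V] [NormSMulClass ℍ[ℝ] V]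
  [NormedSpace ℂ V] [RightComplex V] [CompleteSpace V]

variable {T : RightOp V} {D : Submodule ℍ[ℝ]ᵐᵒᵖ V} {α β ω θ : ℝ} {f g : ℍ[ℝ] → ℍ[ℝ]}
  {F : ℂ → V →L[ℂ] V} {G : ℂ → ℂ}

theorem norm_slice_le {J : ℍ[ℝ]} (hJ : J ∈ imSphere) (K : ℂ → V →L[ℂ] V) (z : ℂ) :
    ‖slice J K z‖ ≤ ‖K z‖ + ‖K (starRingEnd ℂ z)‖ :=
  (norm_add_le _ _).trans (add_le_add
    ((norm_mul_le _ _).trans (mul_le_of_le_one_right (norm_nonneg _) (norm_projP_le hJ)))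
    ((norm_mul_le _ _).trans (mul_le_of_le_one_right (norm_nonneg _) (norm_projM_le hJ))))

/-- The weight `k.order * β` cancels the size of the kernel at infinity exactly, so exp(-δ|Re η|)
remains at both ends. -/
theorem Calculus.converges_of_decays (h : T.IsSectorial D α β ω) (hα : 0 ≤ α)
    (hF : IsSymbol θ f F) (hθ : θ ≤ Real.pi) (k : Calculus)
    (hf : Decays (3 * α) (k.order * β) θ f) : k.Converges T D ω θ f := by
  intro φ hφ J hJ
  obtain ⟨δ, hδ, C, hC, hb⟩ := hf.exp_bound hθ
  obtain ⟨C', hC', hk⟩ := h.kernelC_bound k φ ⟨hφ.1, hφ.2.trans_le hθ⟩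
  have hs : ∀ η : ℂ, |η.im| = φ → ∀ x : ℝ, ‖k.kernelC T D (Complex.exp η)‖ ≤ C' * Real.exp x →
      ‖k.kernelC T D (Complex.exp (starRingEnd ℂ η))‖ ≤ C' * Real.exp x → ∀ y : ℝ,
      ‖f (planePt J (Complex.exp η))‖ ≤ C * Real.exp y →
      ‖k.planeIntegrand T D J f η‖ ≤ 2 * C' * C * Real.exp (η.re + x + y) := by
    intro η hη x hx hx' y hy
    have hm := exp_mem_coSector h.nonneg (hη ▸ hφ.1) (hη ▸ (hφ.2.trans_le hθ).le)
    rw [Complex.exp_conj] at hx'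
    rw [norm_planeIntegrand hJ, h.toIsCoreIn.kernel_planePt hm hJ, norm_toReal, Complex.norm_exp]
    calc _ ≤ (C' * Real.exp x + C' * Real.exp x) * (Real.exp η.re * (C * Real.exp y)) :=
          mul_le_mul ((norm_slice_le hJ _ _).trans (add_le_add hx hx'))
            (mul_le_mul_of_nonneg_left hy (Real.exp_pos _).le) (by positivity) (by positivity)
      _ = _ := by rw [Real.exp_add, Real.exp_add]; ring
  rw [Calculus.integrable_integrand_iff]
  refine contourIntegrable_of_exp_decay (C := 2 * C' * C) (h.nonneg.trans hφ.1.le) (fun η hη =>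
    k.continuousAt_planeIntegrand h.toIsCoreIn hF hθ hJ (hη ▸ hφ.1) (hη ▸ hφ.2)) hδ
    fun η hη => ?_
  have hη' : |(starRingEnd ℂ η).im| = φ := by simpa using hη
  have k1 := hk η hη.ge (hη.trans_le (hφ.2.le.trans hθ))
  have k2 := hk _ hη'.ge (hη'.trans_le (hφ.2.le.trans hθ))
  rw [Complex.conj_re] at k2
  have k3 := hb η (hη.trans_lt hφ.2) J hJ
  refine abs_exp_bound (fun hr => ?_) (fun hr => ?_)
  · refine (hs η hη _ (k1.1 hr) (k2.1 hr) _ (k3.1 hr)).trans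
      (mul_le_mul_of_nonneg_left (Real.exp_le_exp.2 ?_) (by positivity))
    have : 0 ≤ (3 - k.order) * α := mul_nonneg (by linarith [k.order_le_three]) hα
    nlinarith
  · refine (hs η hη _ (k1.2 hr) (k2.2 hr) _ (k3.2 hr)).trans (le_of_eq ?_)
    ring_nf

theorem Calculus.Converges.bounded_mul (h : T.IsCoreIn D ω) {k : Calculus}
    (hF : IsSymbol θ (g * f) F) (hθ : θ ≤ Real.pi) {M : ℝ} (hg : ∀ s ∈ sector θ, ‖g s‖ ≤ M)
    (hf : k.Converges T D ω θ f) : k.Converges T D ω θ (g * f) := by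
  intro φ hφ J hJ
  have h0 : 0 ≤ φ := h.nonneg.trans hφ.1.le
  obtain ⟨i1, i2⟩ := Calculus.integrable_integrand_iff.1 (hf φ hφ J hJ)
  have hc : ∀ c, |c| = φ → Continuous fun u => k.planeIntegrand T D J (g * f) (linePt c u) :=
    fun c hc => continuous_comp_linePt fun η hη => k.continuousAt_planeIntegrand h hF hθ hJ
      (by rw [hη, hc]; exact hφ.1) (by rw [hη, hc]; exact hφ.2)
  have hb : ∀ c u, |c| = φ → ‖k.planeIntegrand T D J (g * f) (linePt c u)‖ ≤
      M * ‖k.planeIntegrand T D J f (linePt c u)‖ := by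
    intro c u hc
    have hs := hg _ (planePt_exp_mem_sector hθ
      (show |(linePt c u).im| < θ by rw [linePt_im, hc]; exact hφ.2) hJ)
    rw [norm_planeIntegrand hJ, norm_planeIntegrand hJ, Pi.mul_apply, norm_mul]
    have := mul_le_mul_of_nonneg_right hs (show 0 ≤
      ‖k.kernel T D (planePt J (Complex.exp (linePt c u)))‖ * (‖Complex.exp (linePt c u)‖ *
        ‖f (planePt J (Complex.exp (linePt c u)))‖) by positivity)
    linarith
  have a1 : |(-φ)| = φ := by rw [abs_neg, abs_of_nonneg h0]
  rw [Calculus.integrable_integrand_iff]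
  exact ⟨(i1.norm.const_mul M).mono' (hc _ a1).aestronglyMeasurable
    (Filter.Eventually.of_forall fun u => hb _ u a1),
    (i2.norm.const_mul M).mono' (hc _ (abs_of_nonneg h0)).aestronglyMeasurable
    (Filter.Eventually.of_forall fun u => hb _ u (abs_of_nonneg h0))⟩

theorem contourIntegral_smul {E : Type*} [NormedAddCommGroup E] [NormedSpace ℂ E]
    (φ : ℝ) (c : ℂ) (H : ℂ → E) :
    contourIntegral φ (fun η => c • H η) = c • contourIntegral φ H := by
  rw [contourIntegral, contourIntegral, integral_smul, integral_smul, smul_sub]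

theorem ContourIntegrable.smul {E : Type*} [NormedAddCommGroup E] [NormedSpace ℂ E]
    {φ : ℝ} (c : ℂ) {H : ℂ → E} (h : ContourIntegrable φ H) :
    ContourIntegrable φ fun η => c • H η :=
  ⟨h.1.smul c, h.2.smul c⟩

/-- A product rule for the calculi follows from an equation for the complex kernels. -/
theorem Calculus.eval_mul_of_kernelC {ι : Type*} [Fintype ι] {k : Calculus}
    {kp kq : ι → Calculus} {Rp Rq : ι → RightOp V} {σ : ι → ℝ}
    (h : T.IsSectorial D α β ω) (hp : ∀ j, (Rp j).IsSectorial D α β ω)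
    (hq : ∀ j, (Rq j).IsSectorial D α β ω)
    (hid : ∀ z ∈ coSector ω, ∀ w ∈ coSector ω, (w - z) • ∑ j, (σ j : ℂ) •
      ((kp j).kernelC (Rp j) D z * (kq j).kernelC (Rq j) D w) = k.kernelC T D z - k.kernelC T D w)
    (hα : 1 / 3 ≤ α) (hβ0 : 0 ≤ β) (hβ : β ≤ 1 / 3) (hω : 0 < ω) (hθ : θ < Real.pi)
    (hG : IsScalarSymbol θ g G) (hF : IsSymbol θ f F)
    (hdg : Decays (3 * α) (3 * β) θ g) (hdf : Decays (3 * α) (3 * β) θ f)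
    (cp : ∀ j, (kp j).Converges (Rp j) D ω θ g) (cq : ∀ j, (kq j).Converges (Rq j) D ω θ f)
    (cg : k.Converges T D ω θ g) (cf : k.Converges T D ω θ f)
    (cgf : k.Converges T D ω θ (g * f)) {φ : ℝ} (hφ : φ ∈ Ioo ω θ) {J : ℍ[ℝ]}
    (hJ : J ∈ imSphere) :
    k.eval T D φ J (g * f) =
      ∑ j, σ j • ((kp j).eval (Rp j) D φ J g * (kq j).eval (Rq j) D φ J f) := by
  have hα0 : 0 ≤ α := by linarith
  -- The integral of f is moved to a larger angle φ', which separates the two contours; its value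
  -- does not change.
  obtain ⟨φ', hφφ', hφ'θ⟩ := exists_between hφ.2
  have hφ' : φ' ∈ Ioo ω θ := ⟨hφ.1.trans hφφ', hφ'θ⟩
  obtain ⟨δ₁, hδ₁, C₁, hC₁, b₁⟩ := hG.exp_bound hθ.le hdg
  obtain ⟨δ₂, hδ₂, C₂, hC₂, b₂⟩ := hF.exp_bound hθ.le hdf
  have hG1 : IsSymbol θ g fun η => G η • (1 : V →L[ℂ] V) := hG.isSymbol
  have lg : ∀ (k : Calculus) (T : RightOp V), k.logIntegrand T D (fun η => G η • 1) = fun ζ =>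
      Complex.exp ζ • G ζ • k.kernelC T D (Complex.exp ζ) := fun k T => funext fun ζ => by
    rw [logIntegrand, mul_smul_comm, mul_one]
  have ig : ∀ (k : Calculus) (R : RightOp V), R.IsSectorial D α β ω → k.Converges R D ω θ g →
      ContourIntegrable φ fun ζ => Complex.exp ζ • G ζ • k.kernelC R D (Complex.exp ζ) := by
    intro k R hR hc
    rw [← lg]
    exact contourIntegrable_of_integrable hR.toIsCoreIn hG1 hθ.le hφ hJ (hc φ hφ J hJ)
  have if' : ∀ (k : Calculus) (R : RightOp V), R.IsSectorial D α β ω → k.Converges R D ω θ f →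
      ∀ φ ∈ Ioo ω θ, ContourIntegrable φ (k.logIntegrand R D F) := fun k R hR hc φ hφ =>
    contourIntegrable_of_integrable hR.toIsCoreIn hF hθ.le hφ hJ (hc φ hφ J hJ)
  have hmem : ∀ η : ℂ, ∀ φ ∈ Ioo ω θ, |η.im| = φ → Complex.exp η ∈ coSector ω :=
    fun η φ hφ hη => exp_mem_coSector hω.le (hη ▸ hφ.1) (hη ▸ (hφ.2.trans hθ).le)
  have hlin : ∀ j, (fun η => Complex.exp η •
      (((σ j : ℂ) • (kq j).kernelC (Rq j) D (Complex.exp η)) * F η)) =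
      fun η => (σ j : ℂ) • (kq j).logIntegrand (Rq j) D F η := fun j => funext fun η => by
    rw [logIntegrand, smul_mul_assoc, smul_comm]
  have main := sum_contourIntegral_mul (K := fun η => k.kernelC T D (Complex.exp η))
    (p := fun j η => (kp j).kernelC (Rp j) D (Complex.exp η))
    (q := fun j η => (σ j : ℂ) • (kq j).kernelC (Rq j) D (Complex.exp η)) (G := G) (F := F)
    (C := max C₁ C₂) (δ := min δ₁ δ₂)
    (hω.trans hφ.1) hφφ' hφ'θ hθ (lt_min hδ₁ hδ₂) hF.differentiableAt
    (fun η hη => Decays.log_decay (by linarith) (by linarith) hC₂ (min_le_right _ _)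
      (le_max_right _ _) (b₂ η hη)) hG.differentiableAt
    (fun η hη => Decays.log_decay (by linarith) (by linarith) hC₁ (min_le_left _ _)
      (le_max_left _ _) (b₁ η hη))
    (fun ζ η hζ hη => by
      simp_rw [mul_smul_comm]
      exact hid _ (hmem ζ φ hφ hζ) _ (hmem η φ' hφ' hη))
    (fun j => ig _ _ (hp j) (cp j))
    (fun j => by
      rw [hlin]
      exact (if' _ _ (hq j) (cq j) φ' hφ').smul _)
    (ig k T h cg) (if' k T h cf φ' hφ')
  rw [eval_eq h.toIsCoreIn (hG.isSymbol_mul hF) hθ.le hφ hJ (cgf φ hφ J hJ)]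
  have ep : ∀ j, (kp j).eval (Rp j) D φ J g = toReal ((2 * Real.pi * Complex.I)⁻¹ •
      contourIntegral φ fun ζ => Complex.exp ζ • G ζ • (kp j).kernelC (Rp j) D (Complex.exp ζ)) := by
    intro j
    rw [eval_eq (hp j).toIsCoreIn hG1 hθ.le hφ hJ (cp j φ hφ J hJ), lg]
  have eq : ∀ j, (kq j).eval (Rq j) D φ J f = toReal ((2 * Real.pi * Complex.I)⁻¹ •
      contourIntegral φ' ((kq j).logIntegrand (Rq j) D F)) := by
    intro j
    rw [eval_eq (hq j).toIsCoreIn hF hθ.le hφ hJ (cq j φ hφ J hJ),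
      contourIntegral_logIntegrand_eq (hq j) hα0 hβ0 hβ hF hθ (kq j) hdf
        (if' _ _ (hq j) (cq j)) hφ hφ']
  have hI : (2 * Real.pi * Complex.I : ℂ) ≠ 0 := Complex.two_pi_I_ne_zero
  -- Cauchy's formula supplies the factor 2πi that balances the two normalizations of the product
  -- against the single one on the left.
  have e1 : contourIntegral φ (k.logIntegrand T D fun η => G η • F η) =
      (2 * Real.pi * Complex.I : ℂ)⁻¹ • ∑ j, (σ j : ℂ) • (contourIntegral φ
        (fun ζ => Complex.exp ζ • G ζ • (kp j).kernelC (Rp j) D (Complex.exp ζ)) *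
        contourIntegral φ' ((kq j).logIntegrand (Rq j) D F)) := by
    rw [eq_inv_smul_iff₀ hI]
    refine main.symm.trans (Finset.sum_congr rfl fun j _ => ?_)
    rw [hlin, contourIntegral_smul, mul_smul_comm]
  rw [e1, Finset.smul_sum, Finset.smul_sum]
  let ψ : (V →L[ℂ] V) →+ (V →L[ℝ] V) := AddMonoidHom.mk' toReal toReal_add
  change ψ _ = _
  rw [map_sum]
  refine Finset.sum_congr rfl fun j _ => ?_
  rw [ep, eq, ← toReal_mul, ← toReal_real_smul]
  change toReal _ = _
  rw [smul_mul_smul_comm, smul_smul, smul_comm]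

end Products

/-! ### The individual product rules. -/

section ProductRules

variable {V : Type*} [NormedAddCommGroup V] [NormedSpace ℝ V]
  [Module ℍ[ℝ] V] [Module ℍ[ℝ]ᵐᵒᵖ V] [SMulCommClass ℍ[ℝ] ℍ[ℝ]ᵐᵒᵖ V]
  [IsScalarTower ℝ ℍ[ℝ] V] [IsScalarTower ℝ ℍ[ℝ]ᵐᵒᵖ V] [NormSMulClass ℍ[ℝ] V]
  [NormedSpace ℂ V] [RightComplex V] [CompleteSpace V]

variable {T : RightOp V} {D : Submodule ℍ[ℝ]ᵐᵒᵖ V} {α β ω θ φ : ℝ} {J : ℍ[ℝ]}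
  {f g : ℍ[ℝ] → ℍ[ℝ]} {F : ℂ → V →L[ℂ] V} {G : ℂ → ℂ}

/-- The resolvent equations of the complex kernels of the four calculi. -/
theorem RightOp.IsCoreIn.kernelC_identities (h : T.IsCoreIn D ω) {z w : ℂ}
    (hz : z ∈ coSector ω) (hw : w ∈ coSector ω) :
    (w - z) • (T.rho D z * T.resol D w + T.conj.resol D z * T.rho D w) =
      T.rho D z - T.rho D w ∧
    (w - z) • (T.rho D z * T.conj.resol D w + T.resol D z * T.rho D w) =
      T.rho D z - T.rho D w ∧
    (w - z) • (T.resol D z * (T.resol D z + T.conj.resol D z) * T.resol D w +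
      T.resol D z * (T.resol D w * (T.resol D w + T.conj.resol D w)) -
      T.rho D z * T.resol D w + T.rho D z * T.conj.resol D w) =
      T.resol D z * (T.resol D z + T.conj.resol D z) -
        T.resol D w * (T.resol D w + T.conj.resol D w) ∧
    (w - z) • (T.resol D z * T.rho D z * T.resol D w + T.resol D z * (T.resol D w * T.rho D w) +
      T.rho D z * T.rho D w) = T.resol D z * T.rho D z - T.resol D w * T.rho D w := by
  have := commuting_resolvent_identities (h.resol_comm hz hw) (h.conj.resol_comm hz hw)
    (h.resol_conj_comm hz hz) (h.resol_conj_comm hz hw) (h.resol_conj_comm hw hz)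
    (h.resol_conj_comm hw hw) (h.resol_sub_resol hz hw) (h.conj.resol_sub_resol hz hw)
  simpa only [h.resol_mul_conj_resol hz, h.resol_mul_conj_resol hw] using this

section

variable (h : T.IsSectorial D α β ω) (hα : 1 / 3 ≤ α) (hβ0 : 0 ≤ β) (hβ : β ≤ 1 / 3)
  (hω : 0 < ω) (hθ : θ < Real.pi) (hG : IsScalarSymbol θ g G) (hF : IsSymbol θ f F)
  (hdg : Decays (3 * α) (3 * β) θ g) (hdf : Decays (3 * α) (3 * β) θ f)

include h hα hβ0 hβ hω hθ hG hF hdg hdf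

theorem Calculus.eval_S_mul (sg : Calculus.S.Converges T D ω θ g)
    (sf : Calculus.S.Converges T D ω θ f) (sgf : Calculus.S.Converges T D ω θ (g * f))
    (hφ : φ ∈ Ioo ω θ) (hJ : J ∈ imSphere) : Calculus.S.eval T D φ J (g * f) =
      Calculus.S.eval T D φ J g * Calculus.S.eval T D φ J f := by
  have := Calculus.eval_mul_of_kernelC (k := .S) (kp := ![.S]) (kq := ![.S]) (Rp := ![T])
    (Rq := ![T]) (σ := ![1]) h (by simpa using h) (by simpa using h) (fun z hz w hw => by
      simpa [Calculus.kernelC] using (h.toIsCoreIn.resol_sub_resol hz hw).symm)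
    hα hβ0 hβ hω hθ hG hF hdg hdf (by simpa using sg) (by simpa using sf) sg sf sgf hφ hJ
  simpa using this

theorem Calculus.eval_Q_mul (qg : Calculus.Q.Converges T D ω θ g)
    (sf : Calculus.S.Converges T D ω θ f) (sg : Calculus.S.Converges T.conj D ω θ g)
    (qf : Calculus.Q.Converges T D ω θ f) (qgf : Calculus.Q.Converges T D ω θ (g * f))
    (hφ : φ ∈ Ioo ω θ) (hJ : J ∈ imSphere) : Calculus.Q.eval T D φ J (g * f) =
      Calculus.Q.eval T D φ J g * Calculus.S.eval T D φ J f +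
        Calculus.S.eval T.conj D φ J g * Calculus.Q.eval T D φ J f := by
  have := Calculus.eval_mul_of_kernelC (k := .Q) (kp := ![.Q, .S]) (kq := ![.S, .Q])
    (Rp := ![T, T.conj]) (Rq := ![T, T]) (σ := ![1, 1]) h
    (by simpa [Fin.forall_fin_two] using ⟨h, h.conj⟩) (by simpa [Fin.forall_fin_two] using h)
    (fun z hz w hw => by
      have e := congrArg ((-2 : ℂ) • ·) (h.toIsCoreIn.kernelC_identities hz hw).1
      simp only [Fin.sum_univ_two, Matrix.cons_val_zero, Matrix.cons_val_one, Calculus.kernelC,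
        Complex.ofReal_one, one_smul, smul_mul_assoc, mul_smul_comm]
      rw [← smul_sub, ← e]
      module)
    hα hβ0 hβ hω hθ hG hF hdg hdf (by simpa [Fin.forall_fin_two] using ⟨qg, sg⟩)
    (by simpa [Fin.forall_fin_two] using ⟨sf, qf⟩) qg qf qgf hφ hJ
  simpa using this

theorem Calculus.eval_Q_mul' (qg : Calculus.Q.Converges T D ω θ g)
    (sf : Calculus.S.Converges T.conj D ω θ f) (sg : Calculus.S.Converges T D ω θ g)
    (qf : Calculus.Q.Converges T D ω θ f) (qgf : Calculus.Q.Converges T D ω θ (g * f))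
    (hφ : φ ∈ Ioo ω θ) (hJ : J ∈ imSphere) : Calculus.Q.eval T D φ J (g * f) =
      Calculus.Q.eval T D φ J g * Calculus.S.eval T.conj D φ J f +
        Calculus.S.eval T D φ J g * Calculus.Q.eval T D φ J f := by
  have := Calculus.eval_mul_of_kernelC (k := .Q) (kp := ![.Q, .S]) (kq := ![.S, .Q])
    (Rp := ![T, T]) (Rq := ![T.conj, T]) (σ := ![1, 1]) h
    (by simpa [Fin.forall_fin_two] using h) (by simpa [Fin.forall_fin_two] using ⟨h.conj, h⟩)
    (fun z hz w hw => by
      have e := congrArg ((-2 : ℂ) • ·) (h.toIsCoreIn.kernelC_identities hz hw).2.1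
      simp only [Fin.sum_univ_two, Matrix.cons_val_zero, Matrix.cons_val_one, Calculus.kernelC,
        Complex.ofReal_one, one_smul, smul_mul_assoc, mul_smul_comm]
      rw [← smul_sub, ← e]
      module)
    hα hβ0 hβ hω hθ hG hF hdg hdf (by simpa [Fin.forall_fin_two] using ⟨qg, sg⟩)
    (by simpa [Fin.forall_fin_two] using ⟨sf, qf⟩) qg qf qgf hφ hJ
  simpa using this

theorem Calculus.eval_P2_mul (pg : Calculus.P2.Converges T D ω θ g)
    (sf : Calculus.S.Converges T D ω θ f) (sg : Calculus.S.Converges T D ω θ g)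
    (pf : Calculus.P2.Converges T D ω θ f) (qg : Calculus.Q.Converges T D ω θ g)
    (sf' : Calculus.S.Converges T.conj D ω θ f) (pgf : Calculus.P2.Converges T D ω θ (g * f))
    (hφ : φ ∈ Ioo ω θ) (hJ : J ∈ imSphere) : Calculus.P2.eval T D φ J (g * f) =
      Calculus.P2.eval T D φ J g * Calculus.S.eval T D φ J f +
        Calculus.S.eval T D φ J g * Calculus.P2.eval T D φ J f +
        Calculus.Q.eval T D φ J g *
          (Calculus.S.eval T D φ J f - Calculus.S.eval T.conj D φ J f) := by
  have := Calculus.eval_mul_of_kernelC (k := .P2) (kp := ![.P2, .S, .Q, .Q])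
    (kq := ![.S, .P2, .S, .S]) (Rp := ![T, T, T, T]) (Rq := ![T, T, T, T.conj])
    (σ := ![1, 1, 1, -1]) h
    (by simpa [Fin.forall_fin_succ] using h) (by simpa [Fin.forall_fin_succ] using ⟨h, h.conj⟩)
    (fun z hz w hw => by
      have e := congrArg ((2 : ℂ) • ·) (h.toIsCoreIn.kernelC_identities hz hw).2.2.1
      simp only [Fin.sum_univ_four, Matrix.cons_val, Calculus.kernelC,
        Complex.ofReal_one, Complex.ofReal_neg, one_smul, smul_mul_assoc, mul_smul_comm]
      rw [← smul_sub, ← e]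
      module)
    hα hβ0 hβ hω hθ hG hF hdg hdf (by simpa [Fin.forall_fin_succ] using ⟨pg, sg, qg⟩)
    (by simpa [Fin.forall_fin_succ] using ⟨sf, pf, sf, sf'⟩) pg pf pgf hφ hJ
  rw [this]
  simp only [Fin.sum_univ_four, Matrix.cons_val, one_smul, neg_smul, mul_sub]
  abel

theorem Calculus.eval_F_mul (fg : Calculus.F.Converges T D ω θ g)
    (sf : Calculus.S.Converges T D ω θ f) (sg : Calculus.S.Converges T D ω θ g)
    (ff : Calculus.F.Converges T D ω θ f) (qg : Calculus.Q.Converges T D ω θ g)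
    (qf : Calculus.Q.Converges T D ω θ f) (fgf : Calculus.F.Converges T D ω θ (g * f))
    (hφ : φ ∈ Ioo ω θ) (hJ : J ∈ imSphere) : Calculus.F.eval T D φ J (g * f) =
      Calculus.F.eval T D φ J g * Calculus.S.eval T D φ J f +
        Calculus.S.eval T D φ J g * Calculus.F.eval T D φ J f -
        Calculus.Q.eval T D φ J g * Calculus.Q.eval T D φ J f := by
  have := Calculus.eval_mul_of_kernelC (k := .F) (kp := ![.F, .S, .Q])
    (kq := ![.S, .F, .Q]) (Rp := ![T, T, T]) (Rq := ![T, T, T])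
    (σ := ![1, 1, -1]) h
    (by simpa [Fin.forall_fin_succ] using h) (by simpa [Fin.forall_fin_succ] using h)
    (fun z hz w hw => by
      have e := congrArg ((-4 : ℂ) • ·) (h.toIsCoreIn.kernelC_identities hz hw).2.2.2
      simp only [Fin.sum_univ_three, Matrix.cons_val, Calculus.kernelC,
        Complex.ofReal_one, Complex.ofReal_neg, one_smul, smul_mul_assoc, mul_smul_comm]
      rw [← smul_sub, ← e]
      module)
    hα hβ0 hβ hω hθ hG hF hdg hdf (by simpa [Fin.forall_fin_succ] using ⟨fg, sg, qg⟩)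
    (by simpa [Fin.forall_fin_succ] using ⟨sf, ff, qf⟩) fg ff fgf hφ hJ
  rw [this]
  simp only [Fin.sum_univ_three, Matrix.cons_val, one_smul, neg_smul, sub_eq_add_neg]

end

/-- The value of a calculus depends neither on the angle nor on the imaginary unit. -/
theorem Calculus.Converges.eval_eq_eval {k : Calculus} (h : T.IsSectorial D α β ω) (hα : 0 ≤ α)
    (hβ0 : 0 ≤ β) (hβ : β ≤ 1 / 3) (hF : IsSymbol θ f F) (hθ : θ < Real.pi)
    (hf : Decays (3 * α) (3 * β) θ f) (hc : k.Converges T D ω θ f) {φ' : ℝ} {J' : ℍ[ℝ]}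
    (hφ : φ ∈ Ioo ω θ) (hφ' : φ' ∈ Ioo ω θ) (hJ : J ∈ imSphere) (hJ' : J' ∈ imSphere) :
    k.eval T D φ J f = k.eval T D φ' J' f := by
  rw [Calculus.eval_eq h.toIsCoreIn hF hθ.le hφ hJ (hc φ hφ J hJ),
    Calculus.eval_eq h.toIsCoreIn hF hθ.le hφ' hJ' (hc φ' hφ' J' hJ'),
    Calculus.contourIntegral_logIntegrand_eq h hα hβ0 hβ hF hθ k hf (fun ψ hψ =>
      Calculus.contourIntegrable_of_integrable h.toIsCoreIn hF hθ.le hψ hJ (hc ψ hψ J hJ)) hφ hφ']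

end ProductRules

end

end FineStructure

/-! ### Assembly of the theorem. -/

theorem mainTheorem3 {V : Type*} [NormedAddCommGroup V] [NormedSpace ℝ V] [CompleteSpace V]
    [Module ℍ[ℝ] V] [Module ℍ[ℝ]ᵐᵒᵖ V] [SMulCommClass ℍ[ℝ] ℍ[ℝ]ᵐᵒᵖ V]
    [IsScalarTower ℝ ℍ[ℝ] V] [IsScalarTower ℝ ℍ[ℝ]ᵐᵒᵖ V]
    [NormSMulClass ℍ[ℝ] V] [NormSMulClass ℍ[ℝ]ᵐᵒᵖ V]
    (α β ω θ : ℝ) (hα : 1 / 3 ≤ α) (hβ : β ∈ Ioc (0 : ℝ) (1 / 3)) (hω : ω ∈ Ioo 0 Real.pi)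
    (hθ : θ ∈ Ioo ω Real.pi)
    (T : RightOp V) (D : Submodule ℍ[ℝ]ᵐᵒᵖ V) (hT : T.IsOfType D α β ω) :
    -- the defining integrals converge for functions that decay fast enough for the kernel
    (∀ k : Calculus, ∀ h ∈ PsiL (3 * α) (k.order * β) θ,
      k.Converges T D ω θ h ∧ k.Converges T.conj D ω θ h) ∧
    -- whenever they converge, they depend neither on the angle nor on the imaginary unit
    (∀ k : Calculus, ∀ h ∈ PsiL (3 * α) (3 * β) θ, ∀ R ∈ ({T, T.conj} : Set (RightOp V)),
      k.Converges R D ω θ h →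
        ∀ φ ∈ Ioo ω θ, ∀ φ' ∈ Ioo ω θ, ∀ J ∈ imSphere, ∀ J' ∈ imSphere,
          k.eval R D φ J h = k.eval R D φ' J' h) ∧
    -- the four product rules, whenever the terms on the right hand side are defined
    (∀ g ∈ Psi (3 * α) (3 * β) θ, ∀ f ∈ PsiL (3 * α) (3 * β) θ,
      g * f ∈ PsiL (3 * α) (3 * β) θ ∧
      (Calculus.S.Converges T D ω θ g → Calculus.S.Converges T D ω θ f →
        Calculus.S.Converges T D ω θ (g * f) ∧
        ∀ φ ∈ Ioo ω θ, ∀ J ∈ imSphere,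
          Calculus.S.eval T D φ J (g * f) =
            Calculus.S.eval T D φ J g * Calculus.S.eval T D φ J f) ∧
      (Calculus.Q.Converges T D ω θ g → Calculus.S.Converges T D ω θ f →
        Calculus.S.Converges T.conj D ω θ g → Calculus.Q.Converges T D ω θ f →
        Calculus.Q.Converges T D ω θ (g * f) ∧
        ∀ φ ∈ Ioo ω θ, ∀ J ∈ imSphere,
          Calculus.Q.eval T D φ J (g * f) =
            Calculus.Q.eval T D φ J g * Calculus.S.eval T D φ J f +
              Calculus.S.eval T.conj D φ J g * Calculus.Q.eval T D φ J f) ∧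
      (Calculus.Q.Converges T D ω θ g → Calculus.S.Converges T.conj D ω θ f →
        Calculus.S.Converges T D ω θ g → Calculus.Q.Converges T D ω θ f →
        Calculus.Q.Converges T D ω θ (g * f) ∧
        ∀ φ ∈ Ioo ω θ, ∀ J ∈ imSphere,
          Calculus.Q.eval T D φ J (g * f) =
            Calculus.Q.eval T D φ J g * Calculus.S.eval T.conj D φ J f +
              Calculus.S.eval T D φ J g * Calculus.Q.eval T D φ J f) ∧
      (Calculus.P2.Converges T D ω θ g → Calculus.S.Converges T D ω θ f →
        Calculus.S.Converges T D ω θ g → Calculus.P2.Converges T D ω θ f →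
        Calculus.Q.Converges T D ω θ g → Calculus.S.Converges T.conj D ω θ f →
        Calculus.P2.Converges T D ω θ (g * f) ∧
        ∀ φ ∈ Ioo ω θ, ∀ J ∈ imSphere,
          Calculus.P2.eval T D φ J (g * f) =
            Calculus.P2.eval T D φ J g * Calculus.S.eval T D φ J f +
              Calculus.S.eval T D φ J g * Calculus.P2.eval T D φ J f +
              Calculus.Q.eval T D φ J g *
                (Calculus.S.eval T D φ J f - Calculus.S.eval T.conj D φ J f)) ∧
      (Calculus.S.Converges T D ω θ f → Calculus.S.Converges T D ω θ g →
        Calculus.Q.Converges T D ω θ g → Calculus.Q.Converges T D ω θ f →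
        Calculus.F.Converges T D ω θ (g * f) ∧
        ∀ φ ∈ Ioo ω θ, ∀ J ∈ imSphere,
          Calculus.F.eval T D φ J (g * f) =
            Calculus.F.eval T D φ J g * Calculus.S.eval T D φ J f +
              Calculus.S.eval T D φ J g * Calculus.F.eval T D φ J f -
              Calculus.Q.eval T D φ J g * Calculus.Q.eval T D φ J f)) := by
  let : NormedSpace ℂ V := rightComplexSpace V
  have := rightComplex_rightComplexSpace V
  have h0 : 0 ≤ θ := (hω.1.trans hθ.1).le
  have hα0 : 0 ≤ α := by linarith
  have hS := hT.isSectorial hω.1.le hω.2.le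
  refine ⟨fun k h hh => ?_, fun k h hh R hR hc φ hφ φ' hφ' J hJ J' hJ' => ?_,
    fun g hg f hf => ?_⟩
  · obtain ⟨F, hF⟩ := exists_isSymbol (V := V) h0 hθ.2.le hh.1
    exact ⟨k.converges_of_decays hS hα0 hF hθ.2.le hh.2,
      k.converges_of_decays hS.conj hα0 hF hθ.2.le hh.2⟩
  · obtain ⟨F, hF⟩ := exists_isSymbol (V := V) h0 hθ.2.le hh.1
    have hR' : R.IsSectorial D α β ω := by
      rcases hR with rfl | rfl
      · exact hS
      · exact hS.conj
    exact hc.eval_eq_eval hR' hα0 hβ.1.le hβ.2 hF hθ.2 hh.2 hφ hφ' hJ hJ'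
  · obtain ⟨F, hF⟩ := exists_isSymbol (V := V) h0 hθ.2.le hf.1
    obtain ⟨G, hG⟩ := exists_isScalarSymbol h0 hθ.2.le hg.1
    obtain ⟨M, hM0, hM⟩ := hg.2.bounded (by linarith) (by linarith [hβ.2])
    have hgF := hG.isSymbol_mul hF
    have conv : ∀ {k : Calculus}, k.Converges T D ω θ f → k.Converges T D ω θ (g * f) :=
      fun hc => hc.bounded_mul hS.toIsCoreIn hgF hθ.2.le hM
    refine ⟨⟨IsLeftSlice.intrinsic_mul h0 hθ.2.le hg.1 hf.1, hf.2.bounded_mul hM0 hM⟩,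
      fun sg sf => ⟨conv sf, fun φ hφ J hJ => ?_⟩,
      fun qg sf sg qf => ⟨conv qf, fun φ hφ J hJ => ?_⟩,
      fun qg sf sg qf => ⟨conv qf, fun φ hφ J hJ => ?_⟩,
      fun pg sf sg pf qg sf' => ⟨conv pf, fun φ hφ J hJ => ?_⟩,
      fun sf sg qg qf => ?_⟩
    · exact Calculus.eval_S_mul hS hα hβ.1.le hβ.2 hω.1 hθ.2 hG hF hg.2 hf.2 sg sf (conv sf) hφ hJ
    · exact Calculus.eval_Q_mul hS hα hβ.1.le hβ.2 hω.1 hθ.2 hG hF hg.2 hf.2 qg sf sg qf (conv qf)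
        hφ hJ
    · exact Calculus.eval_Q_mul' hS hα hβ.1.le hβ.2 hω.1 hθ.2 hG hF hg.2 hf.2 qg sf sg qf
        (conv qf) hφ hJ
    · exact Calculus.eval_P2_mul hS hα hβ.1.le hβ.2 hω.1 hθ.2 hG hF hg.2 hf.2 pg sf sg pf qg sf'
        (conv pf) hφ hJ
    -- The F-calculus has order 3, so the decay assumed of f and g already makes it converge.
    · have ff : Calculus.F.Converges T D ω θ f :=
        Calculus.F.converges_of_decays hS hα0 hF hθ.2.le hf.2
      have fg : Calculus.F.Converges T D ω θ g :=
        Calculus.F.converges_of_decays hS hα0 (hG.isSymbol (V := V)) hθ.2.le hg.2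
      exact ⟨conv ff, fun φ hφ J hJ => Calculus.eval_F_mul hS hα hβ.1.le hβ.2 hω.1 hθ.2 hG hF
        hg.2 hf.2 fg sf sg ff qg qf (conv ff) hφ hJ⟩
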